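/- Let $(K,d)$ be a non-empty metric space in which sets of finite diameter are relatively compact, and let $(V,E,i,t)$ be a finite directed multigraph ($i(e)$, $t(e)$ are the initial and terminal vertex of the edge $e$). A \emph{Markov system} $(K_{i(e)},w_e,p_e)_{e\in E}$ consists of a partition $(K_v)_{v\in V}$ of $K$ into non-empty Borel sets, Borel maps $w_e:K\to K$ with $w_e(K_{i(e)})\subset K_{t(e)}$, and Borel functions $p_e\ge 0$ on $K$ with $\sum_{e\in E}p_e=1$ and $p_e=0$ off $K_{i(e)}$. It is \emph{irreducible} if its graph is, and \emph{contractive} (a CMS) if for some $0<a<1$ we have $\sum_{e\in E}p_e(x)\,d(w_ex,w_ey)\le a\,d(x,y)$ for all $x,y\in K_v$, $v\in V$. A Borel probability measure $\mu$ on $K$ is \emph{invariant} if $\int\sum_{e}p_e\cdot f\circ w_e\,d\mu=\int f\,d\mu$ for all bounded Borel $f:K\to\mathbb R$. Let $\Sigma=E^{\mathbb Z}$ with the product topology and left shift $S$. The \emph{generalized Markov measure} $M$ of an invariant $\mu$ is the Borel measure on $\Sigma$ with \[M(\{\sigma:\sigma_m=e_1,\dots,\sigma_{m+k-1}=e_k\})=\int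 p_{e_1}(x)\,p_{e_2}(w_{e_1}x)\cdots p_{e_k}(w_{e_{k-1}}\circ\dots\circ w_{e_1}x)\,d\mu(x)\] for all $m\in\mathbb Z$ and all words $e_1\dots e_k$. Fix $x_v\in K_v$ for each $v\in V$. Put $\Sigma_G=\{\sigma\in\Sigma: t(\sigma_j)=i(\sigma_{j+1})\ \forall j\in\mathbb Z\}$ and $F(\sigma)=\lim_{m\to-\infty}w_{\sigma_0}\circ w_{\sigma_{-1}}\circ\dots\circ w_{\sigma_m}x_{i(\sigma_m)}$ where the limit exists; let $D$ be the set of $\sigma\in\Sigma_G$ for which it exists, and $Y=\bigcap_{k\in\mathbb Z}S^k(D)$. Let $u(\sigma)=\log p_{\sigma_1}(F(\sigma))$ for $\sigma\in Y$ and $u(\sigma)=-\infty$ for $\sigma\in\Sigma\setminus Y$. For a Borel function $f:\Sigma\to[-\infty,0]$ (an \emph{energy function}) the \emph{pressure} is $P(f)=\sup_\Theta\left(h_\Theta(S)+\int f\,d\Theta\right)$, the supremum over all $S$-invariant Borel probability measures $\Theta$ on $\Sigma$, where $h_\Theta(S)$ is the Kolmogorov--Sinai entropy; an \emph{equilibrium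 state} for $f$ is an $S$-invariant Borel probability measure at which the supremum is attained. A function $h$ on a metric space is \emph{Dini-continuous} if $\int_0^c\phi(t)/t\,dt<\infty$ for some $c>0$, where $\phi(t)=\sup\{|h(x)-h(y)|:d(x,y)\le t\}$. \textbf{Corollary 1.} Suppose that $(K_{i(e)},w_e,p_e)_{e\in E}$ is an irreducible CMS, that every $K_v$ is open, and that every $p_e|_{K_{i(e)}}$ is Dini-continuous and bounded away from zero. Then $u$ is an energy function, there is exactly one invariant Borel probability measure $\mu$, its generalized Markov measure $M$ exists and is unique, and: (i) $M$ is the unique equilibrium state for $u$; (ii) $P(u)=0$; (iii) $M(Y)=1$ (so that $F$ is defined $M$-almost everywhere), and $F(M)=\mu$; (iv) $h_M(S)=-\sum_{e\in E}\int_{K_{i(e)}}p_e\log p_e\,d\mu$. -/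

import Mathlib

open MeasureTheory Filter Topology
open scoped ENNReal

/-! ### Entropy, pressure and equilibrium states -/

section Thermodynamics

variable {X : Type*} [MeasurableSpace X]

/-- Shannon entropy of the finite partition of `X` into the level sets of `ξ`. -/
noncomputable def partitionEntropy {ι : Type*} [Fintype ι] (μ : Measure X) (ξ : X → ι) : ℝ :=
  ∑ j, Real.negMulLog (μ.real (ξ ⁻¹' {j}))

/-- The level sets of `itinerary T ξ n` form the joined partition
`ξ ∨ T⁻¹ξ ∨ ⋯ ∨ T⁻⁽ⁿ⁻¹⁾ξ`. -/
def itinerary {ι : Type*} (T : X → X) (ξ : X → ι) (n : ℕ) : X → Fin n → ι :=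
  fun x k => ξ (T^[k] x)

/-- Kolmogorov–Sinai entropy of `T` with respect to the invariant probability measure `μ`: the
supremum over all finite measurable partitions of the entropy rate of the partition (for invariant
`μ` the upper limit below is a limit). -/
noncomputable def ksEntropy (T : X → X) (μ : Measure X) : EReal :=
  ⨆ (k : ℕ) (ξ : X → Fin k) (_ : Measurable ξ),
    limsup (fun n : ℕ => ((partitionEntropy μ (itinerary T ξ n) / n : ℝ) : EReal)) atTop

/-- A Borel measurable function with values in `[-∞, 0]`. -/
def IsEnergyFunction (f : X → EReal) : Prop :=
  Measurable f ∧ ∀ x, f x ≤ 0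

/-- The integral, with values in `[-∞, 0]`, of a measurable function with values in `[-∞, 0]`. -/
noncomputable def energyIntegral (μ : Measure X) (f : X → EReal) : EReal :=
  -((∫⁻ x, (-f x).toENNReal ∂μ : ℝ≥0∞) : EReal)

/-- `Θ` is a `T`-invariant probability measure. -/
def IsInvariantProb (T : X → X) (Θ : Measure X) : Prop :=
  IsProbabilityMeasure Θ ∧ MeasurePreserving T Θ Θ

/-- The pressure of an energy function `f` (for a transformation of finite topological entropy). -/
noncomputable def pressure (T : X → X) (f : X → EReal) : EReal :=
  ⨆ (Θ : Measure X) (_ : IsInvariantProb T Θ), (ksEntropy T Θ + energyIntegral Θ f)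

/-- `Λ` is an equilibrium state for the energy function `f`. -/
def IsEquilibriumState (T : X → X) (f : X → EReal) (Λ : Measure X) : Prop :=
  IsInvariantProb T Λ ∧ ksEntropy T Λ + energyIntegral Λ f = pressure T f

end Thermodynamics

/-! ### Dini continuity -/

section Dini

variable {X : Type*} [PseudoMetricSpace X]

/-- The modulus of uniform continuity of the restriction of `h` to `s`, with values in `[0, ∞]`. -/
noncomputable def modulusOn (h : X → ℝ) (s : Set X) (t : ℝ) : ℝ≥0∞ :=
  ⨆ (x ∈ s) (y ∈ s) (_ : dist x y ≤ t), ENNReal.ofReal |h x - h y|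

/-- The restriction of `h` to `s` is Dini-continuous. -/
def DiniContinuousOn (h : X → ℝ) (s : Set X) : Prop :=
  ∃ c : ℝ, 0 < c ∧ ∫⁻ t in Set.Ioc 0 c, modulusOn h s t / ENNReal.ofReal t < ⊤

end Dini

/-! ### The code space -/

section CodeSpace

variable {E : Type*}

/-- The `k`-th power of the left shift on the two-sided code space. -/
def shiftBy (k : ℤ) (σ : ℤ → E) : ℤ → E := fun n => σ (n + k)

/-- The left shift `S`. -/
def leftShift : (ℤ → E) → (ℤ → E) := shiftBy 1

/-- The cylinder of all `σ` in which the word `l` occurs at the places `m, m + 1, …`. -/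
def cylinderAt (m : ℤ) (l : List E) : Set (ℤ → E) :=
  {σ | ∀ (j : ℕ) (hj : j < l.length), σ (m + j) = l[j]}

end CodeSpace

/-! ### Markov systems -/

/-- A Markov system on `K` over a finite directed multigraph with vertices `V` and edges `E`. -/
structure MarkovSystem (K V E : Type*) [MeasurableSpace K] [Fintype E] where
  /-- initial vertex of an edge -/
  init : E → V
  /-- terminal vertex of an edge -/
  term : E → V
  /-- the vertex sets, a partition of `K` into non-empty Borel sets -/
  cell : V → Set K
  cell_nonempty : ∀ v, (cell v).Nonempty
  cell_measurable : ∀ v, MeasurableSet (cell v)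
  cell_disjoint : Pairwise fun v v' => Disjoint (cell v) (cell v')
  cell_cover : ⋃ v, cell v = Set.univ
  /-- the maps -/
  w : E → K → K
  w_measurable : ∀ e, Measurable (w e)
  w_mapsTo : ∀ e, Set.MapsTo (w e) (cell (init e)) (cell (term e))
  /-- the probability functions -/
  p : E → K → ℝ
  p_measurable : ∀ e, Measurable (p e)
  p_nonneg : ∀ e x, 0 ≤ p e x
  p_sum : ∀ x, ∑ e, p e x = 1
  p_eq_zero : ∀ e x, x ∉ cell (init e) → p e x = 0

namespace MarkovSystem

variable {K V E : Type*} [MeasurableSpace K] [Fintype E] (𝓜 : MarkovSystem K V E)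

/-- The directed graph is irreducible: every vertex is reached from every vertex by a path. -/
def IsIrreducible : Prop :=
  ∀ v v' : V, Relation.ReflTransGen (fun a b => ∃ e, 𝓜.init e = a ∧ 𝓜.term e = b) v v'

/-- Contractiveness on average, with some rate `0 < a < 1`. -/
def IsContractive [PseudoMetricSpace K] : Prop :=
  ∃ a : ℝ, 0 < a ∧ a < 1 ∧ ∀ v, ∀ x ∈ 𝓜.cell v, ∀ y ∈ 𝓜.cell v,
    ∑ e, 𝓜.p e x * dist (𝓜.w e x) (𝓜.w e y) ≤ a * dist x y

/-- The Markov operator `U`. -/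
noncomputable def markovOp (f : K → ℝ) (x : K) : ℝ := ∑ e, 𝓜.p e x * f (𝓜.w e x)

/-- `μ` is an invariant Borel probability measure: `U*μ = μ`, where `U*μ(f) = ∫ U f dμ` for all
bounded Borel functions `f`. -/
def IsInvariantMeasure (μ : Measure K) : Prop :=
  IsProbabilityMeasure μ ∧ ∀ f : K → ℝ, Measurable f → (∃ C, ∀ x, |f x| ≤ C) →
    ∫ x, 𝓜.markovOp f x ∂μ = ∫ x, f x ∂μ

/-- `p_{e₁}(x) p_{e₂}(w_{e₁} x) ⋯ p_{eₖ}(w_{eₖ₋₁} ⋯ w_{e₁} x)` for the word `[e₁, …, eₖ]`. -/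
noncomputable def wordProb : List E → K → ℝ
  | [], _ => 1
  | e :: l, x => 𝓜.p e x * wordProb l (𝓜.w e x)

/-- `M` is the generalized Markov measure on the code space given by `μ`. -/
def IsGeneralizedMarkovMeasure [MeasurableSpace E] (μ : Measure K) (M : Measure (ℤ → E)) : Prop :=
  ∀ (m : ℤ) (l : List E), M (cylinderAt m l) = ∫⁻ x, ENNReal.ofReal (𝓜.wordProb l x) ∂μ

/-- The paths of the graph, `Σ_G`. -/
def pathSpace : Set (ℤ → E) := {σ | ∀ j, 𝓜.term (σ j) = 𝓜.init (σ (j + 1))}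

/-- `w_{σ₀} ∘ w_{σ₋₁} ∘ ⋯ ∘ w_{σ₋ₙ}`. -/
def pastMap (σ : ℤ → E) : ℕ → K → K
  | 0 => 𝓜.w (σ 0)
  | n + 1 => pastMap σ n ∘ 𝓜.w (σ (-((n : ℤ) + 1)))

/-- `w_{σ₀} ∘ w_{σ₋₁} ∘ ⋯ ∘ w_{σ₋ₙ} (x_{i(σ₋ₙ)})`. -/
def codingSeq (x : V → K) (σ : ℤ → E) (n : ℕ) : K :=
  𝓜.pastMap σ n (x (𝓜.init (σ (-(n : ℤ)))))

/-- The coding map `F`; its value is meaningful where the limit exists. -/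
noncomputable def codingMap [TopologicalSpace K] [Nonempty K] (x : V → K) (σ : ℤ → E) : K :=
  limUnder atTop (𝓜.codingSeq x σ)

/-- The set `D` of the paths along which the limit defining the coding map exists. -/
def convergenceSet [TopologicalSpace K] (x : V → K) : Set (ℤ → E) :=
  {σ | σ ∈ 𝓜.pathSpace ∧ ∃ y, Tendsto (𝓜.codingSeq x σ) atTop (𝓝 y)}

/-- `Y = ⋂_{k ∈ ℤ} S^k(D)`. -/
def codingDomain [TopologicalSpace K] (x : V → K) : Set (ℤ → E) :=
  ⋂ k : ℤ, shiftBy k '' 𝓜.convergenceSet x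

open Classical in
/-- The energy function `u`. -/
noncomputable def energy [TopologicalSpace K] [Nonempty K] (x : V → K) (σ : ℤ → E) : EReal :=
  if σ ∈ 𝓜.codingDomain x then ((Real.log (𝓜.p (σ 1) (𝓜.codingMap x σ)) : ℝ) : EReal) else ⊥

end MarkovSystem

/-!
Because of the contraction, two trajectories that start in the same cell and follow a random word
stay so close that, by Dini continuity, the logarithmic distortion of the word probabilities is
summable. The laws of the words seen from two such points therefore overlap by an amount that does
not depend on the length, so that no two invariant measures are mutually singular; since the
positive part of the difference of two invariant measures is again invariant, there is only one.
Contraction also keeps the mean distance to the base points bounded along the averages of the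
iterates of a point mass, and a limit point of these averages is an invariant measure with
integrable height.

Under the generalized Markov measure, the points obtained from longer and longer pasts differ by a
geometrically small amount on average, so they converge almost surely, and the limit has law `μ`.

For an invariant law `Λ` of paths, the difference between the mean of `-log p_{σ₁}` at a finite
past and the conditional entropy of the next letter given this past is a relative entropy. It is
nonnegative, so the pressure is at most zero, and it controls the total variation distance between
the true and the predicted law of the next letter. If `Λ` is an equilibrium state, it follows that
the next letter given the past has the law `p_e ∘ F`, so that `F(Λ)` is invariant and `Λ` is its
generalized Markov measure. That `M` attains the value zero follows from the concavity of
`-t log t`, which bounds its block entropies from below.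
-/

open ProbabilityTheory

/-! ### Sums over words -/

section Words

variable {E : Type*} [Fintype E] {A : Type*} [AddCommMonoid A]

theorem sum_fin_succ_fun {n : ℕ} (F : (Fin (n + 1) → E) → A) :
    ∑ g, F g = ∑ e, ∑ g : Fin n → E, F (Fin.cons e g) := by
  rw [← (Fin.consEquiv fun _ => E).sum_comp, Fintype.sum_prod_type]
  rfl

theorem sum_fin_succ_fun_last {n : ℕ} (F : (Fin (n + 1) → E) → A) :
    ∑ g, F g = ∑ g : Fin n → E, ∑ e, F (Fin.snoc g e) := by
  rw [← (Fin.snocEquiv fun _ => E).sum_comp, Fintype.sum_prod_type_right]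
  rfl

omit [Fintype E] in
theorem ofFn_snoc {n : ℕ} (g : Fin n → E) (e : E) :
    List.ofFn (Fin.snoc g e : Fin (n + 1) → E) = List.ofFn g ++ [e] := by
  simp only [List.ofFn_succ_last, Fin.snoc_castSucc, Fin.snoc_last]

theorem sum_ofFn_succ (n : ℕ) (f : List E → A) :
    ∑ g : Fin (n + 1) → E, f (List.ofFn g) = ∑ e, ∑ g : Fin n → E, f (e :: List.ofFn g) := by
  simp only [sum_fin_succ_fun, List.ofFn_cons]

theorem sum_ofFn_succ_last (n : ℕ) (f : List E → A) :
    ∑ g : Fin (n + 1) → E, f (List.ofFn g) = ∑ g : Fin n → E, ∑ e, f (List.ofFn g ++ [e]) := by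
  simp only [sum_fin_succ_fun_last, ofFn_snoc]

end Words

theorem integral_bind_of_bounded {X : Type*} [MeasurableSpace X] {κ : Kernel X X} [IsMarkovKernel κ]
    {ν : Measure X} [IsFiniteMeasure ν] {f : X → ℝ} (hf : Measurable f) {C : ℝ}
    (hC : ∀ x, |f x| ≤ C) : ∫ x, f x ∂(ν.bind κ) = ∫ x, ∫ y, f y ∂κ x ∂ν := by
  have hfint : Integrable f (ν.bind κ) :=
    Integrable.of_bound hf.aestronglyMeasurable C (ae_of_all _ hC)
  rw [Measure.comp_eq_comp_const_apply] at hfint ⊢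
  simp only [Kernel.integral_comp hfint, Kernel.const_apply]

namespace MarkovSystem

variable {K V E : Type*} [MeasurableSpace K] [Fintype E] (𝓜 : MarkovSystem K V E)

/-- `w_{eₖ} ∘ ⋯ ∘ w_{e₁}` for the word `[e₁, …, eₖ]`. -/
def wordMap : List E → K → K
  | [], x => x
  | e :: l, x => wordMap l (𝓜.w e x)

@[simp] theorem wordProb_nil (x : K) : 𝓜.wordProb [] x = 1 := rfl

@[simp] theorem wordProb_cons (e : E) (l : List E) (x : K) :
    𝓜.wordProb (e :: l) x = 𝓜.p e x * 𝓜.wordProb l (𝓜.w e x) := rfl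

@[simp] theorem wordMap_nil (x : K) : 𝓜.wordMap [] x = x := rfl

@[simp] theorem wordMap_cons (e : E) (l : List E) (x : K) :
    𝓜.wordMap (e :: l) x = 𝓜.wordMap l (𝓜.w e x) := rfl

theorem wordMap_append (l l' : List E) (x : K) :
    𝓜.wordMap (l ++ l') x = 𝓜.wordMap l' (𝓜.wordMap l x) := by
  induction l generalizing x with
  | nil => rfl
  | cons e l ih => simp [ih]

theorem wordProb_append (l l' : List E) (x : K) :
    𝓜.wordProb (l ++ l') x = 𝓜.wordProb l x * 𝓜.wordProb l' (𝓜.wordMap l x) := by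
  induction l generalizing x with
  | nil => simp
  | cons e l ih => simp [ih, mul_assoc]

theorem wordProb_nonneg (l : List E) (x : K) : 0 ≤ 𝓜.wordProb l x := by
  induction l generalizing x with
  | nil => simp
  | cons e l ih => exact mul_nonneg (𝓜.p_nonneg _ _) (ih _)

theorem p_le_one (e : E) (x : K) : 𝓜.p e x ≤ 1 := by
  rw [← 𝓜.p_sum x]
  exact Finset.single_le_sum (f := fun e => 𝓜.p e x) (fun e _ => 𝓜.p_nonneg e x) (Finset.mem_univ e)

theorem wordProb_le_one (l : List E) (x : K) : 𝓜.wordProb l x ≤ 1 := by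
  induction l generalizing x with
  | nil => simp
  | cons e l ih => exact mul_le_one₀ (𝓜.p_le_one _ _) (𝓜.wordProb_nonneg _ _) (ih _)

@[fun_prop]
theorem measurable_wordMap (l : List E) : Measurable (𝓜.wordMap l) := by
  induction l with
  | nil => exact measurable_id
  | cons e l ih => exact ih.comp (𝓜.w_measurable e)

@[fun_prop]
theorem measurable_wordProb (l : List E) : Measurable (𝓜.wordProb l) := by
  induction l with
  | nil => exact measurable_const
  | cons e l ih => exact (𝓜.p_measurable e).mul (ih.comp (𝓜.w_measurable e))

theorem sum_wordProb (n : ℕ) (x : K) : ∑ g : Fin n → E, 𝓜.wordProb (List.ofFn g) x = 1 := by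
  induction n generalizing x with
  | zero => simp
  | succ n ih =>
    rw [sum_ofFn_succ n fun l => 𝓜.wordProb l x]
    simp [← Finset.mul_sum, ih, 𝓜.p_sum]

theorem mem_cell_init_of_p_ne_zero {e : E} {x : K} (h : 𝓜.p e x ≠ 0) : x ∈ 𝓜.cell (𝓜.init e) := by
  by_contra hx
  exact h (𝓜.p_eq_zero e x hx)

theorem exists_mem_cell (x : K) : ∃ v, x ∈ 𝓜.cell v := by
  have h : x ∈ ⋃ v, 𝓜.cell v := by rw [𝓜.cell_cover]; trivial
  simpa using h

theorem cell_unique {v v' : V} {x : K} (h : x ∈ 𝓜.cell v) (h' : x ∈ 𝓜.cell v') : v = v' := by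
  by_contra hv
  exact Set.disjoint_left.1 (𝓜.cell_disjoint hv) h h'

theorem mem_cell_of_p_ne_zero {e : E} {x y : K} {v : V} (h : 𝓜.p e x ≠ 0) (hx : x ∈ 𝓜.cell v)
    (hy : y ∈ 𝓜.cell v) : 𝓜.w e x ∈ 𝓜.cell (𝓜.term e) ∧ 𝓜.w e y ∈ 𝓜.cell (𝓜.term e) := by
  obtain rfl := 𝓜.cell_unique hx (𝓜.mem_cell_init_of_p_ne_zero h)
  exact ⟨𝓜.w_mapsTo e hx, 𝓜.w_mapsTo e hy⟩

@[fun_prop]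
theorem measurable_ofReal_p (e : E) : Measurable fun x => ENNReal.ofReal (𝓜.p e x) :=
  (𝓜.p_measurable e).ennreal_ofReal

theorem sum_ofReal_p (x : K) : ∑ e, ENNReal.ofReal (𝓜.p e x) = 1 := by
  rw [← ENNReal.ofReal_sum_of_nonneg fun e _ => 𝓜.p_nonneg _ _, 𝓜.p_sum, ENNReal.ofReal_one]

/-- The transition kernel of the Markov system, through which it acts on measures: `U*ν` is
`ν.bind 𝓜.kernel`. -/
noncomputable def kernel : Kernel K K where
  toFun x := ∑ e, ENNReal.ofReal (𝓜.p e x) • Measure.dirac (𝓜.w e x)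
  measurable' := Measure.measurable_of_measurable_coe _ fun s hs => by
    simp only [Measure.coe_finsetSum, Measure.coe_smul, Finset.sum_apply, Pi.smul_apply,
      smul_eq_mul, Measure.dirac_apply' _ hs]
    exact Finset.measurable_sum _ fun e _ => (𝓜.measurable_ofReal_p e).mul
      ((measurable_one.indicator hs).comp (𝓜.w_measurable e))

theorem kernel_apply (x : K) :
    𝓜.kernel x = ∑ e, ENNReal.ofReal (𝓜.p e x) • Measure.dirac (𝓜.w e x) := rfl

instance : IsMarkovKernel 𝓜.kernel :=
  ⟨fun x => ⟨by simp [kernel_apply, 𝓜.sum_ofReal_p]⟩⟩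

theorem lintegral_kernel {f : K → ℝ≥0∞} (hf : Measurable f) (x : K) :
    ∫⁻ y, f y ∂𝓜.kernel x = ∑ e, ENNReal.ofReal (𝓜.p e x) * f (𝓜.w e x) := by
  simp only [kernel_apply, lintegral_finsetSum_measure, lintegral_smul_measure,
    lintegral_dirac' _ hf, smul_eq_mul]

theorem integral_kernel {f : K → ℝ} (hf : Measurable f) (x : K) :
    ∫ y, f y ∂𝓜.kernel x = 𝓜.markovOp f x := by
  have hfint : ∀ e, Integrable f (Measure.dirac (𝓜.w e x)) := fun e =>
    integrable_dirac' hf.stronglyMeasurable (by simp)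
  rw [kernel_apply, integral_finsetSum_measure fun e _ =>
    (hfint e).smul_measure ENNReal.ofReal_ne_top]
  simp only [integral_smul_measure, integral_dirac' _ _ hf.stronglyMeasurable,
    ENNReal.toReal_ofReal (𝓜.p_nonneg _ x), smul_eq_mul, markovOp]

theorem lintegral_bind_kernel (ν : Measure K) {f : K → ℝ≥0∞} (hf : Measurable f) :
    ∫⁻ x, f x ∂(ν.bind 𝓜.kernel) = ∫⁻ x, ∑ e, ENNReal.ofReal (𝓜.p e x) * f (𝓜.w e x) ∂ν := by
  simp only [Measure.lintegral_bind 𝓜.kernel.aemeasurable hf.aemeasurable, 𝓜.lintegral_kernel hf]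

theorem integral_bind_kernel (ν : Measure K) [IsFiniteMeasure ν] {f : K → ℝ} (hf : Measurable f)
    {C : ℝ} (hC : ∀ x, |f x| ≤ C) :
    ∫ x, f x ∂(ν.bind 𝓜.kernel) = ∫ x, 𝓜.markovOp f x ∂ν := by
  simp only [integral_bind_of_bounded hf hC, 𝓜.integral_kernel hf]

theorem isInvariantMeasure_iff (μ : Measure K) :
    𝓜.IsInvariantMeasure μ ↔ IsProbabilityMeasure μ ∧ 𝓜.kernel.Invariant μ := by
  refine and_congr_right fun _ => ⟨fun h => ?_, fun h f hf ⟨C, hC⟩ => ?_⟩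
  · ext s hs
    have hbound : ∀ x, |s.indicator (1 : K → ℝ) x| ≤ 1 := fun x => by
      by_cases hx : x ∈ s <;> simp [hx]
    have hs1 : Measurable (s.indicator (1 : K → ℝ)) := measurable_one.indicator hs
    have h1 := h (s.indicator 1) hs1 ⟨1, hbound⟩
    rw [← 𝓜.integral_bind_kernel μ hs1 hbound, integral_indicator_one hs,
      integral_indicator_one hs] at h1
    exact (measureReal_eq_measureReal_iff).1 h1
  · rw [← 𝓜.integral_bind_kernel μ hf hC, h.def]

theorem iterate_markovOp_apply (n : ℕ) (f : K → ℝ) (x : K) :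
    𝓜.markovOp^[n] f x =
      ∑ g : Fin n → E, 𝓜.wordProb (List.ofFn g) x * f (𝓜.wordMap (List.ofFn g) x) := by
  induction n generalizing x with
  | zero => simp
  | succ n ih =>
    rw [Function.iterate_succ_apply', sum_ofFn_succ n fun l => 𝓜.wordProb l x * f (𝓜.wordMap l x)]
    simp only [markovOp, ih, Finset.mul_sum, wordProb_cons, wordMap_cons, mul_assoc]

theorem iterate_markovOp_one_sub (n : ℕ) (f : K → ℝ) (x : K) :
    𝓜.markovOp^[n] (fun y => 1 - f y) x = 1 - 𝓜.markovOp^[n] f x := by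
  simp only [iterate_markovOp_apply, mul_sub, mul_one, Finset.sum_sub_distrib, sum_wordProb]

theorem iterate_markovOp_nonneg {f : K → ℝ} (hf : ∀ x, 0 ≤ f x) (n : ℕ) (x : K) :
    0 ≤ 𝓜.markovOp^[n] f x := by
  rw [iterate_markovOp_apply]
  exact Finset.sum_nonneg fun g _ => mul_nonneg (𝓜.wordProb_nonneg _ _) (hf _)

@[fun_prop]
theorem measurable_markovOp {f : K → ℝ} (hf : Measurable f) : Measurable (𝓜.markovOp f) :=
  Finset.measurable_sum _ fun e _ => (𝓜.p_measurable e).mul (hf.comp (𝓜.w_measurable e))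

theorem measurable_iterate_markovOp {f : K → ℝ} (hf : Measurable f) (n : ℕ) :
    Measurable (𝓜.markovOp^[n] f) :=
  Function.Iterate.rec Measurable hf (fun _ => 𝓜.measurable_markovOp) n

section Invariant

variable {𝓜} {ν : Measure K} {f : K → ℝ}

theorem lintegral_markovOp_of_invariant (hν : 𝓜.kernel.Invariant ν) (hf : Measurable f)
    (hf0 : ∀ x, 0 ≤ f x) :
    ∫⁻ x, ENNReal.ofReal (𝓜.markovOp f x) ∂ν = ∫⁻ x, ENNReal.ofReal (f x) ∂ν := by
  conv_rhs => rw [← hν.def, 𝓜.lintegral_bind_kernel ν hf.ennreal_ofReal]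
  refine lintegral_congr fun x => ?_
  rw [markovOp, ENNReal.ofReal_sum_of_nonneg fun e _ => mul_nonneg (𝓜.p_nonneg e x) (hf0 _)]
  exact Finset.sum_congr rfl fun e _ => ENNReal.ofReal_mul (𝓜.p_nonneg e x)

theorem lintegral_iterate_markovOp_of_invariant (hν : 𝓜.kernel.Invariant ν) (hf : Measurable f)
    (hf0 : ∀ x, 0 ≤ f x) (n : ℕ) :
    ∫⁻ x, ENNReal.ofReal (𝓜.markovOp^[n] f x) ∂ν = ∫⁻ x, ENNReal.ofReal (f x) ∂ν := by
  induction n with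
  | zero => rfl
  | succ n ih =>
    rw [Function.iterate_succ', ← ih]
    exact lintegral_markovOp_of_invariant hν (𝓜.measurable_iterate_markovOp hf n)
      (𝓜.iterate_markovOp_nonneg hf0 n)

theorem integral_iterate_markovOp_of_invariant (hν : 𝓜.kernel.Invariant ν) (hf : Measurable f)
    (hf0 : ∀ x, 0 ≤ f x) (n : ℕ) : ∫ x, 𝓜.markovOp^[n] f x ∂ν = ∫ x, f x ∂ν := by
  rw [integral_eq_lintegral_of_nonneg_ae (ae_of_all _ (𝓜.iterate_markovOp_nonneg hf0 n))
      (𝓜.measurable_iterate_markovOp hf n).aestronglyMeasurable,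
    integral_eq_lintegral_of_nonneg_ae (ae_of_all _ hf0) hf.aestronglyMeasurable,
    lintegral_iterate_markovOp_of_invariant hν hf hf0]

end Invariant

end MarkovSystem

/-! ### Distortion of word probabilities -/

section Dini

variable {X : Type*} [PseudoMetricSpace X]

theorem modulusOn_mono (h : X → ℝ) (s : Set X) : Monotone (modulusOn h s) := by
  intro t t' htt
  refine iSup₂_le fun x hx => iSup₂_le fun y hy => iSup_le fun hxy => ?_
  exact le_iSup₂_of_le x hx (le_iSup₂_of_le y hy (le_iSup_of_le (hxy.trans htt) le_rfl))

theorem le_modulusOn {h : X → ℝ} {s : Set X} {t : ℝ} {x y : X} (hx : x ∈ s) (hy : y ∈ s)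
    (hxy : dist x y ≤ t) : ENNReal.ofReal |h x - h y| ≤ modulusOn h s t :=
  le_iSup₂_of_le x hx (le_iSup₂_of_le y hy (le_iSup_of_le hxy le_rfl))

theorem modulusOn_le_one {h : X → ℝ} (s : Set X) (h0 : ∀ x, 0 ≤ h x) (h1 : ∀ x, h x ≤ 1) (t : ℝ) :
    modulusOn h s t ≤ 1 := by
  refine iSup₂_le fun x _ => iSup₂_le fun y _ => iSup_le fun _ => ?_
  rw [← ENNReal.ofReal_one]
  refine ENNReal.ofReal_le_ofReal (abs_sub_le_iff.2 ⟨?_, ?_⟩) <;>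
    linarith [h0 x, h1 x, h0 y, h1 y]

theorem modulusOn_mul_le_setLIntegral (h : X → ℝ) (s : Set X) {b t : ℝ} (ht : 0 < t) :
    modulusOn h s (t * b) * ENNReal.ofReal (1 - b) ≤
      ∫⁻ r in Set.Ioc (t * b) t, modulusOn h s r / ENNReal.ofReal r := by
  calc modulusOn h s (t * b) * ENNReal.ofReal (1 - b)
      = ∫⁻ _ in Set.Ioc (t * b) t, modulusOn h s (t * b) / ENNReal.ofReal t := by
        rw [setLIntegral_const, Real.volume_Ioc, show t - t * b = t * (1 - b) by ring,
          ENNReal.ofReal_mul ht.le, ← mul_assoc,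
          ENNReal.div_mul_cancel (by simpa using ht) ENNReal.ofReal_ne_top]
    _ ≤ _ := by
        refine setLIntegral_mono' measurableSet_Ioc fun _ hr => ?_
        exact ENNReal.div_le_div (modulusOn_mono h s hr.1.le) (ENNReal.ofReal_le_ofReal hr.2)

theorem tsum_modulusOn_mul_le_setLIntegral (h : X → ℝ) (s : Set X) {b t : ℝ} (hb0 : 0 < b)
    (hb1 : b < 1) (ht : 0 < t) :
    (∑' k : ℕ, modulusOn h s (t * b ^ (k + 1))) * ENNReal.ofReal (1 - b) ≤
      ∫⁻ r in Set.Ioc 0 t, modulusOn h s r / ENNReal.ofReal r := by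
  have hanti : Antitone fun k : ℕ => t * b ^ k := fun i j hij =>
    mul_le_mul_of_nonneg_left (pow_le_pow_of_le_one hb0.le hb1.le hij) ht.le
  have hdisj : Pairwise (Function.onFun Disjoint
      fun k : ℕ => Set.Ioc (t * b ^ (k + 1)) (t * b ^ k)) := by
    simpa only [Order.succ_eq_add_one] using hanti.pairwise_disjoint_on_Ioc_succ
  rw [← ENNReal.tsum_mul_right]
  calc ∑' k : ℕ, modulusOn h s (t * b ^ (k + 1)) * ENNReal.ofReal (1 - b)
      ≤ ∑' k : ℕ, ∫⁻ r in Set.Ioc (t * b ^ (k + 1)) (t * b ^ k),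
          modulusOn h s r / ENNReal.ofReal r := by
        refine ENNReal.tsum_le_tsum fun k => ?_
        rw [pow_succ, ← mul_assoc]
        exact modulusOn_mul_le_setLIntegral h s (by positivity)
    _ = ∫⁻ r in ⋃ k : ℕ, Set.Ioc (t * b ^ (k + 1)) (t * b ^ k),
          modulusOn h s r / ENNReal.ofReal r :=
        (lintegral_iUnion (fun _ => measurableSet_Ioc) hdisj _).symm
    _ ≤ _ := lintegral_mono_set <| Set.iUnion_subset fun k =>
        Set.Ioc_subset_Ioc (by positivity) (by simpa using hanti (Nat.zero_le k))

theorem DiniContinuousOn.tsum_modulusOn_ne_top {h : X → ℝ} {s : Set X} (hd : DiniContinuousOn h s)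
    (h0 : ∀ x, 0 ≤ h x) (h1 : ∀ x, h x ≤ 1) {b T : ℝ} (hb0 : 0 < b) (hb1 : b < 1) (hT : 0 < T) :
    ∑' k : ℕ, modulusOn h s (T * b ^ k) ≠ ⊤ := by
  obtain ⟨c, hc, hInt⟩ := hd
  obtain ⟨N, hN⟩ := exists_pow_lt_of_lt_one (show 0 < c / T by positivity) hb1
  rw [lt_div_iff₀' hT] at hN
  have htail : ∑' k : ℕ, modulusOn h s (T * b ^ (k + (N + 1))) ≠ ⊤ := by
    have hfin := ne_top_of_le_ne_top hInt.ne <|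
      (tsum_modulusOn_mul_le_setLIntegral h s hb0 hb1 (show 0 < T * b ^ N by positivity)).trans
        (lintegral_mono_set (Set.Ioc_subset_Ioc_right hN.le))
    have hexp : ∀ k, T * b ^ N * b ^ (k + 1) = T * b ^ (k + (N + 1)) := fun k => by ring
    simp only [hexp] at hfin
    exact fun htop => hfin (by rw [htop, ENNReal.top_mul (by simpa using hb1)])
  rw [← ENNReal.summable.sum_add_tsum_nat_add' (k := N + 1)]
  exact ENNReal.add_ne_top.2 ⟨ENNReal.sum_ne_top.2 fun k _ =>
    ne_top_of_le_ne_top ENNReal.one_ne_top (modulusOn_le_one s h0 h1 _), htail⟩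

end Dini

namespace MarkovSystem

variable {K V E : Type*} [MeasurableSpace K] [Fintype E] (𝓜 : MarkovSystem K V E)

/-- The functions `p_e` are bounded away from zero on the cells on which they live. -/
def IsBoundedBelow : Prop := ∀ e, ∃ δ : ℝ, 0 < δ ∧ ∀ y ∈ 𝓜.cell (𝓜.init e), δ ≤ 𝓜.p e y

section Contraction

variable [PseudoMetricSpace K]

/-- Contractiveness on average with the given rate. -/
def ContractsBy (a : ℝ) : Prop :=
  ∀ v, ∀ x ∈ 𝓜.cell v, ∀ y ∈ 𝓜.cell v,
    ∑ e, 𝓜.p e x * dist (𝓜.w e x) (𝓜.w e y) ≤ a * dist x y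

variable {𝓜}

theorem ContractsBy.sum_wordProb_mul_dist_le {a : ℝ} (ha : 𝓜.ContractsBy a) (ha0 : 0 ≤ a) (n : ℕ)
    {v : V} {x y : K} (hx : x ∈ 𝓜.cell v) (hy : y ∈ 𝓜.cell v) :
    ∑ g : Fin n → E, 𝓜.wordProb (List.ofFn g) x *
      dist (𝓜.wordMap (List.ofFn g) x) (𝓜.wordMap (List.ofFn g) y) ≤ a ^ n * dist x y := by
  induction n generalizing v x y with
  | zero => simp
  | succ n ih =>
    rw [sum_ofFn_succ n fun l => 𝓜.wordProb l x * dist (𝓜.wordMap l x) (𝓜.wordMap l y)]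
    calc _ ≤ ∑ e, 𝓜.p e x * (a ^ n * dist (𝓜.w e x) (𝓜.w e y)) := by
          refine Finset.sum_le_sum fun e _ => ?_
          simp only [wordProb_cons, wordMap_cons, mul_assoc, ← Finset.mul_sum]
          by_cases hp : 𝓜.p e x = 0
          · simp [hp]
          obtain ⟨hx', hy'⟩ := 𝓜.mem_cell_of_p_ne_zero hp hx hy
          exact mul_le_mul_of_nonneg_left (ih hx' hy') (𝓜.p_nonneg e x)
      _ = a ^ n * ∑ e, 𝓜.p e x * dist (𝓜.w e x) (𝓜.w e y) := by
          rw [Finset.mul_sum]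
          exact Finset.sum_congr rfl fun e _ => by ring
      _ ≤ a ^ n * (a * dist x y) := mul_le_mul_of_nonneg_left (ha v x hx y hy) (by positivity)
      _ = _ := by ring

variable (𝓜) in
/-- The distances of two trajectories along a word, summed with the weights `b⁻ᵏ`. -/
noncomputable def weightedDist (b : ℝ) : List E → K → K → ℝ
  | [], _, _ => 0
  | e :: l, x, y => dist x y + b⁻¹ * weightedDist b l (𝓜.w e x) (𝓜.w e y)

theorem weightedDist_nonneg {b : ℝ} (hb : 0 ≤ b) (l : List E) (x y : K) :
    0 ≤ 𝓜.weightedDist b l x y := by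
  induction l generalizing x y with
  | nil => exact le_rfl
  | cons e l ih =>
    have := ih (𝓜.w e x) (𝓜.w e y)
    simp only [weightedDist]
    positivity

theorem ContractsBy.sum_wordProb_mul_weightedDist_le {a b c : ℝ} (ha : 𝓜.ContractsBy a)
    (hb : 0 < b) (hc : 0 ≤ c) (hbc : 1 + b⁻¹ * a * c ≤ c) (n : ℕ)
    {v : V} {x y : K} (hx : x ∈ 𝓜.cell v) (hy : y ∈ 𝓜.cell v) :
    ∑ g : Fin n → E, 𝓜.wordProb (List.ofFn g) x *
      𝓜.weightedDist b (List.ofFn g) x y ≤ c * dist x y := by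
  induction n generalizing v x y with
  | zero => simpa [weightedDist] using mul_nonneg hc dist_nonneg
  | succ n ih =>
    rw [sum_ofFn_succ n fun l => 𝓜.wordProb l x * 𝓜.weightedDist b l x y]
    calc _ ≤ ∑ e, 𝓜.p e x * (dist x y + b⁻¹ * (c * dist (𝓜.w e x) (𝓜.w e y))) := by
          refine Finset.sum_le_sum fun e _ => ?_
          simp only [wordProb_cons, weightedDist, mul_assoc, ← Finset.mul_sum]
          by_cases hp : 𝓜.p e x = 0
          · simp [hp]
          obtain ⟨hx', hy'⟩ := 𝓜.mem_cell_of_p_ne_zero hp hx hy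
          refine mul_le_mul_of_nonneg_left ?_ (𝓜.p_nonneg e x)
          simp only [mul_add, Finset.sum_add_distrib, ← Finset.sum_mul, sum_wordProb, one_mul]
          gcongr
          simp only [mul_left_comm _ b⁻¹, ← Finset.mul_sum]
          exact mul_le_mul_of_nonneg_left (ih hx' hy') (by positivity)
      _ = dist x y + b⁻¹ * c * ∑ e, 𝓜.p e x * dist (𝓜.w e x) (𝓜.w e y) := by
          simp only [mul_add, Finset.sum_add_distrib, ← Finset.sum_mul, 𝓜.p_sum, one_mul]
          rw [Finset.mul_sum]
          congr 1
          exact Finset.sum_congr rfl fun e _ => by ring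
      _ ≤ dist x y + b⁻¹ * c * (a * dist x y) := by
          gcongr
          exact ha v x hx y hy
      _ = (1 + b⁻¹ * a * c) * dist x y := by ring
      _ ≤ _ := mul_le_mul_of_nonneg_right hbc dist_nonneg

variable (𝓜) in
/-- The functions `p_e` restricted to the cells on which they live are Dini-continuous. -/
def IsDini : Prop := ∀ e, DiniContinuousOn (𝓜.p e) (𝓜.cell (𝓜.init e))

variable (𝓜) in
/-- `φ` is a common modulus of continuity of the functions `log p_e` on the cells on which they
live, written without logarithms. -/
def IsLogModulus (φ : ℝ → ℝ) : Prop :=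
  ∀ e, ∀ x ∈ 𝓜.cell (𝓜.init e), ∀ y ∈ 𝓜.cell (𝓜.init e), ∀ t, dist x y ≤ t →
    𝓜.p e x * Real.exp (-φ t) ≤ 𝓜.p e y

theorem IsLogModulus.wordProb_mul_exp_le {φ : ℝ → ℝ} (hφ : 𝓜.IsLogModulus φ)
    {b : ℝ} (hb : 0 < b) (l : List E) {v : V} {x y : K} (hx : x ∈ 𝓜.cell v) (hy : y ∈ 𝓜.cell v)
    {T : ℝ} (hT : 𝓜.weightedDist b l x y ≤ T) :
    𝓜.wordProb l x * Real.exp (-∑ k ∈ Finset.range l.length, φ (T * b ^ k)) ≤ 𝓜.wordProb l y := by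
  induction l generalizing v x y T with
  | nil => simp
  | cons e l ih =>
    by_cases hp : 𝓜.p e x = 0
    · simpa [hp] using mul_nonneg (𝓜.p_nonneg e y) (𝓜.wordProb_nonneg _ _)
    obtain ⟨hx', hy'⟩ := 𝓜.mem_cell_of_p_ne_zero hp hx hy
    obtain rfl := 𝓜.cell_unique hx (𝓜.mem_cell_init_of_p_ne_zero hp)
    rw [weightedDist] at hT
    have hW : 0 ≤ b⁻¹ * 𝓜.weightedDist b l (𝓜.w e x) (𝓜.w e y) :=
      mul_nonneg (inv_nonneg.2 hb.le) (weightedDist_nonneg hb.le l _ _)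
    have hletter := hφ e x hx y hy T (by linarith)
    have hword := ih hx' hy' (T := T * b) (by
      rw [← div_le_iff₀ hb, div_eq_inv_mul]
      linarith [dist_nonneg (x := x) (y := y)])
    rw [List.length_cons, Finset.sum_range_succ']
    simp only [wordProb_cons, pow_zero, mul_one, neg_add, Real.exp_add, pow_succ', ← mul_assoc]
    calc _ = (𝓜.p e x * Real.exp (-φ T)) * (𝓜.wordProb l (𝓜.w e x) *
          Real.exp (-∑ k ∈ Finset.range l.length, φ (T * b * b ^ k))) := by ring
      _ ≤ _ := mul_le_mul hletter hword
          (mul_nonneg (𝓜.wordProb_nonneg _ _) (Real.exp_nonneg _)) (𝓜.p_nonneg e y)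

theorem mul_exp_neg_le_of_sub_le {p q m δ s : ℝ} (hδ : 0 < δ) (hδq : δ ≤ q) (hm : 0 ≤ m)
    (hpq : p - q ≤ m) (hs : m / δ ≤ s) : p * Real.exp (-s) ≤ q := by
  have hq : 0 < q := hδ.trans_le hδq
  rw [Real.exp_neg, ← div_eq_mul_inv, div_le_iff₀ (Real.exp_pos _)]
  calc p ≤ q * (1 + m / q) := by rw [mul_add, mul_div_cancel₀ _ hq.ne']; linarith
    _ ≤ q * (1 + s) := by gcongr; exact (div_le_div_of_nonneg_left hm hδ hδq).trans hs
    _ ≤ q * Real.exp s := by gcongr; linarith [Real.add_one_le_exp s]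

theorem exists_isLogModulus_summable (hdini : 𝓜.IsDini) (hpos : 𝓜.IsBoundedBelow) :
    ∃ φ : ℝ → ℝ, (∀ t, 0 ≤ φ t) ∧ 𝓜.IsLogModulus φ ∧
      ∀ b T : ℝ, 0 < b → b < 1 → 0 < T → Summable fun k : ℕ => φ (T * b ^ k) := by
  choose δ hδ0 hδ using hpos
  set m : E → ℝ → ℝ := fun e t => (modulusOn (𝓜.p e) (𝓜.cell (𝓜.init e)) t).toReal
  have hterm : ∀ t e, 0 ≤ m e t / δ e := fun t e => div_nonneg ENNReal.toReal_nonneg (hδ0 e).le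
  refine ⟨fun t => ∑ e, m e t / δ e, fun t => Finset.sum_nonneg fun e _ => hterm t e,
    fun e x hx y hy t hxy => ?_, fun b T hb0 hb1 hT => ?_⟩
  · have hfin : modulusOn (𝓜.p e) (𝓜.cell (𝓜.init e)) t ≠ ⊤ :=
      ne_top_of_le_ne_top ENNReal.one_ne_top
        (modulusOn_le_one _ (𝓜.p_nonneg e) (𝓜.p_le_one e) t)
    have hpq : 𝓜.p e x - 𝓜.p e y ≤ m e t :=
      (le_abs_self _).trans ((ENNReal.ofReal_le_iff_le_toReal hfin).1 (le_modulusOn hx hy hxy))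
    exact mul_exp_neg_le_of_sub_le (hδ0 e) (hδ e y hy) ENNReal.toReal_nonneg hpq
      (Finset.single_le_sum (fun e _ => hterm t e) (Finset.mem_univ e))
  · exact summable_sum fun e _ => (ENNReal.summable_toReal
      ((hdini e).tsum_modulusOn_ne_top (𝓜.p_nonneg e) (𝓜.p_le_one e) hb0 hb1 hT)).div_const _

-- The left side is positive only if `W ≤ T`, and then the two trajectories along the word stay so
-- close that the logarithmic distortions of its letters have a summable majorant.
theorem IsLogModulus.exp_mul_le_min_wordProb {φ : ℝ → ℝ} (hφ : 𝓜.IsLogModulus φ)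
    (hφ0 : ∀ t, 0 ≤ φ t) {b T : ℝ} (hb : 0 < b) (hT : 0 < T)
    (hsum : Summable fun k : ℕ => φ (T * b ^ k)) (l : List E) {v : V} {x y : K}
    (hx : x ∈ 𝓜.cell v) (hy : y ∈ 𝓜.cell v) :
    Real.exp (-∑' k : ℕ, φ (T * b ^ k)) *
        (𝓜.wordProb l x - 𝓜.wordProb l x * 𝓜.weightedDist b l x y / T) ≤
      min (𝓜.wordProb l x) (𝓜.wordProb l y) := by
  have hP := 𝓜.wordProb_nonneg l x
  have hW := weightedDist_nonneg (𝓜 := 𝓜) hb.le l x y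
  obtain hWT | hTW := le_or_gt (𝓜.weightedDist b l x y) T
  · have hsub : 𝓜.wordProb l x - 𝓜.wordProb l x * 𝓜.weightedDist b l x y / T ≤ 𝓜.wordProb l x :=
      sub_le_self _ (by positivity)
    refine (mul_le_mul_of_nonneg_left hsub (Real.exp_nonneg _)).trans (le_min ?_ ?_)
    · exact mul_le_of_le_one_left hP
        (Real.exp_le_one_iff.2 (neg_nonpos.2 (tsum_nonneg fun k => hφ0 _)))
    · rw [mul_comm]
      refine le_trans ?_ (hφ.wordProb_mul_exp_le hb l hx hy hWT)
      gcongr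
      exact hsum.sum_le_tsum _ fun k _ => hφ0 _
  · refine le_trans ?_ (le_min hP (𝓜.wordProb_nonneg l y))
    refine mul_nonpos_of_nonneg_of_nonpos (Real.exp_nonneg _) ?_
    rw [sub_nonpos, mul_div_assoc]
    exact le_mul_of_one_le_right hP ((one_le_div hT).2 hTW.le)

variable (𝓜) in
/-- The common mass of the laws of the words of length `n` that start at `x` and at `y`. -/
noncomputable def wordOverlap (n : ℕ) (x y : K) : ℝ :=
  ∑ g : Fin n → E, min (𝓜.wordProb (List.ofFn g) x) (𝓜.wordProb (List.ofFn g) y)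

theorem exists_le_wordOverlap {a : ℝ} (ha : 𝓜.ContractsBy a) (ha0 : 0 < a) (ha1 : a < 1)
    (hdini : 𝓜.IsDini) (hpos : 𝓜.IsBoundedBelow) {R : ℝ} (hR : 0 < R) :
    ∃ η : ℝ, 0 < η ∧ ∀ (n : ℕ) (v : V), ∀ x ∈ 𝓜.cell v, ∀ y ∈ 𝓜.cell v, dist x y ≤ R →
      η ≤ 𝓜.wordOverlap n x y := by
  obtain ⟨φ, hφ0, hφ, hsum⟩ := exists_isLogModulus_summable hdini hpos
  obtain ⟨b, hab, hb1⟩ := exists_between ha1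
  have hb0 : 0 < b := ha0.trans hab
  have hba : b⁻¹ * a < 1 := by rwa [← div_eq_inv_mul, div_lt_one hb0]
  set c : ℝ := (1 - b⁻¹ * a)⁻¹
  have hc0 : 0 < c := inv_pos.2 (by linarith)
  have hc : 1 + b⁻¹ * a * c = c := by
    linarith [mul_inv_cancel₀ (sub_ne_zero.2 hba.ne')]
  set T : ℝ := 2 * (c * R)
  have hT : 0 < T := by positivity
  refine ⟨Real.exp (-∑' k : ℕ, φ (T * b ^ k)) * (1 / 2), by positivity,
    fun n v x hx y hy hxy => ?_⟩
  refine le_trans ?_ (Finset.sum_le_sum fun g _ =>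
    hφ.exp_mul_le_min_wordProb hφ0 hb0 hT (hsum b T hb0 hb1 hT) (List.ofFn g) hx hy)
  rw [← Finset.mul_sum, Finset.sum_sub_distrib, sum_wordProb, ← Finset.sum_div]
  have hmarkov : (∑ g : Fin n → E, 𝓜.wordProb (List.ofFn g) x *
      𝓜.weightedDist b (List.ofFn g) x y) / T ≤ 1 / 2 := by
    rw [div_le_iff₀ hT]
    have hcR : c * dist x y ≤ c * R := mul_le_mul_of_nonneg_left hxy hc0.le
    linarith [ha.sum_wordProb_mul_weightedDist_le hb0 hc0.le hc.le n hx hy]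
  gcongr
  linarith

theorem mul_sub_mul_le_sub_min_add {P Q s t : ℝ} (hP : 0 ≤ P) (hQ : 0 ≤ Q) (hs : s ≤ 1)
    (ht : 0 ≤ t) : P * s - Q * t ≤ P - min P Q + P * |s - t| := by
  have hlow : (P - min P Q) * s ≤ P - min P Q :=
    mul_le_of_le_one_right (sub_nonneg.2 (min_le_left _ _)) hs
  have hhigh : 0 ≤ (Q - min P Q) * t := mul_nonneg (sub_nonneg.2 (min_le_right _ _)) ht
  have hmid : min P Q * (s - t) ≤ P * |s - t| :=
    (mul_le_mul_of_nonneg_left (le_abs_self _) (le_min hP hQ)).trans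
      (mul_le_mul_of_nonneg_right (min_le_left _ _) (abs_nonneg _))
  linarith

theorem ContractsBy.iterate_markovOp_sub_le {a : ℝ} (ha : 𝓜.ContractsBy a) (ha0 : 0 ≤ a)
    {f : K → ℝ} (hf0 : ∀ x, 0 ≤ f x) (hf1 : ∀ x, f x ≤ 1) {L : NNReal} (hf : LipschitzWith L f)
    (n : ℕ) {v : V} {x y : K} (hx : x ∈ 𝓜.cell v) (hy : y ∈ 𝓜.cell v) :
    𝓜.markovOp^[n] f x - 𝓜.markovOp^[n] f y ≤
      1 - 𝓜.wordOverlap n x y + L * (a ^ n * dist x y) := by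
  refine le_trans ?_ (add_le_add_right
    (mul_le_mul_of_nonneg_left (ha.sum_wordProb_mul_dist_le ha0 n hx hy) L.coe_nonneg) _)
  rw [← 𝓜.sum_wordProb n x, wordOverlap, Finset.mul_sum, iterate_markovOp_apply,
    iterate_markovOp_apply, ← Finset.sum_sub_distrib, ← Finset.sum_sub_distrib,
    ← Finset.sum_add_distrib]
  refine Finset.sum_le_sum fun g _ => ?_
  refine (mul_sub_mul_le_sub_min_add (𝓜.wordProb_nonneg _ x) (𝓜.wordProb_nonneg _ y)
    (hf1 _) (hf0 _)).trans (add_le_add_right ?_ _)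
  rw [mul_left_comm]
  exact mul_le_mul_of_nonneg_left (hf.dist_le_mul _ _) (𝓜.wordProb_nonneg _ _)

end Contraction

end MarkovSystem

/-! ### Uniqueness of the invariant measure -/

theorem comp_le_comp {X Y : Type*} [MeasurableSpace X] [MeasurableSpace Y] (κ : Kernel X Y)
    {μ ν : Measure X} (h : μ ≤ ν) : κ ∘ₘ μ ≤ κ ∘ₘ ν :=
  Measure.le_intro fun s hs _ => by
    simpa only [Measure.bind_apply hs κ.aemeasurable] using lintegral_mono' h le_rfl

theorem invariant_sub {X : Type*} [MeasurableSpace X] {κ : Kernel X X} [IsMarkovKernel κ]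
    {μ ν : Measure X} [IsFiniteMeasure μ] [IsFiniteMeasure ν] (hμ : κ.Invariant μ)
    (hν : κ.Invariant ν) : κ.Invariant (μ - ν) := by
  have hle : μ - ν ≤ κ ∘ₘ (μ - ν) := by
    refine Measure.sub_le_of_le_add ?_
    calc μ = κ ∘ₘ μ := hμ.def.symm
      _ ≤ κ ∘ₘ (μ - ν + ν) := comp_le_comp κ (Measure.sub_le_iff_le_add.1 le_rfl)
      _ = κ ∘ₘ (μ - ν) + ν := by rw [Measure.comp_add, hν.def]
  exact (Measure.eq_of_le_of_measure_univ_eq hle (by simp)).symm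

section Separation

variable {X : Type*} [PseudoEMetricSpace X] [MeasurableSpace X]

theorem lintegral_thickenedIndicator_le [OpensMeasurableSpace X] (ν : Measure X) {r : ℝ}
    (hr : 0 < r) (F : Set X) :
    ∫⁻ x, thickenedIndicator hr F x ∂ν ≤ ν (Metric.thickening r F) := by
  rw [← lintegral_indicator_one Metric.isOpen_thickening.measurableSet]
  refine lintegral_mono fun x => ?_
  by_cases hx : x ∈ Metric.thickening r F
  · simpa [hx] using thickenedIndicator_le_one hr F x
  · simp [thickenedIndicator_zero hr F hx]

theorem lintegral_one_sub_thickenedIndicator_le (ν : Measure X) {r : ℝ} (hr : 0 < r) {F : Set X}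
    (hF : MeasurableSet F) :
    ∫⁻ x, ENNReal.ofReal (1 - thickenedIndicator hr F x) ∂ν ≤ ν Fᶜ := by
  rw [← lintegral_indicator_one hF.compl]
  refine lintegral_mono fun x => ?_
  by_cases hx : x ∈ F
  · simp [thickenedIndicator_one hr F hx]
  · simp [hx]

theorem exists_lipschitzWith_lintegral_lt [BorelSpace X] {ν₁ ν₂ : Measure X} [IsFiniteMeasure ν₁]
    [IsFiniteMeasure ν₂] (h : ν₁ ⟂ₘ ν₂) {ε : ℝ≥0∞} (hε : ε ≠ 0) :
    ∃ (f : X → ℝ) (L : NNReal), LipschitzWith L f ∧ (∀ x, 0 ≤ f x) ∧ (∀ x, f x ≤ 1) ∧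
      ∫⁻ x, ENNReal.ofReal (1 - f x) ∂ν₁ < ε ∧ ∫⁻ x, ENNReal.ofReal (f x) ∂ν₂ < ε := by
  obtain ⟨A, hA, h₁, h₂⟩ := h
  obtain ⟨F, hFA, hF, hFε⟩ := hA.compl.exists_isClosed_sdiff_lt (measure_ne_top ν₁ Aᶜ) hε
  have hF₁ : ν₁ Fᶜ < ε := by
    refine lt_of_le_of_lt ?_ hFε
    calc ν₁ Fᶜ ≤ ν₁ (Aᶜ \ F) + ν₁ A := by
          refine (measure_mono fun x hx => ?_).trans (measure_union_le _ _)
          exact (em (x ∈ A)).symm.imp_left fun hxA => ⟨hxA, hx⟩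
      _ = ν₁ (Aᶜ \ F) := by rw [h₁, add_zero]
  have hF₂ := tendsto_measure_thickening_of_isClosed (μ := ν₂) ⟨1, one_pos, measure_ne_top _ _⟩ hF
  rw [measure_mono_null hFA h₂] at hF₂
  obtain ⟨r, hrε, hr⟩ :=
    ((hF₂.eventually_lt_const hε.bot_lt).and self_mem_nhdsWithin).exists
  refine ⟨fun x => thickenedIndicator hr F x, _,
    NNReal.isometry_coe.lipschitz.comp (lipschitzWith_thickenedIndicator hr F),
    fun x => NNReal.coe_nonneg _, fun x => mod_cast thickenedIndicator_le_one hr F x,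
    (lintegral_one_sub_thickenedIndicator_le ν₁ hr hF.measurableSet).trans_lt hF₁, ?_⟩
  simpa only [ENNReal.ofReal_coe_nnreal] using
    (lintegral_thickenedIndicator_le ν₂ hr F).trans_lt hrε

end Separation

theorem exists_measure_inter_ball_ne_zero {X : Type*} [PseudoMetricSpace X] [MeasurableSpace X]
    {ν : Measure X} {s : Set X} (h : ν s ≠ 0) (x : X) :
    ∃ R₀ : ℝ, ∀ R, R₀ ≤ R → ν (s ∩ Metric.ball x R) ≠ 0 := by
  by_contra! hc
  refine h ?_
  have : s ⊆ ⋃ n : ℕ, s ∩ Metric.ball x n := by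
    rw [← Set.inter_iUnion, Metric.iUnion_ball_nat, Set.inter_univ]
  refine measure_mono_null this (measure_iUnion_null fun n => ?_)
  obtain ⟨R, hR, hR0⟩ := hc n
  exact measure_mono_null (Set.inter_subset_inter_right s (Metric.ball_subset_ball hR)) hR0

namespace MarkovSystem

variable {K V E : Type*} [MeasurableSpace K] [Fintype E] {𝓜 : MarkovSystem K V E}

theorem measure_cell_init_eq_zero (hpos : 𝓜.IsBoundedBelow) {ν : Measure K}
    (hν : 𝓜.kernel.Invariant ν) {e : E} (he : ν (𝓜.cell (𝓜.term e)) = 0) :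
    ν (𝓜.cell (𝓜.init e)) = 0 := by
  obtain ⟨δ, hδ0, hδ⟩ := hpos e
  have hle : ENNReal.ofReal δ * ν (𝓜.cell (𝓜.init e)) ≤ ν (𝓜.cell (𝓜.term e)) := by
    calc ENNReal.ofReal δ * ν (𝓜.cell (𝓜.init e))
        = ∫⁻ _ in 𝓜.cell (𝓜.init e), ENNReal.ofReal δ ∂ν := by rw [setLIntegral_const]
      _ ≤ ∫⁻ x in 𝓜.cell (𝓜.init e), ∑ e', ENNReal.ofReal (𝓜.p e' x) *
            (𝓜.cell (𝓜.term e)).indicator 1 (𝓜.w e' x) ∂ν := by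
          refine setLIntegral_mono' (𝓜.cell_measurable _) fun x hx => ?_
          refine le_trans ?_ (Finset.single_le_sum (fun _ _ => zero_le) (Finset.mem_univ e))
          rw [Set.indicator_of_mem (𝓜.w_mapsTo e hx)]
          simpa using ENNReal.ofReal_le_ofReal (hδ x hx)
      _ ≤ ∫⁻ x, ∑ e', ENNReal.ofReal (𝓜.p e' x) *
            (𝓜.cell (𝓜.term e)).indicator 1 (𝓜.w e' x) ∂ν := setLIntegral_le_lintegral _ _
      _ = ν (𝓜.cell (𝓜.term e)) := by
          rw [← 𝓜.lintegral_bind_kernel ν (measurable_one.indicator (𝓜.cell_measurable _)),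
            hν.def, lintegral_indicator_one (𝓜.cell_measurable _)]
  rw [he, nonpos_iff_eq_zero, mul_eq_zero] at hle
  exact hle.resolve_left (by simpa using hδ0)

theorem measure_cell_ne_zero [Countable V] (hirr : 𝓜.IsIrreducible)
    (hpos : 𝓜.IsBoundedBelow) {ν : Measure K} (hν : 𝓜.kernel.Invariant ν) (h0 : ν ≠ 0) (v : V) :
    ν (𝓜.cell v) ≠ 0 := by
  intro hv
  refine h0 (Measure.measure_univ_eq_zero.1 ?_)
  rw [← 𝓜.cell_cover, measure_iUnion_null_iff]
  intro v'
  induction hirr v' v using Relation.ReflTransGen.head_induction_on with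
  | refl => exact hv
  | head hedge _ ih =>
    obtain ⟨e, rfl, rfl⟩ := hedge
    exact measure_cell_init_eq_zero hpos hν ih

theorem ofReal_mul_measure_le_of_le_iterate_markovOp {ν : Measure K} (hν : 𝓜.kernel.Invariant ν)
    {f : K → ℝ} (hf : Measurable f) (hf0 : ∀ x, 0 ≤ f x) {n : ℕ} {c : ℝ} {B : Set K}
    (hB : MeasurableSet B) (hc : ∀ x ∈ B, c ≤ 𝓜.markovOp^[n] f x) :
    ENNReal.ofReal c * ν B ≤ ∫⁻ x, ENNReal.ofReal (f x) ∂ν := by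
  rw [← lintegral_iterate_markovOp_of_invariant hν hf hf0 n, ← setLIntegral_const]
  exact (setLIntegral_mono' hB fun x hx => ENNReal.ofReal_le_ofReal (hc x hx)).trans
    (setLIntegral_le_lintegral B _)

theorem exists_forall_le_iterate_markovOp [PseudoMetricSpace K] (hcontr : 𝓜.IsContractive)
    (hdini : 𝓜.IsDini) (hpos : 𝓜.IsBoundedBelow) {R : ℝ} (hR : 0 < R) :
    ∃ η : ℝ, 0 < η ∧ ∀ (f : K → ℝ) (L : NNReal), LipschitzWith L f → (∀ x, 0 ≤ f x) →
      (∀ x, f x ≤ 1) → ∃ n : ℕ, ∀ v, ∀ x ∈ 𝓜.cell v, ∀ y ∈ 𝓜.cell v, dist x y ≤ R →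
        2 * η ≤ 𝓜.markovOp^[n] (fun z => 1 - f z) x + 𝓜.markovOp^[n] f y := by
  obtain ⟨a, ha0, ha1, ha⟩ := hcontr
  have ha : 𝓜.ContractsBy a := ha
  obtain ⟨η, hη, hover⟩ := exists_le_wordOverlap ha ha0 ha1 hdini hpos hR
  refine ⟨η / 4, by positivity, fun f L hL hf0 hf1 => ?_⟩
  have hlim : Tendsto (fun n : ℕ => L * (a ^ n * R)) atTop (𝓝 (L * (0 * R))) :=
    ((tendsto_pow_atTop_nhds_zero_of_lt_one ha0.le ha1).mul_const _).const_mul _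
  rw [zero_mul, mul_zero] at hlim
  obtain ⟨n, hn⟩ := (hlim.eventually_lt_const (half_pos hη)).exists
  refine ⟨n, fun v x hx y hy hxy => ?_⟩
  have hdist : (L : ℝ) * (a ^ n * dist x y) ≤ L * (a ^ n * R) := by gcongr
  rw [iterate_markovOp_one_sub]
  linarith [ha.iterate_markovOp_sub_le ha0.le hf0 hf1 hL n hx hy, hover n v x hx y hy hxy]

section Uniqueness

variable [PseudoMetricSpace K] [BorelSpace K] [Countable V] (hcontr : 𝓜.IsContractive)
  (hirr : 𝓜.IsIrreducible) (hdini : 𝓜.IsDini) (hpos : 𝓜.IsBoundedBelow)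

include hcontr hirr hdini hpos

-- A Lipschitz function that separates the two measures almost exactly would be carried by the
-- iterates of the Markov operator to one that is close to 1 for the first measure and close to 0
-- for the second, against the overlap of the word laws on a set charged by both.
theorem not_mutuallySingular_of_invariant {ν₁ ν₂ : Measure K} [IsFiniteMeasure ν₁]
    [IsFiniteMeasure ν₂] (h₁ : 𝓜.kernel.Invariant ν₁) (h₂ : 𝓜.kernel.Invariant ν₂)
    (hν₁ : ν₁ ≠ 0) (hν₂ : ν₂ ≠ 0) : ¬ ν₁ ⟂ₘ ν₂ := by
  intro hsing
  have : Nonempty K := by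
    by_contra hK
    exact hν₁ (@Measure.eq_zero_of_isEmpty K (not_nonempty_iff.1 hK) _ ν₁)
  obtain ⟨x₀⟩ := this
  obtain ⟨v, -⟩ := 𝓜.exists_mem_cell x₀
  obtain ⟨R₁, hR₁⟩ := exists_measure_inter_ball_ne_zero
    (measure_cell_ne_zero hirr hpos h₁ hν₁ v) x₀
  obtain ⟨R₂, hR₂⟩ := exists_measure_inter_ball_ne_zero
    (measure_cell_ne_zero hirr hpos h₂ hν₂ v) x₀
  set R := max 1 (max R₁ R₂)
  set B := 𝓜.cell v ∩ Metric.ball x₀ R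
  have hB : MeasurableSet B := (𝓜.cell_measurable v).inter measurableSet_ball
  have hdiam : ∀ x ∈ B, ∀ y ∈ B, dist x y ≤ 2 * R := fun x hx y hy => by
    linarith [dist_triangle x x₀ y, Metric.mem_ball.1 hx.2, Metric.mem_ball'.1 hy.2]
  obtain ⟨η, hη, hmix⟩ := exists_forall_le_iterate_markovOp hcontr hdini hpos
    (show 0 < 2 * R by positivity)
  have hη0 : ENNReal.ofReal η ≠ 0 := by simpa using hη
  have hε : min (ENNReal.ofReal η * ν₁ B) (ENNReal.ofReal η * ν₂ B) ≠ 0 :=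
    (lt_min (pos_iff_ne_zero.2 (mul_ne_zero hη0 (hR₁ R (by simp [R]))))
      (pos_iff_ne_zero.2 (mul_ne_zero hη0 (hR₂ R (by simp [R]))))).ne'
  obtain ⟨f, L, hL, hf0, hf1, hi₁, hi₂⟩ := exists_lipschitzWith_lintegral_lt hsing hε
  have hfm : Measurable f := hL.continuous.measurable
  obtain ⟨n, hn⟩ := hmix f L hL hf0 hf1
  by_cases hsmall : ∃ x ∈ B, 𝓜.markovOp^[n] (fun z => 1 - f z) x < η
  · obtain ⟨x, hxB, hx⟩ := hsmall
    have hle := ofReal_mul_measure_le_of_le_iterate_markovOp (c := η) h₂ hfm hf0 hB fun y hy => by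
      linarith [hn v x hxB.1 y hy.1 (hdiam x hxB y hy)]
    exact absurd (hle.trans_lt hi₂) (not_lt.2 (min_le_right _ _))
  · push Not at hsmall
    have hle := ofReal_mul_measure_le_of_le_iterate_markovOp (c := η) h₁ (measurable_const.sub hfm)
      (fun x => sub_nonneg.2 (hf1 x)) hB hsmall
    exact absurd (hle.trans_lt hi₁) (not_lt.2 (min_le_left _ _))

theorem eq_of_invariant {μ₁ μ₂ : Measure K} [IsProbabilityMeasure μ₁] [IsProbabilityMeasure μ₂]
    (h₁ : 𝓜.kernel.Invariant μ₁) (h₂ : 𝓜.kernel.Invariant μ₂) : μ₁ = μ₂ := by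
  by_contra hne
  have hsub : ∀ {μ ν : Measure K} [IsProbabilityMeasure μ] [IsProbabilityMeasure ν],
      μ ≠ ν → μ - ν ≠ 0 := fun {μ ν} _ _ hμν h0 =>
    hμν <| Measure.eq_of_le_of_measure_univ_eq
      (by simpa only [zero_add] using Measure.sub_le_iff_le_add.1 h0.le) (by simp)
  exact not_mutuallySingular_of_invariant hcontr hirr hdini hpos (invariant_sub h₁ h₂)
    (invariant_sub h₂ h₁) (hsub hne) (hsub (Ne.symm hne)) Measure.mutually_singular_measure_sub

end Uniqueness

end MarkovSystem

theorem DiniContinuousOn.tendsto_modulusOn {X : Type*} [PseudoMetricSpace X] {h : X → ℝ}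
    {s : Set X} (hd : DiniContinuousOn h s) (h0 : ∀ x, 0 ≤ h x) (h1 : ∀ x, h x ≤ 1) :
    Tendsto (fun k : ℕ => modulusOn h s ((1 / 2) ^ k)) atTop (𝓝 0) := by
  simpa only [one_mul] using ENNReal.tendsto_atTop_zero_of_tsum_ne_top
    (hd.tsum_modulusOn_ne_top h0 h1 (b := 1 / 2) (by norm_num) (by norm_num) one_pos)

theorem DiniContinuousOn.continuousOn {X : Type*} [PseudoMetricSpace X] {h : X → ℝ}
    {s : Set X} (hd : DiniContinuousOn h s) (h0 : ∀ x, 0 ≤ h x) (h1 : ∀ x, h x ≤ 1) :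
    ContinuousOn h s := by
  rw [Metric.continuousOn_iff]
  intro x hx ε hε
  obtain ⟨k, hk⟩ := ((hd.tendsto_modulusOn h0 h1).eventually_lt_const
    (ENNReal.ofReal_pos.2 hε)).exists
  refine ⟨(1 / 2) ^ k, by positivity, fun y hy hyx => ?_⟩
  rw [Real.dist_eq]
  exact (ENNReal.ofReal_lt_ofReal_iff hε).1 ((le_modulusOn hy hx hyx.le).trans_lt hk)

theorem continuous_of_continuousOn_isClopen {X : Type*} [TopologicalSpace X] {s : Set X}
    (hs : IsClopen s) {f : X → ℝ} (hf : ContinuousOn f s) (h0 : ∀ x ∉ s, f x = 0) :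
    Continuous f := by
  rw [← continuousOn_univ, ← Set.union_compl_self s]
  exact hf.union_of_isOpen (continuousOn_const.congr h0) hs.isOpen hs.compl.isOpen

section KrylovBogolyubov

variable {X : Type*} [MeasurableSpace X]

/-- The Krylov–Bogolyubov averages of the laws at the times `0, …, n` of the Markov chain with
transition kernel `κ` and initial law `ν`. -/
noncomputable def krylovAverage (κ : Kernel X X) (ν : Measure X) (n : ℕ) : Measure X :=
  ((n : ℝ≥0∞) + 1)⁻¹ • ∑ k ∈ Finset.range (n + 1), (fun ρ : Measure X => ρ.bind κ)^[k] ν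

variable (κ : Kernel X X) (ν : Measure X)

instance isProbabilityMeasure_iterate_bind [IsMarkovKernel κ] [IsProbabilityMeasure ν] (k : ℕ) :
    IsProbabilityMeasure ((fun ρ : Measure X => ρ.bind κ)^[k] ν) := by
  induction k with
  | zero => assumption
  | succ k ih => rw [Function.iterate_succ_apply']; infer_instance

instance [IsMarkovKernel κ] [IsProbabilityMeasure ν] (n : ℕ) :
    IsProbabilityMeasure (krylovAverage κ ν n) := by
  constructor
  simp only [krylovAverage, Measure.smul_apply, Measure.finsetSum_apply, measure_univ, smul_eq_mul,
    Finset.sum_const, Finset.card_range, nsmul_eq_mul, mul_one, Nat.cast_add, Nat.cast_one]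
  exact ENNReal.inv_mul_cancel (by simp) (by simp)

variable {κ ν}

theorem lintegral_krylovAverage_le {f : X → ℝ≥0∞} {D : ℝ≥0∞}
    (h : ∀ k, ∫⁻ y, f y ∂((fun ρ : Measure X => ρ.bind κ)^[k] ν) ≤ D) (n : ℕ) :
    ∫⁻ y, f y ∂(krylovAverage κ ν n) ≤ D := by
  rw [krylovAverage, lintegral_smul_measure, lintegral_finsetSum_measure, smul_eq_mul]
  calc _ ≤ ((n : ℝ≥0∞) + 1)⁻¹ * ∑ _ ∈ Finset.range (n + 1), D := by gcongr; exact h _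
    _ = D := by
      rw [Finset.sum_const, Finset.card_range, nsmul_eq_mul, ← mul_assoc, Nat.cast_add,
        Nat.cast_one, ENNReal.inv_mul_cancel (by simp) (by simp), one_mul]

theorem lintegral_iterate_bind_le [IsMarkovKernel κ] [IsProbabilityMeasure ν] {h : X → ℝ≥0∞}
    (hm : Measurable h) {a c D : ℝ≥0∞} (hdrift : ∀ x, ∫⁻ y, h y ∂κ x ≤ a * h x + c)
    (hD : a * D + c ≤ D) (h0 : ∫⁻ x, h x ∂ν ≤ D) (k : ℕ) :
    ∫⁻ x, h x ∂((fun ρ : Measure X => ρ.bind κ)^[k] ν) ≤ D := by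
  induction k with
  | zero => exact h0
  | succ k ih =>
    rw [Function.iterate_succ_apply', Measure.lintegral_bind κ.aemeasurable hm.aemeasurable]
    calc _ ≤ ∫⁻ x, (a * h x + c) ∂((fun ρ : Measure X => ρ.bind κ)^[k] ν) := lintegral_mono hdrift
      _ = a * ∫⁻ x, h x ∂((fun ρ : Measure X => ρ.bind κ)^[k] ν) + c := by
        rw [lintegral_add_right _ measurable_const, lintegral_const_mul _ hm, lintegral_const,
          measure_univ, mul_one]
      _ ≤ a * D + c := by gcongr
      _ ≤ D := hD

theorem abs_integral_kernel_krylovAverage_sub_le [IsMarkovKernel κ] [IsProbabilityMeasure ν]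
    {f : X → ℝ} (hf : Measurable f) {C : ℝ} (hC : ∀ x, |f x| ≤ C) (n : ℕ) :
    |∫ x, ∫ y, f y ∂κ x ∂(krylovAverage κ ν n) - ∫ x, f x ∂(krylovAverage κ ν n)| ≤
      2 * C / (n + 1) := by
  set m : ℕ → Measure X := fun k => (fun ρ : Measure X => ρ.bind κ)^[k] ν
  have hbound : ∀ (ρ : Measure X) [IsProbabilityMeasure ρ], |∫ x, f x ∂ρ| ≤ C := fun ρ _ => by
    simpa using norm_integral_le_of_norm_le_const (μ := ρ) (f := f) (ae_of_all _ hC)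
  have hintf : ∀ k, Integrable f (m k) := fun k =>
    Integrable.of_bound hf.aestronglyMeasurable C (ae_of_all _ hC)
  have hfintκ : ∀ k, Integrable (fun x => ∫ y, f y ∂κ x) (m k) := fun k =>
    Integrable.of_bound hf.stronglyMeasurable.integral_kernel.aestronglyMeasurable C
      (ae_of_all _ fun x => hbound (κ x))
  have hstep : ∀ k, ∫ x, ∫ y, f y ∂κ x ∂m k = ∫ x, f x ∂m (k + 1) := fun k => by
    simp only [m, Function.iterate_succ_apply', integral_bind_of_bounded hf hC]
  rw [krylovAverage, integral_smul_measure, integral_smul_measure,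
    integral_finsetSum_measure fun k _ => hfintκ k, integral_finsetSum_measure fun k _ => hintf k]
  simp only [hstep, ← smul_sub, ← Finset.sum_sub_distrib]
  rw [Finset.sum_range_sub fun k => ∫ x, f x ∂m k, smul_eq_mul, abs_mul, div_eq_inv_mul]
  have hn : ((n : ℝ≥0∞) + 1)⁻¹.toReal = ((n : ℝ) + 1)⁻¹ := by
    rw [ENNReal.toReal_inv, ENNReal.toReal_add (by simp) (by simp)]
    simp
  rw [hn, abs_of_nonneg (by positivity), two_mul]
  gcongr
  exact (abs_sub _ _).trans (add_le_add (hbound _) (hbound _))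

theorem isTightMeasureSet_of_lintegral_le [TopologicalSpace X] {h : X → ℝ} (hm : Measurable h)
    (hh : Tendsto h (cocompact X) atTop) {D : ℝ≥0∞} (hD : D ≠ ⊤) {S : Set (Measure X)}
    (hS : ∀ μ ∈ S, ∫⁻ x, ENNReal.ofReal (h x) ∂μ ≤ D) : IsTightMeasureSet S := by
  rw [isTightMeasureSet_iff_exists_isCompact_measure_compl_le]
  intro ε hε
  obtain ⟨r, hr, hr0⟩ : ∃ r : ℝ, D / ENNReal.ofReal r ≤ ε ∧ 0 < r := by
    have hlim : Tendsto (fun r : ℝ => D / ENNReal.ofReal r) atTop (𝓝 (D / ⊤)) :=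
      ENNReal.Tendsto.const_div ENNReal.tendsto_ofReal_atTop (Or.inr hD)
    rw [ENNReal.div_top] at hlim
    exact ((hlim.eventually_le_const hε).and (eventually_gt_atTop 0)).exists
  obtain ⟨C, hC, hCr⟩ := mem_cocompact.1 (hh.eventually_ge_atTop r)
  refine ⟨C, hC, fun μ hμ => ?_⟩
  calc μ Cᶜ ≤ μ {x | ENNReal.ofReal r ≤ ENNReal.ofReal (h x)} :=
        measure_mono fun x hx => ENNReal.ofReal_le_ofReal (hCr hx)
    _ ≤ (∫⁻ x, ENNReal.ofReal (h x) ∂μ) / ENNReal.ofReal r :=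
        meas_ge_le_lintegral_div hm.ennreal_ofReal.aemeasurable (by simpa using hr0)
          ENNReal.ofReal_ne_top
    _ ≤ D / ENNReal.ofReal r := ENNReal.div_le_div_right (hS μ hμ) _
    _ ≤ ε := hr

variable [TopologicalSpace X]

theorem invariant_of_tendsto_krylovAverage [HasOuterApproxClosed X] [BorelSpace X]
    [IsMarkovKernel κ] [IsProbabilityMeasure ν]
    (hfeller : ∀ f : BoundedContinuousFunction X ℝ, Continuous fun x => ∫ y, f y ∂κ x)
    {μ : ProbabilityMeasure X} {φ : ℕ → ℕ} (hφ : StrictMono φ)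
    (hμ : Tendsto (β := ProbabilityMeasure X)
      (fun n => ⟨krylovAverage κ ν (φ n), inferInstance⟩) atTop (𝓝 μ)) :
    κ.Invariant (μ : Measure X) := by
  refine ext_of_forall_integral_eq_of_IsFiniteMeasure fun f => ?_
  have hfm : Measurable f := f.continuous.measurable
  have hfC : ∀ y, |f y| ≤ ‖f‖ := f.norm_coe_le_norm
  rw [integral_bind_of_bounded hfm hfC]
  let κf : BoundedContinuousFunction X ℝ := BoundedContinuousFunction.ofNormedAddCommGroup
    (fun x => ∫ y, f y ∂κ x) (hfeller f) ‖f‖ fun x => by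
      simpa using norm_integral_le_of_norm_le_const (μ := κ x) (f := f) (ae_of_all _ hfC)
  have hf := ProbabilityMeasure.tendsto_iff_forall_integral_tendsto.1 hμ f
  have hκf := ProbabilityMeasure.tendsto_iff_forall_integral_tendsto.1 hμ κf
  have h0 : Tendsto (fun n => ∫ y, κf y ∂(krylovAverage κ ν (φ n)) -
      ∫ y, f y ∂(krylovAverage κ ν (φ n))) atTop (𝓝 0) := by
    refine squeeze_zero_norm (a := fun n : ℕ => 2 * ‖f‖ / ((φ n : ℝ) + 1))
      (fun n => abs_integral_kernel_krylovAverage_sub_le hfm hfC (φ n)) ?_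
    exact tendsto_const_nhds.div_atTop (tendsto_atTop_add_const_right _ _
      (tendsto_natCast_atTop_atTop.comp hφ.tendsto_atTop))
  exact sub_eq_zero.1 (tendsto_nhds_unique (hκf.sub hf) h0)

theorem exists_invariant_of_lintegral_le [TopologicalSpace.MetrizableSpace X]
    [TopologicalSpace.SeparableSpace X] [BorelSpace X] [IsMarkovKernel κ] [IsProbabilityMeasure ν]
    (hfeller : ∀ f : BoundedContinuousFunction X ℝ, Continuous fun x => ∫ y, f y ∂κ x)
    {h : X → ℝ} (hc : Continuous h) (h0 : ∀ x, 0 ≤ h x) (hh : Tendsto h (cocompact X) atTop)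
    {D : ℝ≥0∞} (hDtop : D ≠ ⊤)
    (hD : ∀ k, ∫⁻ x, ENNReal.ofReal (h x) ∂((fun ρ : Measure X => ρ.bind κ)^[k] ν) ≤ D) :
    ∃ μ : Measure X, IsProbabilityMeasure μ ∧ κ.Invariant μ ∧
      ∫⁻ x, ENNReal.ofReal (h x) ∂μ ≤ D := by
  let m : ℕ → ProbabilityMeasure X := fun n => ⟨krylovAverage κ ν n, inferInstance⟩
  have hmD : ∀ n, ∫⁻ x, ENNReal.ofReal (h x) ∂(m n : Measure X) ≤ D :=
    lintegral_krylovAverage_le hD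
  have hcomp : IsCompact (closure (Set.range m)) := by
    refine isCompact_closure_of_isTightMeasureSet
      (isTightMeasureSet_of_lintegral_le hc.measurable hh hDtop ?_)
    rintro _ ⟨_, ⟨n, rfl⟩, rfl⟩
    exact hmD n
  obtain ⟨μ, -, φ, hφ, hμ⟩ := hcomp.tendsto_subseq fun n => subset_closure (Set.mem_range_self n)
  refine ⟨μ, inferInstance, invariant_of_tendsto_krylovAverage hfeller hφ hμ, ?_⟩
  calc ∫⁻ x, ENNReal.ofReal (h x) ∂(μ : Measure X)
      ≤ atTop.liminf fun n => ∫⁻ x, ENNReal.ofReal (h x) ∂(m (φ n) : Measure X) :=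
        lintegral_le_liminf_lintegral_of_forall_isOpen_measure_le_liminf_measure hc h0
          fun _ hG => ProbabilityMeasure.le_liminf_measure_open_of_tendsto hμ hG
    _ ≤ D := liminf_le_of_frequently_le' (Frequently.of_forall fun n => hmD (φ n))

end KrylovBogolyubov

namespace MarkovSystem

variable {K V E : Type*} [MeasurableSpace K] [Fintype E] {𝓜 : MarkovSystem K V E}

theorem isClopen_cell [TopologicalSpace K] (hopen : ∀ v, IsOpen (𝓜.cell v)) (v : V) :
    IsClopen (𝓜.cell v) := by
  refine ⟨⟨?_⟩, hopen v⟩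
  have : (𝓜.cell v)ᶜ = ⋃ v' ∈ {v' | v' ≠ v}, 𝓜.cell v' := by
    ext x
    simp only [Set.mem_compl_iff, Set.mem_ofPred_eq, Set.mem_iUnion, exists_prop]
    constructor
    · intro hx
      obtain ⟨v', hv'⟩ := 𝓜.exists_mem_cell x
      exact ⟨v', fun h => hx (h ▸ hv'), hv'⟩
    · rintro ⟨v', hne, hv'⟩ hx
      exact hne (𝓜.cell_unique hv' hx)
  rw [this]
  exact isOpen_biUnion fun v' _ => hopen v'

section Regularity

variable [MetricSpace K]

theorem continuous_p (hopen : ∀ v, IsOpen (𝓜.cell v)) (hdini : 𝓜.IsDini) (e : E) :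
    Continuous (𝓜.p e) :=
  continuous_of_continuousOn_isClopen (isClopen_cell hopen _)
    ((hdini e).continuousOn (𝓜.p_nonneg e) (𝓜.p_le_one e)) (𝓜.p_eq_zero e)

theorem IsContractive.exists_lipschitzOnWith (hcontr : 𝓜.IsContractive)
    (hpos : 𝓜.IsBoundedBelow) (e : E) :
    ∃ L : NNReal, LipschitzOnWith L (𝓜.w e) (𝓜.cell (𝓜.init e)) := by
  obtain ⟨a, ha0, -, ha⟩ := hcontr
  obtain ⟨δ, hδ0, hδ⟩ := hpos e
  refine ⟨(a / δ).toNNReal, LipschitzOnWith.of_dist_le_mul fun x hx y hy => ?_⟩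
  rw [Real.coe_toNNReal _ (by positivity), div_mul_eq_mul_div, le_div_iff₀ hδ0, mul_comm]
  refine le_trans ?_ (ha _ x hx y hy)
  refine le_trans ?_ (Finset.single_le_sum
    (f := fun e => 𝓜.p e x * dist (𝓜.w e x) (𝓜.w e y))
    (fun e _ => mul_nonneg (𝓜.p_nonneg e x) dist_nonneg) (Finset.mem_univ e))
  exact mul_le_mul_of_nonneg_right (hδ x hx) dist_nonneg

theorem continuous_markovOp (hcontr : 𝓜.IsContractive) (hopen : ∀ v, IsOpen (𝓜.cell v))
    (hdini : 𝓜.IsDini) (hpos : 𝓜.IsBoundedBelow) {f : K → ℝ} (hf : Continuous f) :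
    Continuous (𝓜.markovOp f) := by
  refine continuous_finsetSum _ fun e _ =>
    continuous_of_continuousOn_isClopen (isClopen_cell hopen (𝓜.init e)) ?_ fun x hx => by
      rw [𝓜.p_eq_zero e x hx, zero_mul]
  obtain ⟨L, hL⟩ := hcontr.exists_lipschitzOnWith hpos e
  exact (continuous_p hopen hdini e).continuousOn.mul (hf.comp_continuousOn hL.continuousOn)

variable [Fintype V]

variable (𝓜) in
/-- The distance to the base point of the cell. -/
noncomputable def height (x : V → K) (z : K) : ℝ :=
  ∑ v, (𝓜.cell v).indicator (fun z => dist z (x v)) z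

theorem height_eq (x : V → K) {z : K} {v : V} (hz : z ∈ 𝓜.cell v) :
    𝓜.height x z = dist z (x v) := by
  rw [height, Finset.sum_eq_single v]
  · rw [Set.indicator_of_mem hz]
  · intro v' _ hne
    exact Set.indicator_of_notMem (fun h => hne (𝓜.cell_unique h hz)) _
  · simp

theorem height_nonneg (x : V → K) (z : K) : 0 ≤ 𝓜.height x z := by
  obtain ⟨v, hv⟩ := 𝓜.exists_mem_cell z
  rw [height_eq x hv]
  exact dist_nonneg

theorem continuous_height (hopen : ∀ v, IsOpen (𝓜.cell v)) (x : V → K) :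
    Continuous (𝓜.height x) :=
  continuous_finsetSum _ fun v _ =>
    (isClopen_cell hopen v).continuous_indicator (continuous_id.dist continuous_const)

theorem ContractsBy.markovOp_height_le {a : ℝ} (ha : 𝓜.ContractsBy a) {x : V → K}
    (hx : ∀ v, x v ∈ 𝓜.cell v) (z : K) :
    𝓜.markovOp (𝓜.height x) z ≤
      a * 𝓜.height x z + ∑ e, dist (𝓜.w e (x (𝓜.init e))) (x (𝓜.term e)) := by
  obtain ⟨v, hv⟩ := 𝓜.exists_mem_cell z
  rw [height_eq x hv]
  refine le_trans ?_ (add_le_add_left (ha v z hv (x v) (hx v)) _)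
  rw [← Finset.sum_add_distrib]
  refine Finset.sum_le_sum fun e _ => ?_
  by_cases hp : 𝓜.p e z = 0
  · simp [hp]
  obtain rfl := 𝓜.cell_unique hv (𝓜.mem_cell_init_of_p_ne_zero hp)
  rw [height_eq x (𝓜.w_mapsTo e hv)]
  have h1 := dist_triangle (𝓜.w e z) (𝓜.w e (x (𝓜.init e))) (x (𝓜.term e))
  have h2 := mul_le_mul_of_nonneg_left h1 (𝓜.p_nonneg e z)
  have h3 : 𝓜.p e z * dist (𝓜.w e (x (𝓜.init e))) (x (𝓜.term e)) ≤
      dist (𝓜.w e (x (𝓜.init e))) (x (𝓜.term e)) :=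
    mul_le_of_le_one_left dist_nonneg (𝓜.p_le_one e z)
  linarith

theorem tendsto_height_cocompact [ProperSpace K] (x : V → K) :
    Tendsto (𝓜.height x) (cocompact K) atTop := by
  refine tendsto_atTop.2 fun r => mem_cocompact.2 ⟨⋃ v, Metric.closedBall (x v) r,
    isCompact_iUnion fun v => isCompact_closedBall _ _, fun z hz => ?_⟩
  obtain ⟨v, hv⟩ := 𝓜.exists_mem_cell z
  rw [Set.mem_ofPred_eq, height_eq x hv]
  simp only [Set.mem_compl_iff, Set.mem_iUnion, Metric.mem_closedBall, not_exists, not_le] at hz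
  exact (hz v).le

theorem ContractsBy.lintegral_height_kernel_le {a : ℝ} (ha : 𝓜.ContractsBy a) (ha0 : 0 ≤ a)
    {x : V → K} (hx : ∀ v, x v ∈ 𝓜.cell v) (hm : Measurable (𝓜.height x)) (z : K) :
    ∫⁻ y, ENNReal.ofReal (𝓜.height x y) ∂𝓜.kernel z ≤
      ENNReal.ofReal a * ENNReal.ofReal (𝓜.height x z) +
        ENNReal.ofReal (∑ e, dist (𝓜.w e (x (𝓜.init e))) (x (𝓜.term e))) := by
  have hle := ENNReal.ofReal_le_ofReal (ha.markovOp_height_le hx z)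
  rw [ENNReal.ofReal_add (mul_nonneg ha0 (height_nonneg x z))
    (Finset.sum_nonneg fun e _ => dist_nonneg), ENNReal.ofReal_mul ha0, markovOp,
    ENNReal.ofReal_sum_of_nonneg fun e _ => mul_nonneg (𝓜.p_nonneg e z) (height_nonneg x _)] at hle
  rw [𝓜.lintegral_kernel hm.ennreal_ofReal]
  simpa only [ENNReal.ofReal_mul (𝓜.p_nonneg _ z)] using hle

theorem exists_invariant [ProperSpace K] [BorelSpace K] [Nonempty K] (hcontr : 𝓜.IsContractive)
    (hopen : ∀ v, IsOpen (𝓜.cell v)) (hdini : 𝓜.IsDini) (hpos : 𝓜.IsBoundedBelow) {x : V → K}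
    (hx : ∀ v, x v ∈ 𝓜.cell v) :
    ∃ μ : Measure K, IsProbabilityMeasure μ ∧ 𝓜.kernel.Invariant μ ∧ Integrable (𝓜.height x) μ := by
  obtain ⟨z⟩ := ‹Nonempty K›
  obtain ⟨a, ha0, ha1, ha : 𝓜.ContractsBy a⟩ := id hcontr
  have hh := continuous_height (𝓜 := 𝓜) hopen x
  have hz0 : 0 ≤ 𝓜.height x z := height_nonneg x z
  have h1a : 0 < 1 - a := sub_pos.2 ha1
  set C := ∑ e, dist (𝓜.w e (x (𝓜.init e))) (x (𝓜.term e))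
  have hC : 0 ≤ C := Finset.sum_nonneg fun e _ => dist_nonneg
  have hD : a * (𝓜.height x z + C / (1 - a)) + C ≤ 𝓜.height x z + C / (1 - a) := by
    have hCa : (1 - a) * (C / (1 - a)) = C := mul_div_cancel₀ C h1a.ne'
    nlinarith [mul_nonneg h1a.le hz0]
  have hbound := lintegral_iterate_bind_le (κ := 𝓜.kernel) (ν := Measure.dirac z)
    (D := ENNReal.ofReal (𝓜.height x z + C / (1 - a))) hh.measurable.ennreal_ofReal
    (ha.lintegral_height_kernel_le ha0.le hx hh.measurable)
    (by rw [← ENNReal.ofReal_mul ha0.le, ← ENNReal.ofReal_add (by positivity) hC]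
        exact ENNReal.ofReal_le_ofReal hD)
    (by rw [lintegral_dirac' _ hh.measurable.ennreal_ofReal]
        exact ENNReal.ofReal_le_ofReal (le_add_of_nonneg_right (by positivity)))
  obtain ⟨μ, hμ, hinv, hfin⟩ := exists_invariant_of_lintegral_le
    (fun f => by
      simpa only [𝓜.integral_kernel f.continuous.measurable] using!
        continuous_markovOp hcontr hopen hdini hpos f.continuous)
    hh (height_nonneg x) (tendsto_height_cocompact x) ENNReal.ofReal_ne_top hbound
  exact ⟨μ, hμ, hinv, (lintegral_ofReal_ne_top_iff_integrable
    hh.measurable.aestronglyMeasurable (ae_of_all _ (height_nonneg x))).1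
    (ne_top_of_le_ne_top ENNReal.ofReal_ne_top hfin)⟩

end Regularity

end MarkovSystem

/-! ### Cylinders of the code space -/

section CodeSpace

variable {E : Type*}

/-- The word of length `n` that occurs in `σ` at the places `m, m + 1, …`. -/
def window (m : ℤ) (n : ℕ) (σ : ℤ → E) : Fin n → E := fun j => σ (m + j)

theorem cylinderAt_ofFn (m : ℤ) {n : ℕ} (g : Fin n → E) :
    cylinderAt m (List.ofFn g) = window m n ⁻¹' {g} := by
  ext σ
  simp only [cylinderAt, Set.mem_ofPred_eq, Set.mem_preimage, Set.mem_singleton_iff,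
    List.getElem_ofFn, List.length_ofFn]
  exact ⟨fun h => funext fun j => h j j.2, fun h j hj => congrFun h ⟨j, hj⟩⟩

@[simp] theorem cylinderAt_nil (m : ℤ) : cylinderAt m ([] : List E) = Set.univ := by
  ext σ
  simp [cylinderAt]

theorem mem_cylinderAt_cons {m : ℤ} {e : E} {l : List E} {σ : ℤ → E} :
    σ ∈ cylinderAt m (e :: l) ↔ σ m = e ∧ σ ∈ cylinderAt (m + 1) l := by
  simp only [cylinderAt, Set.mem_ofPred_eq, List.length_cons]
  constructor
  · intro h
    refine ⟨by simpa using h 0 (by omega), fun j hj => ?_⟩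
    have := h (j + 1) (by omega)
    simp only [Nat.cast_add, Nat.cast_one, List.getElem_cons_succ] at this
    rw [← this]
    congr 1
    ring
  · rintro ⟨h0, h⟩ j hj
    cases j with
    | zero => simpa using h0
    | succ j =>
      rw [List.getElem_cons_succ, ← h j (by omega)]
      congr 1
      push_cast
      ring

theorem mem_cylinderAt_append {m : ℤ} {l l' : List E} {σ : ℤ → E} :
    σ ∈ cylinderAt m (l ++ l') ↔ σ ∈ cylinderAt m l ∧ σ ∈ cylinderAt (m + l.length) l' := by
  induction l generalizing m with
  | nil => simp
  | cons e l ih =>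
    rw [List.cons_append, mem_cylinderAt_cons, ih, mem_cylinderAt_cons, and_assoc,
      List.length_cons, show m + 1 + (l.length : ℤ) = m + (l.length + 1 : ℕ) by push_cast; ring]

theorem cylinderAt_append_singleton (m : ℤ) (l : List E) (e : E) :
    cylinderAt m (l ++ [e]) = cylinderAt m l ∩ {σ | σ (m + l.length) = e} := by
  ext σ
  rw [mem_cylinderAt_append, mem_cylinderAt_cons]
  simp

theorem preimage_shiftBy_cylinderAt (k m : ℤ) (l : List E) :
    shiftBy k ⁻¹' cylinderAt m l = cylinderAt (m + k) l := by
  ext σ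
  simp only [cylinderAt, shiftBy, Set.mem_preimage, Set.mem_ofPred_eq, add_right_comm]

theorem ofFn_window_succ (m : ℤ) (n : ℕ) (σ : ℤ → E) :
    List.ofFn (window m (n + 1) σ) = σ m :: List.ofFn (window (m + 1) n σ) := by
  rw [List.ofFn_succ]
  simp only [window, Fin.val_zero, Nat.cast_zero, add_zero, Fin.val_succ]
  congr 2
  funext j
  congr 1
  push_cast
  ring

theorem tail_window (m : ℤ) (n : ℕ) (σ : ℤ → E) :
    Fin.tail (window m (n + 1) σ) = window (m + 1) n σ := by
  funext j
  simp only [window, Fin.tail, Fin.val_succ]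
  congr 1
  push_cast
  ring

theorem exists_comp_window_eq {m m' : ℤ} {n n' : ℕ} (h : m' ≤ m) (h' : m + n ≤ m' + n') :
    ∃ ρ : (Fin n' → E) → Fin n → E, ∀ σ, ρ (window m' n' σ) = window m n σ := by
  refine ⟨fun g i => g ⟨(m + i - m').toNat, by omega⟩, fun σ => funext fun i => ?_⟩
  simp only [window]
  congr 1
  omega

theorem ofFn_window_succ_last (m : ℤ) (n : ℕ) (σ : ℤ → E) :
    List.ofFn (window m (n + 1) σ) = List.ofFn (window m n σ) ++ [σ (m + n)] := by
  induction n generalizing m with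
  | zero => simp [window]
  | succ n ih =>
    rw [ofFn_window_succ, ih, ofFn_window_succ m n]
    simp only [List.cons_append, Nat.cast_add, Nat.cast_one]
    congr 4
    ring

@[simp] theorem window_leftShift (m : ℤ) (n : ℕ) (σ : ℤ → E) :
    window m n (leftShift σ) = window (m + 1) n σ := by
  funext j
  simp only [window, leftShift, shiftBy]
  congr 1
  ring

theorem shiftBy_shiftBy (j k : ℤ) (σ : ℤ → E) : shiftBy j (shiftBy k σ) = shiftBy (j + k) σ := by
  funext n
  simp only [shiftBy]
  congr 1
  ring

@[simp] theorem shiftBy_zero (σ : ℤ → E) : shiftBy 0 σ = σ := by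
  funext n
  simp [shiftBy]

theorem image_shiftBy (k : ℤ) (s : Set (ℤ → E)) : shiftBy k '' s = shiftBy (-k) ⁻¹' s := by
  refine congrFun (Set.image_eq_preimage_of_inverse (fun σ => ?_) (fun σ => ?_)) s <;>
    simp [shiftBy_shiftBy]

theorem iterate_leftShift (n : ℕ) : (leftShift : (ℤ → E) → (ℤ → E))^[n] = shiftBy n := by
  induction n with
  | zero => funext σ; simp
  | succ n ih =>
    rw [Function.iterate_succ', ih]
    funext σ
    simp only [Function.comp_apply, leftShift, shiftBy_shiftBy]
    congr 1
    push_cast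
    ring

/-- The two-sided sequence in which the word `g` stands at the places `-n, …, n` and which is
constant elsewhere. -/
def extendWord (e₀ : E) (n : ℕ) (g : Fin (2 * n + 1) → E) (j : ℤ) : E :=
  if h : (j + n).toNat < 2 * n + 1 then g ⟨(j + n).toNat, h⟩ else e₀

theorem window_extendWord (e₀ : E) (n : ℕ) (g : Fin (2 * n + 1) → E) :
    window (-n) (2 * n + 1) (extendWord e₀ n g) = g := by
  funext j
  have h : (-(n : ℤ) + j + n).toNat = j := by omega
  simp only [window, extendWord, h, j.2, dite_true]

variable [MeasurableSpace E]

@[fun_prop]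
theorem measurable_window (m : ℤ) (n : ℕ) : Measurable (window m n : (ℤ → E) → Fin n → E) :=
  measurable_pi_lambda _ fun _ => measurable_pi_apply _

@[fun_prop]
theorem measurable_shiftBy (k : ℤ) : Measurable (shiftBy k : (ℤ → E) → ℤ → E) :=
  measurable_pi_lambda _ fun _ => measurable_pi_apply _

@[fun_prop]
theorem measurable_leftShift : Measurable (leftShift : (ℤ → E) → ℤ → E) := measurable_shiftBy 1

theorem exists_window_of_mem_measurableCylinders {s : Set (ℤ → E)}
    (hs : s ∈ measurableCylinders fun _ : ℤ => E) :
    ∃ (n : ℕ) (S : Set (Fin (2 * n + 1) → E)), s = window (-n) (2 * n + 1) ⁻¹' S := by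
  obtain ⟨I, S, -, rfl⟩ := (mem_measurableCylinders _).1 hs
  obtain ⟨n, hn⟩ : ∃ n : ℕ, ∀ i ∈ I, |i| ≤ n := by
    refine ⟨∑ i ∈ I, i.natAbs, fun i hi => ?_⟩
    rw [Int.abs_eq_natAbs]
    exact_mod_cast Finset.single_le_sum (f := Int.natAbs) (fun _ _ => Nat.zero_le _) hi
  have hlt : ∀ i : I, ((i : ℤ) + n).toNat < 2 * n + 1 := fun i => by
    have := abs_le.1 (hn i i.2)
    omega
  refine ⟨n, {g | (fun i : I => g ⟨((i : ℤ) + n).toNat, hlt i⟩) ∈ S}, ?_⟩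
  ext σ
  simp only [mem_cylinder, Set.mem_preimage, Set.mem_ofPred_eq, window]
  suffices h : (I.restrict σ) = fun i : I => σ (-(n : ℤ) + ((i : ℤ) + n).toNat) by rw [h]
  funext i
  have := abs_le.1 (hn i i.2)
  simp only [Finset.restrict]
  congr 1
  omega

variable [DiscreteMeasurableSpace E]

theorem measurableSet_eval (j : ℤ) (e : E) : MeasurableSet {σ : ℤ → E | σ j = e} :=
  measurableSet_preimage (measurable_pi_apply (X := fun _ : ℤ => E) j) (measurableSet_singleton e)

section Finite

variable [Finite E]

theorem measurableSet_cylinderAt (m : ℤ) (l : List E) : MeasurableSet (cylinderAt m l) := by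
  rw [← List.ofFn_getElem (xs := l), cylinderAt_ofFn]
  exact measurable_window _ _ (measurableSet_singleton _)

theorem measurable_of_window {X : Type*} [MeasurableSpace X] (m : ℤ) (n : ℕ)
    (f : (Fin n → E) → X) : Measurable fun σ : ℤ → E => f (window m n σ) :=
  (measurable_of_finite f).comp (measurable_window m n)

theorem map_window_eq {Λ Λ' : Measure (ℤ → E)} {m : ℤ} {n : ℕ}
    (h : ∀ g : Fin n → E, Λ (cylinderAt m (List.ofFn g)) = Λ' (cylinderAt m (List.ofFn g))) :
    Λ.map (window m n) = Λ'.map (window m n) := by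
  refine Measure.ext_of_singleton fun g => ?_
  rw [Measure.map_apply (measurable_window m n) (measurableSet_singleton _),
    Measure.map_apply (measurable_window m n) (measurableSet_singleton _), ← cylinderAt_ofFn, h]

theorem measure_ext_of_cylinderAt {Λ Λ' : Measure (ℤ → E)} [IsFiniteMeasure Λ]
    (h : ∀ (n : ℕ) (g : Fin (2 * n + 1) → E),
      Λ (cylinderAt (-n) (List.ofFn g)) = Λ' (cylinderAt (-n) (List.ofFn g))) : Λ = Λ' := by
  have hwin : ∀ (n : ℕ) (S : Set (Fin (2 * n + 1) → E)),
      Λ (window (-n) (2 * n + 1) ⁻¹' S) = Λ' (window (-n) (2 * n + 1) ⁻¹' S) := fun n S => by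
    rw [← Measure.map_apply (measurable_window _ _) S.toFinite.measurableSet,
      ← Measure.map_apply (measurable_window _ _) S.toFinite.measurableSet,
      map_window_eq fun g => h n g]
  refine ext_of_generate_finite _ generateFrom_measurableCylinders.symm
    isPiSystem_measurableCylinders (fun s hs => ?_) (by simpa using hwin 0 Set.univ)
  obtain ⟨n, S, rfl⟩ := exists_window_of_mem_measurableCylinders hs
  exact hwin n S

end Finite

variable [Fintype E]

theorem lintegral_window (Λ : Measure (ℤ → E)) (m : ℤ) (n : ℕ) (f : (Fin n → E) → ℝ≥0∞) :
    ∫⁻ σ, f (window m n σ) ∂Λ = ∑ g, f g * Λ (cylinderAt m (List.ofFn g)) := by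
  rw [← lintegral_map (measurable_of_finite f) (measurable_window m n), lintegral_fintype]
  refine Finset.sum_congr rfl fun g _ => ?_
  rw [Measure.map_apply (measurable_window m n) (measurableSet_singleton _), cylinderAt_ofFn]

theorem integral_window (Λ : Measure (ℤ → E)) [IsFiniteMeasure Λ] (m : ℤ) (n : ℕ)
    (f : (Fin n → E) → ℝ) :
    ∫ σ, f (window m n σ) ∂Λ = ∑ g, Λ.real (cylinderAt m (List.ofFn g)) * f g := by
  rw [← integral_map (measurable_window m n).aemeasurable
    (measurable_of_finite f).aestronglyMeasurable, integral_fintype .of_finite]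
  refine Finset.sum_congr rfl fun g _ => ?_
  rw [map_measureReal_apply (measurable_window m n) (measurableSet_singleton _), cylinderAt_ofFn,
    smul_eq_mul]

theorem setIntegral_window (Λ : Measure (ℤ → E)) [IsFiniteMeasure Λ] (m : ℤ) (n : ℕ)
    (S : Set (Fin n → E)) (f : (Fin n → E) → ℝ) :
    ∫ σ in window m n ⁻¹' S, f (window m n σ) ∂Λ =
      ∑ g, Λ.real (cylinderAt m (List.ofFn g)) * S.indicator f g := by
  rw [← integral_indicator (measurable_window m n S.toFinite.measurableSet),
    ← integral_window Λ m n (S.indicator f)]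
  exact integral_congr_ae (ae_of_all _ fun _ => rfl)

theorem sum_measure_inter_eval (Λ : Measure (ℤ → E)) (s : Set (ℤ → E)) (j : ℤ) :
    ∑ e, Λ (s ∩ {σ | σ j = e}) = Λ s := by
  have hsum := sum_measure_preimage_singleton (μ := Λ.restrict s) (Finset.univ : Finset E)
    (f := fun σ : ℤ → E => σ j) fun e _ => measurableSet_eval j e
  rw [Finset.coe_univ, Set.preimage_univ, Measure.restrict_apply_univ] at hsum
  rw [← hsum]
  refine Finset.sum_congr rfl fun e _ => ?_
  rw [Set.inter_comm]
  exact (Measure.restrict_apply (measurableSet_eval j e)).symm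

theorem sum_setLIntegral_eval (Λ : Measure (ℤ → E)) (j : ℤ) (f : (ℤ → E) → ℝ≥0∞) :
    ∑ e, ∫⁻ σ in {σ | σ j = e}, f σ ∂Λ = ∫⁻ σ, f σ ∂Λ := by
  have hsplit : Λ = ∑ e, Λ.restrict {σ : ℤ → E | σ j = e} := by
    ext s hs
    rw [Measure.finsetSum_apply, ← sum_measure_inter_eval Λ s j]
    exact Finset.sum_congr rfl fun e _ => (Measure.restrict_apply hs).symm
  conv_rhs => rw [hsplit]
  rw [lintegral_finsetSum_measure]

theorem sum_measure_cylinderAt_cons (Λ : Measure (ℤ → E)) (m : ℤ) (l : List E) :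
    ∑ e, Λ (cylinderAt m (e :: l)) = Λ (cylinderAt (m + 1) l) := by
  rw [← sum_measure_inter_eval Λ (cylinderAt (m + 1) l) m]
  refine Finset.sum_congr rfl fun e _ => congrArg _ ?_
  ext σ
  rw [mem_cylinderAt_cons, and_comm]
  rfl

theorem sum_measure_cylinderAt_append (Λ : Measure (ℤ → E)) (m : ℤ) (l : List E) :
    ∑ e, Λ (cylinderAt m (l ++ [e])) = Λ (cylinderAt m l) := by
  simp only [cylinderAt_append_singleton]
  exact sum_measure_inter_eval Λ _ _

section KolmogorovExtension

variable {q : List E → ℝ≥0∞}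

theorem measure_cylinderAt_add_eq (hcons : ∀ l, ∑ e, q (e :: l) = q l)
    (happend : ∀ l, ∑ e, q (l ++ [e]) = q l) {Λ : Measure (ℤ → E)} {m : ℤ} {N : ℕ}
    (h : ∀ g : Fin N → E, Λ (cylinderAt m (List.ofFn g)) = q (List.ofFn g))
    (k : ℕ) (l : List E) (hl : k + l.length ≤ N) : Λ (cylinderAt (m + k) l) = q l := by
  induction k generalizing l with
  | zero =>
    rw [Nat.cast_zero, add_zero]
    obtain ⟨d, hd⟩ := Nat.exists_eq_add_of_le hl
    induction d generalizing l with
    | zero =>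
      have hN : N = l.length := by omega
      subst hN
      simpa using h l.get
    | succ d ih =>
      rw [← sum_measure_cylinderAt_append, ← happend]
      refine Finset.sum_congr rfl fun e _ => ih (l ++ [e]) ?_ ?_ <;> simp <;> omega
  | succ k ih =>
    rw [Nat.cast_add, Nat.cast_one, ← add_assoc, ← sum_measure_cylinderAt_cons, ← hcons]
    exact Finset.sum_congr rfl fun e _ => ih (e :: l) (by simp; omega)

/-- The law of a random word of length `2 n + 1` with the probabilities `q`, extended to a
two-sided sequence. -/
noncomputable def extendWordLaw (q : List E → ℝ≥0∞) (e₀ : E) (n : ℕ) : Measure (ℤ → E) :=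
  ∑ g : Fin (2 * n + 1) → E, q (List.ofFn g) • Measure.dirac (extendWord e₀ n g)

theorem extendWordLaw_cylinderAt (e₀ : E) (n : ℕ) (g : Fin (2 * n + 1) → E) :
    extendWordLaw q e₀ n (cylinderAt (-n) (List.ofFn g)) = q (List.ofFn g) := by
  classical
  have hdirac : ∀ g', Measure.dirac (extendWord e₀ n g') (cylinderAt (-n) (List.ofFn g)) =
      if g = g' then 1 else 0 := fun g' => by
    rw [Measure.dirac_apply' _ (measurableSet_cylinderAt _ _), cylinderAt_ofFn]
    simp only [Set.indicator_apply, Set.mem_preimage, window_extendWord, Set.mem_singleton_iff,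
      Pi.one_apply, eq_comm]
  simp only [extendWordLaw, Measure.finsetSum_apply, Measure.smul_apply, hdirac, smul_eq_mul,
    mul_ite, mul_one, mul_zero, Finset.sum_ite_eq, Finset.mem_univ, if_true]

omit [DiscreteMeasurableSpace E] in
theorem isProbabilityMeasure_extendWordLaw (hnil : q [] = 1)
    (happend : ∀ l, ∑ e, q (l ++ [e]) = q l) (e₀ : E) (n : ℕ) :
    IsProbabilityMeasure (extendWordLaw q e₀ n) := by
  have hsum : ∀ N : ℕ, ∑ g : Fin N → E, q (List.ofFn g) = 1 := fun N => by
    induction N with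
    | zero => simp [hnil]
    | succ N ih => rw [sum_ofFn_succ_last N q]; simp only [happend, ih]
  exact ⟨by simpa [extendWordLaw, Measure.finsetSum_apply] using hsum (2 * n + 1)⟩

theorem exists_measure_cylinderAt_eq [Nonempty E] (hnil : q [] = 1)
    (hcons : ∀ l, ∑ e, q (e :: l) = q l) (happend : ∀ l, ∑ e, q (l ++ [e]) = q l) :
    ∃ M : Measure (ℤ → E), IsProbabilityMeasure M ∧ ∀ m l, M (cylinderAt m l) = q l := by
  obtain ⟨e₀⟩ := ‹Nonempty E›
  let _ : TopologicalSpace E := ⊥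
  have : DiscreteTopology E := ⟨rfl⟩
  have hclopen : ∀ (m : ℤ) (l : List E), IsClopen (cylinderAt m l) := fun m l => by
    rw [← List.ofFn_getElem (xs := l), cylinderAt_ofFn]
    exact (isClopen_discrete _).preimage (continuous_pi fun j => continuous_apply _)
  let P : ℕ → ProbabilityMeasure (ℤ → E) := fun n =>
    ⟨extendWordLaw q e₀ n, isProbabilityMeasure_extendWordLaw hnil happend e₀ n⟩
  obtain ⟨M, φ, hφ, hM⟩ := CompactSpace.tendsto_subseq P
  refine ⟨M, inferInstance, fun m l => ?_⟩
  have hlim := ENNReal.tendsto_coe.2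
    (ProbabilityMeasure.tendsto_measure_of_isClopen_of_tendsto hM (hclopen m l))
  simp only [ProbabilityMeasure.ennreal_coeFn_eq_coeFn_toMeasure] at hlim
  refine tendsto_nhds_unique hlim (tendsto_const_nhds.congr' ?_)
  filter_upwards [hφ.tendsto_atTop.eventually_ge_atTop (m.natAbs + l.length)] with n hn
  have heq := measure_cylinderAt_add_eq hcons happend
    (extendWordLaw_cylinderAt e₀ (φ n)) (m + φ n).toNat l (by omega)
  rw [show -(φ n : ℤ) + ((m + φ n).toNat : ℕ) = m by omega] at heq
  exact heq.symm

end KolmogorovExtension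

end CodeSpace

/-! ### The generalized Markov measure -/

namespace MarkovSystem

variable {K V E : Type*} [MeasurableSpace K] [Fintype E] (𝓜 : MarkovSystem K V E)

/-- The mean over `μ` of the probability of a word. -/
noncomputable def wordMass (μ : Measure K) (l : List E) : ℝ≥0∞ :=
  ∫⁻ x, ENNReal.ofReal (𝓜.wordProb l x) ∂μ

theorem sum_wordMass_append (μ : Measure K) (l : List E) :
    ∑ e, 𝓜.wordMass μ (l ++ [e]) = 𝓜.wordMass μ l := by
  simp only [wordMass]
  rw [← lintegral_finsetSum _ fun e _ => (𝓜.measurable_wordProb _).ennreal_ofReal]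
  refine lintegral_congr fun x => ?_
  simp only [wordProb_append, wordProb_cons, wordProb_nil, mul_one,
    ENNReal.ofReal_mul (𝓜.wordProb_nonneg l x), ← Finset.mul_sum, sum_ofReal_p]

variable {𝓜}

theorem sum_wordMass_cons {μ : Measure K} (hμ : 𝓜.kernel.Invariant μ) (l : List E) :
    ∑ e, 𝓜.wordMass μ (e :: l) = 𝓜.wordMass μ l := by
  simp only [wordMass]
  conv_rhs => rw [← hμ.def, 𝓜.lintegral_bind_kernel μ (𝓜.measurable_wordProb l).ennreal_ofReal]
  rw [← lintegral_finsetSum _ fun e _ => (𝓜.measurable_wordProb _).ennreal_ofReal]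
  refine lintegral_congr fun x => Finset.sum_congr rfl fun e _ => ?_
  rw [wordProb_cons, ENNReal.ofReal_mul (𝓜.p_nonneg e x)]

variable [MeasurableSpace E]

theorem IsGeneralizedMarkovMeasure.isProbabilityMeasure {μ : Measure K} [IsProbabilityMeasure μ]
    {M : Measure (ℤ → E)} (hM : 𝓜.IsGeneralizedMarkovMeasure μ M) : IsProbabilityMeasure M := by
  constructor
  simpa using hM 0 []

variable [DiscreteMeasurableSpace E]

theorem exists_isGeneralizedMarkovMeasure [Nonempty K] {μ : Measure K} [IsProbabilityMeasure μ]
    (hμ : 𝓜.kernel.Invariant μ) : ∃ M : Measure (ℤ → E), 𝓜.IsGeneralizedMarkovMeasure μ M := by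
  obtain ⟨x₀⟩ := ‹Nonempty K›
  have : Nonempty E := by
    by_contra hE
    have := not_nonempty_iff.1 hE
    simpa using 𝓜.p_sum x₀
  obtain ⟨M, -, hM⟩ := exists_measure_cylinderAt_eq (q := 𝓜.wordMass μ) (by simp [wordMass])
    (sum_wordMass_cons hμ) (𝓜.sum_wordMass_append μ)
  exact ⟨M, hM⟩

theorem IsGeneralizedMarkovMeasure.eq {μ : Measure K} [IsProbabilityMeasure μ]
    {M M' : Measure (ℤ → E)} (hM : 𝓜.IsGeneralizedMarkovMeasure μ M)
    (hM' : 𝓜.IsGeneralizedMarkovMeasure μ M') : M = M' := by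
  have := hM.isProbabilityMeasure
  exact measure_ext_of_cylinderAt fun n g => by rw [hM, hM']

theorem IsGeneralizedMarkovMeasure.isInvariantProb {μ : Measure K} [IsProbabilityMeasure μ]
    {M : Measure (ℤ → E)} (hM : 𝓜.IsGeneralizedMarkovMeasure μ M) :
    IsInvariantProb leftShift M := by
  have := hM.isProbabilityMeasure
  refine ⟨this, measurable_leftShift, ?_⟩
  refine IsGeneralizedMarkovMeasure.eq (𝓜 := 𝓜) (μ := μ) (fun m l => ?_) hM
  rw [Measure.map_apply measurable_leftShift (measurableSet_cylinderAt m l), leftShift,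
    preimage_shiftBy_cylinderAt, hM]

end MarkovSystem

/-! ### The coding map and the energy function -/

theorem measurable_letter_comp {X Y Z E : Type*} [MeasurableSpace X] [MeasurableSpace Y]
    [MeasurableSpace Z] [MeasurableSpace E] [DiscreteMeasurableSpace E] [Finite E]
    {f : E → Y → Z} (hf : ∀ e, Measurable (f e)) {c : X → E} (hc : Measurable c) {F : X → Y}
    (hF : Measurable F) : Measurable fun s => f (c s) (F s) :=
  (measurable_from_prod_countable_right (f := fun q : E × Y => f q.1 q.2) hf).comp (hc.prodMk hF)

namespace MarkovSystem

variable {K V E : Type*} [MeasurableSpace K] [Fintype E] {𝓜 : MarkovSystem K V E}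

variable (𝓜) in
theorem neg_log_p_nonneg (e : E) (z : K) : 0 ≤ -Real.log (𝓜.p e z) :=
  neg_nonneg.2 (Real.log_nonpos (𝓜.p_nonneg e z) (𝓜.p_le_one e z))

variable (𝓜) in
theorem measurable_log_p (e : E) : Measurable fun z => Real.log (𝓜.p e z) :=
  Real.measurable_log.comp (𝓜.p_measurable e)

variable (𝓜) in
/-- `w_{eₙ} ∘ ⋯ ∘ w_{e₀} (x_{i(e₀)})` for the word `e₀ … eₙ`. -/
def wordPoint (x : V → K) {n : ℕ} (g : Fin (n + 1) → E) : K :=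
  𝓜.wordMap (List.ofFn g) (x (𝓜.init (g 0)))

theorem pastMap_eq_wordMap (σ : ℤ → E) (n : ℕ) (z : K) :
    𝓜.pastMap σ n z = 𝓜.wordMap (List.ofFn (window (-n) (n + 1) σ)) z := by
  induction n generalizing z with
  | zero => simp [pastMap, window]
  | succ n ih =>
    rw [ofFn_window_succ, wordMap_cons, pastMap, Function.comp_apply, ih]
    simp

theorem codingSeq_eq_wordPoint (x : V → K) (σ : ℤ → E) (n : ℕ) :
    𝓜.codingSeq x σ n = 𝓜.wordPoint x (window (-n) (n + 1) σ) := by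
  simp [codingSeq, pastMap_eq_wordMap, wordPoint, window]

theorem codingSeq_leftShift_succ (x : V → K) (σ : ℤ → E) (n : ℕ) :
    𝓜.codingSeq x (leftShift σ) (n + 1) = 𝓜.w (σ 1) (𝓜.codingSeq x σ n) := by
  simp only [codingSeq_eq_wordPoint, wordPoint, window_leftShift]
  rw [ofFn_window_succ_last, wordMap_append]
  simp [window]

theorem pastMap_mem_cell {σ : ℤ → E} (hσ : σ ∈ 𝓜.pathSpace) (n : ℕ) {z : K}
    (hz : z ∈ 𝓜.cell (𝓜.init (σ (-n)))) : 𝓜.pastMap σ n z ∈ 𝓜.cell (𝓜.init (σ 1)) := by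
  induction n generalizing z with
  | zero =>
    have := hσ 0
    rw [zero_add] at this
    rw [← this]
    exact 𝓜.w_mapsTo _ (by simpa using hz)
  | succ n ih =>
    refine ih ?_
    have := hσ (-((n : ℤ) + 1))
    rw [show -((n : ℤ) + 1) + 1 = -n by ring] at this
    rw [← this]
    exact 𝓜.w_mapsTo _ (by simpa using hz)

theorem codingSeq_mem_cell {x : V → K} (hx : ∀ v, x v ∈ 𝓜.cell v) {σ : ℤ → E}
    (hσ : σ ∈ 𝓜.pathSpace) (n : ℕ) : 𝓜.codingSeq x σ n ∈ 𝓜.cell (𝓜.init (σ 1)) :=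
  pastMap_mem_cell hσ n (hx _)

theorem mem_codingDomain [TopologicalSpace K] {x : V → K} {σ : ℤ → E} :
    σ ∈ 𝓜.codingDomain x ↔ ∀ k : ℤ, shiftBy k σ ∈ 𝓜.convergenceSet x := by
  simp only [codingDomain, image_shiftBy, Set.mem_iInter, Set.mem_preimage]
  exact ⟨fun h k => by simpa using h (-k), fun h k => h (-k)⟩

theorem mem_convergenceSet_of_mem_codingDomain [TopologicalSpace K] {x : V → K} {σ : ℤ → E}
    (hσ : σ ∈ 𝓜.codingDomain x) : σ ∈ 𝓜.convergenceSet x := by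
  simpa using mem_codingDomain.1 hσ 0

section Topology

variable [MetricSpace K] [Nonempty K] {x : V → K}

theorem tendsto_codingSeq {σ : ℤ → E} (hσ : σ ∈ 𝓜.convergenceSet x) :
    Tendsto (𝓜.codingSeq x σ) atTop (𝓝 (𝓜.codingMap x σ)) :=
  tendsto_nhds_limUnder hσ.2

theorem codingMap_mem_cell (hopen : ∀ v, IsOpen (𝓜.cell v)) (hx : ∀ v, x v ∈ 𝓜.cell v)
    {σ : ℤ → E} (hσ : σ ∈ 𝓜.convergenceSet x) :
    𝓜.codingMap x σ ∈ 𝓜.cell (𝓜.init (σ 1)) :=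
  (isClopen_cell hopen _).isClosed.mem_of_tendsto (tendsto_codingSeq hσ)
    (Eventually.of_forall fun n => codingSeq_mem_cell hx hσ.1 n)

theorem codingMap_leftShift (hcontr : 𝓜.IsContractive) (hopen : ∀ v, IsOpen (𝓜.cell v))
    (hpos : 𝓜.IsBoundedBelow) (hx : ∀ v, x v ∈ 𝓜.cell v) {σ : ℤ → E} (hσ : σ ∈ 𝓜.codingDomain x) :
    𝓜.codingMap x (leftShift σ) = 𝓜.w (σ 1) (𝓜.codingMap x σ) := by
  have h0 := mem_convergenceSet_of_mem_codingDomain hσ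
  have h1 : leftShift σ ∈ 𝓜.convergenceSet x := mem_codingDomain.1 hσ 1
  refine tendsto_nhds_unique ((tendsto_codingSeq h1).comp (tendsto_add_atTop_nat 1)) ?_
  obtain ⟨L, hL⟩ := hcontr.exists_lipschitzOnWith hpos (σ 1)
  have hw := (hL.continuousOn.continuousAt
    ((hopen _).mem_nhds (codingMap_mem_cell hopen hx h0))).tendsto.comp (tendsto_codingSeq h0)
  refine hw.congr fun n => ?_
  simp [codingSeq_leftShift_succ]

variable (𝓜) in
/-- Minus the energy, on the domain of the coding map. -/
noncomputable def rate (x : V → K) (σ : ℤ → E) : ℝ :=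
  -Real.log (𝓜.p (σ 1) (𝓜.codingMap x σ))

theorem energyIntegral_energy [MeasurableSpace E] {Λ : Measure (ℤ → E)}
    (h : ∀ᵐ σ ∂Λ, σ ∈ 𝓜.codingDomain x) (hi : Integrable (𝓜.rate x) Λ) :
    energyIntegral Λ (𝓜.energy x) = ((-∫ σ, 𝓜.rate x σ ∂Λ : ℝ) : EReal) := by
  have h1 : ∫⁻ σ, (-𝓜.energy x σ).toENNReal ∂Λ = ENNReal.ofReal (∫ σ, 𝓜.rate x σ ∂Λ) := by
    rw [ofReal_integral_eq_lintegral_ofReal hi (ae_of_all _ fun _ => 𝓜.neg_log_p_nonneg _ _)]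
    refine lintegral_congr_ae ?_
    filter_upwards [h] with σ hσ
    rw [energy, if_pos hσ, ← EReal.coe_neg, EReal.toENNReal_of_ne_top (EReal.coe_ne_top _),
      EReal.toReal_coe, rate]
  have h2 : 0 ≤ ∫ σ, 𝓜.rate x σ ∂Λ := integral_nonneg fun _ => 𝓜.neg_log_p_nonneg _ _
  rw [energyIntegral, h1, EReal.coe_ennreal_ofReal, max_eq_left h2, EReal.coe_neg]

end Topology

section Measurability

variable [MeasurableSpace E] [DiscreteMeasurableSpace E]

theorem measurable_codingSeq (x : V → K) (n : ℕ) :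
    Measurable fun σ => 𝓜.codingSeq x σ n := by
  simp only [codingSeq_eq_wordPoint]
  exact measurable_of_window _ _ _

theorem measurableSet_pathSpace : MeasurableSet 𝓜.pathSpace := by
  have : 𝓜.pathSpace = ⋂ j : ℤ, (fun σ : ℤ → E => (σ j, σ (j + 1))) ⁻¹'
      {q | 𝓜.term q.1 = 𝓜.init q.2} := by
    ext σ
    simp [pathSpace]
  rw [this]
  exact MeasurableSet.iInter fun j => ((measurable_pi_apply j).prodMk (measurable_pi_apply _))
    (Set.toFinite _).measurableSet

variable [MetricSpace K] [ProperSpace K] [BorelSpace K]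

theorem measurableSet_convergenceSet (x : V → K) :
    MeasurableSet (𝓜.convergenceSet x) :=
  measurableSet_pathSpace.inter (measurableSet_exists_tendsto fun n => measurable_codingSeq x n)

theorem measurableSet_codingDomain (x : V → K) :
    MeasurableSet (𝓜.codingDomain x) := by
  simp only [codingDomain, image_shiftBy]
  exact MeasurableSet.iInter fun k => measurable_shiftBy _ (measurableSet_convergenceSet x)

variable [Nonempty K]

@[fun_prop]
theorem measurable_codingMap (x : V → K) : Measurable (𝓜.codingMap x) :=
  (StronglyMeasurable.limUnder fun n => (measurable_codingSeq x n).stronglyMeasurable).measurable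

@[fun_prop]
theorem measurable_rate (x : V → K) : Measurable (𝓜.rate x) :=
  (measurable_letter_comp 𝓜.measurable_log_p (measurable_pi_apply 1) (measurable_codingMap x)).neg

theorem isEnergyFunction_energy (x : V → K) : IsEnergyFunction (𝓜.energy x) := by
  classical
  constructor
  · unfold energy
    refine Measurable.ite (measurableSet_codingDomain x) ?_ measurable_const
    exact (measurable_letter_comp 𝓜.measurable_log_p (measurable_pi_apply 1)
      (measurable_codingMap x)).coe_real_ereal
  · intro σ
    unfold energy
    split_ifs
    · have := 𝓜.neg_log_p_nonneg (σ 1) (𝓜.codingMap x σ)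
      exact_mod_cast (neg_nonneg.1 this)
    · exact bot_le

theorem energyIntegral_energy_eq_bot {x : V → K} {Λ : Measure (ℤ → E)}
    (h : ¬ ∀ᵐ σ ∂Λ, σ ∈ 𝓜.codingDomain x) :
    energyIntegral Λ (𝓜.energy x) = ⊥ := by
  have h1 : ∫⁻ σ, (-𝓜.energy x σ).toENNReal ∂Λ = ⊤ := by
    rw [eq_top_iff]
    calc (⊤ : ℝ≥0∞) = ∫⁻ _ in (𝓜.codingDomain x)ᶜ, ⊤ ∂Λ := by
          rw [setLIntegral_const, ENNReal.top_mul]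
          exact fun h0 => h (by rwa [ae_iff])
      _ ≤ ∫⁻ σ in (𝓜.codingDomain x)ᶜ, (-𝓜.energy x σ).toENNReal ∂Λ := by
          refine setLIntegral_mono' (measurableSet_codingDomain x).compl fun _ hσ => ?_
          rw [energy, if_neg hσ]
          simp
      _ ≤ _ := setLIntegral_le_lintegral _ _
  rw [energyIntegral, h1]
  simp

end Measurability

end MarkovSystem

/-! ### The coding map under the generalized Markov measure -/

theorem measure_ext_of_lipschitz {X : Type*} [MetricSpace X] [MeasurableSpace X] [BorelSpace X]
    {ν₁ ν₂ : Measure X} [IsFiniteMeasure ν₁] [IsFiniteMeasure ν₂]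
    (h : ∀ (L : NNReal) (f : X → ℝ), LipschitzWith L f → (∀ x, f x ∈ Set.Icc 0 1) →
      ∫ x, f x ∂ν₁ = ∫ x, f x ∂ν₂) : ν₁ = ν₂ := by
  have hclosed : ∀ s : Set X, IsClosed s → ν₁ s = ν₂ s := by
    intro s hs
    rw [← measureReal_eq_measureReal_iff]
    have hpos : ∀ n : ℕ, (0 : ℝ) < 1 / (n + 1) := fun n => by positivity
    have t₁ := tendsto_integral_thickenedIndicator_of_isClosed ν₁ hs hpos
      tendsto_one_div_add_atTop_nhds_zero_nat
    have t₂ := tendsto_integral_thickenedIndicator_of_isClosed ν₂ hs hpos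
      tendsto_one_div_add_atTop_nhds_zero_nat
    refine tendsto_nhds_unique t₁ (t₂.congr fun n => ?_)
    exact (h _ _ (NNReal.isometry_coe.lipschitz.comp (lipschitzWith_thickenedIndicator (hpos n) s))
      fun y => ⟨NNReal.coe_nonneg _, mod_cast thickenedIndicator_le_one (hpos n) s y⟩).symm
  refine ext_of_generate_finite _ (BorelSpace.measurable_eq.trans borel_eq_generateFrom_isClosed)
    isPiSystem_isClosed (fun s hs => hclosed s hs) (hclosed _ isClosed_univ)

namespace MarkovSystem

variable {K V E : Type*} [MeasurableSpace K] [Fintype E] {𝓜 : MarkovSystem K V E}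

theorem integrable_wordProb (μ : Measure K) [IsFiniteMeasure μ] (l : List E) :
    Integrable (𝓜.wordProb l) μ :=
  Integrable.of_bound (𝓜.measurable_wordProb l).aestronglyMeasurable 1 <| ae_of_all _ fun x => by
    rw [Real.norm_of_nonneg (𝓜.wordProb_nonneg l x)]
    exact 𝓜.wordProb_le_one l x

section Window

variable [MeasurableSpace E] {μ : Measure K} {M : Measure (ℤ → E)}

theorem IsGeneralizedMarkovMeasure.measureReal_cylinderAt
    (hM : 𝓜.IsGeneralizedMarkovMeasure μ M) (m : ℤ) (l : List E) :
    M.real (cylinderAt m l) = ∫ y, 𝓜.wordProb l y ∂μ := by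
  rw [Measure.real, hM, integral_eq_lintegral_of_nonneg_ae
    (ae_of_all _ fun y => 𝓜.wordProb_nonneg l y)
    (𝓜.measurable_wordProb l).aestronglyMeasurable]

variable [DiscreteMeasurableSpace E]

theorem IsGeneralizedMarkovMeasure.lintegral_window
    (hM : 𝓜.IsGeneralizedMarkovMeasure μ M) (m : ℤ) (n : ℕ) (f : (Fin n → E) → ℝ≥0∞) :
    ∫⁻ σ, f (window m n σ) ∂M =
      ∫⁻ y, ∑ g, ENNReal.ofReal (𝓜.wordProb (List.ofFn g) y) * f g ∂μ := by
  rw [_root_.lintegral_window, lintegral_finsetSum _ fun g _ =>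
    (𝓜.measurable_wordProb _).ennreal_ofReal.mul_const _]
  refine Finset.sum_congr rfl fun g _ => ?_
  rw [lintegral_mul_const _ (𝓜.measurable_wordProb _).ennreal_ofReal, hM, mul_comm]

theorem IsGeneralizedMarkovMeasure.integral_window [IsProbabilityMeasure μ]
    (hM : 𝓜.IsGeneralizedMarkovMeasure μ M) (m : ℤ) (n : ℕ) (f : (Fin n → E) → ℝ) :
    ∫ σ, f (window m n σ) ∂M = ∫ y, ∑ g, 𝓜.wordProb (List.ofFn g) y * f g ∂μ := by
  have := hM.isProbabilityMeasure
  rw [_root_.integral_window, integral_finsetSum _ fun g _ =>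
    (integrable_wordProb μ _).mul_const _]
  refine Finset.sum_congr rfl fun g _ => ?_
  rw [integral_mul_const, hM.measureReal_cylinderAt]

theorem IsGeneralizedMarkovMeasure.ae_shiftBy [IsProbabilityMeasure μ]
    (hM : 𝓜.IsGeneralizedMarkovMeasure μ M) {s : Set (ℤ → E)} (hs : ∀ᵐ σ ∂M, σ ∈ s) :
    ∀ᵐ σ ∂M, ∀ k : ℤ, shiftBy k σ ∈ s := by
  refine ae_all_iff.2 fun k => ?_
  have hmap : M.map (shiftBy k) = M := by
    refine IsGeneralizedMarkovMeasure.eq (𝓜 := 𝓜) (μ := μ) (fun m l => ?_) hM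
    rw [Measure.map_apply (measurable_shiftBy k) (measurableSet_cylinderAt m l),
      preimage_shiftBy_cylinderAt, hM]
  rw [← hmap] at hs
  exact ae_of_ae_map (measurable_shiftBy k).aemeasurable hs

theorem IsGeneralizedMarkovMeasure.ae_mem_pathSpace
    (hM : 𝓜.IsGeneralizedMarkovMeasure μ M) : ∀ᵐ σ ∂M, σ ∈ 𝓜.pathSpace := by
  classical
  refine (ae_all_iff (ι := ℤ)).2 fun j => ?_
  set f : (Fin 2 → E) → ℝ≥0∞ := fun g => if 𝓜.term (g 0) = 𝓜.init (g 1) then 0 else 1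
  have h0 : ∫⁻ σ, f (window j 2 σ) ∂M = 0 := by
    rw [hM.lintegral_window]
    refine (lintegral_congr fun y => ?_).trans lintegral_zero
    refine Finset.sum_eq_zero fun g _ => ?_
    obtain hg | hg := eq_or_ne (𝓜.term (g 0)) (𝓜.init (g 1))
    · simp [f, hg]
    · suffices h : 𝓜.wordProb (List.ofFn g) y = 0 by rw [h]; simp
      simp only [List.ofFn_succ, wordProb_cons, List.ofFn_zero]
      by_cases hp : 𝓜.p (g 0) y = 0
      · simp [hp]
      have hy := 𝓜.w_mapsTo _ (𝓜.mem_cell_init_of_p_ne_zero hp)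
      have := 𝓜.p_eq_zero (g 1) (𝓜.w (g 0) y) fun h => hg (𝓜.cell_unique hy h)
      simp [this]
  rw [lintegral_eq_zero_iff (measurable_of_window _ _ _)] at h0
  filter_upwards [h0] with σ hσ
  by_contra hne
  simp [f, window, hne] at hσ

theorem IsGeneralizedMarkovMeasure.setIntegral_codingSeq [IsProbabilityMeasure μ]
    (hM : 𝓜.IsGeneralizedMarkovMeasure μ M) (x : V → K) (e : E) (f : K → ℝ) (n : ℕ) :
    ∫ σ in {σ | σ 1 = e}, f (𝓜.codingSeq x σ n) ∂M =
      ∫ y, ∑ g : Fin (n + 1) → E, 𝓜.wordProb (List.ofFn g) y *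
        (𝓜.p e (𝓜.wordMap (List.ofFn g) y) * f (𝓜.wordPoint x g)) ∂μ := by
  classical
  set F : (Fin (n + 2) → E) → ℝ := fun g =>
    if g (Fin.last (n + 1)) = e then f (𝓜.wordPoint x (Fin.init g)) else 0
  have hwin : ∀ σ : ℤ → E, {σ : ℤ → E | σ 1 = e}.indicator (fun σ => f (𝓜.codingSeq x σ n)) σ =
      F (window (-n) (n + 2) σ) := fun σ => by
    have hlast : window (-n) (n + 2) σ (Fin.last (n + 1)) = σ 1 := by simp [window]
    simp only [F, hlast, codingSeq_eq_wordPoint, Set.indicator_apply, Set.mem_ofPred_eq]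
    rfl
  rw [← integral_indicator (measurableSet_eval 1 e), integral_congr_ae (ae_of_all _ hwin),
    hM.integral_window _ _ F]
  refine integral_congr_ae (ae_of_all _ fun y => ?_)
  simp only [F, sum_fin_succ_fun_last, Fin.snoc_last, Fin.init_snoc, mul_ite, mul_zero,
    Finset.sum_ite_eq', Finset.mem_univ, if_true, ofFn_snoc, wordProb_append, wordProb_cons,
    wordProb_nil, mul_one, mul_assoc]

end Window

section Coding

variable [MetricSpace K] [Fintype V]

theorem ContractsBy.sum_wordProb_mul_dist_wordPoint_le {a : ℝ} (ha : 𝓜.ContractsBy a)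
    (ha0 : 0 ≤ a) {x : V → K} (hx : ∀ v, x v ∈ 𝓜.cell v) (n : ℕ) (y : K) :
    ∑ g : Fin (n + 1) → E, 𝓜.wordProb (List.ofFn g) y *
      dist (𝓜.wordMap (List.ofFn g) y) (𝓜.wordPoint x g) ≤ a ^ (n + 1) * 𝓜.height x y := by
  obtain ⟨v, hv⟩ := 𝓜.exists_mem_cell y
  rw [height_eq x hv]
  refine le_trans (Finset.sum_le_sum fun g _ => le_of_eq ?_)
    (ha.sum_wordProb_mul_dist_le ha0 (n + 1) hv (hx v))
  by_cases hp : 𝓜.p (g 0) y = 0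
  · simp [List.ofFn_succ, hp]
  · rw [wordPoint, 𝓜.cell_unique (𝓜.mem_cell_init_of_p_ne_zero hp) hv]

theorem ContractsBy.sum_wordProb_mul_dist_wordPoint_tail_le {a : ℝ} (ha : 𝓜.ContractsBy a)
    (ha0 : 0 ≤ a) {x : V → K} (hx : ∀ v, x v ∈ 𝓜.cell v) (n : ℕ) (y : K) :
    ∑ g : Fin (n + 2) → E, 𝓜.wordProb (List.ofFn g) y *
      dist (𝓜.wordMap (List.ofFn g) y) (𝓜.wordPoint x (Fin.tail g)) ≤
      a ^ (n + 1) * 𝓜.markovOp (𝓜.height x) y := by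
  rw [sum_fin_succ_fun, markovOp, Finset.mul_sum]
  refine Finset.sum_le_sum fun e _ => ?_
  simp only [Fin.tail_cons, List.ofFn_cons, wordProb_cons, wordMap_cons, mul_assoc,
    ← Finset.mul_sum]
  rw [mul_left_comm]
  exact mul_le_mul_of_nonneg_left (ha.sum_wordProb_mul_dist_wordPoint_le ha0 hx n (𝓜.w e y))
    (𝓜.p_nonneg e y)

theorem ContractsBy.sum_wordProb_mul_dist_wordPoint_succ_le {a : ℝ} (ha : 𝓜.ContractsBy a)
    (ha0 : 0 ≤ a) {x : V → K} (hx : ∀ v, x v ∈ 𝓜.cell v) (n : ℕ) (y : K) :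
    ∑ g : Fin (n + 2) → E, 𝓜.wordProb (List.ofFn g) y *
      dist (𝓜.wordPoint x (Fin.tail g)) (𝓜.wordPoint x g) ≤
      a ^ (n + 1) * 𝓜.markovOp (𝓜.height x) y + a ^ (n + 2) * 𝓜.height x y := by
  refine le_trans (Finset.sum_le_sum fun g _ => ?_)
    ((Finset.sum_add_distrib (M := ℝ)).trans_le
      (add_le_add (ha.sum_wordProb_mul_dist_wordPoint_tail_le ha0 hx n y)
        (ha.sum_wordProb_mul_dist_wordPoint_le ha0 hx (n + 1) y)))
  rw [← mul_add]
  exact mul_le_mul_of_nonneg_left (dist_triangle_left _ _ _) (𝓜.wordProb_nonneg _ _)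

theorem ContractsBy.sum_wordProb_mul_edist_wordPoint_succ_le {a : ℝ} (ha : 𝓜.ContractsBy a)
    (ha0 : 0 ≤ a) {x : V → K} (hx : ∀ v, x v ∈ 𝓜.cell v) (n : ℕ) (y : K) :
    ∑ g : Fin (n + 2) → E, ENNReal.ofReal (𝓜.wordProb (List.ofFn g) y) *
      edist (𝓜.wordPoint x (Fin.tail g)) (𝓜.wordPoint x g) ≤
      ENNReal.ofReal (a ^ (n + 1)) * ENNReal.ofReal (𝓜.markovOp (𝓜.height x) y) +
        ENNReal.ofReal (a ^ (n + 2)) * ENNReal.ofReal (𝓜.height x y) := by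
  have hop : 0 ≤ 𝓜.markovOp (𝓜.height x) y := 𝓜.iterate_markovOp_nonneg (height_nonneg x) 1 y
  have hle := ENNReal.ofReal_le_ofReal (ha.sum_wordProb_mul_dist_wordPoint_succ_le ha0 hx n y)
  rw [ENNReal.ofReal_sum_of_nonneg fun g _ => mul_nonneg (𝓜.wordProb_nonneg _ _) dist_nonneg]
    at hle
  rw [← ENNReal.ofReal_mul (by positivity), ← ENNReal.ofReal_mul (by positivity),
    ← ENNReal.ofReal_add (by positivity) (mul_nonneg (by positivity) (height_nonneg x y))]
  simpa only [edist_dist, ENNReal.ofReal_mul (𝓜.wordProb_nonneg _ _)] using hle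

theorem ContractsBy.abs_sum_wordProb_mul_sub_iterate_markovOp_le {a : ℝ} (ha : 𝓜.ContractsBy a)
    (ha0 : 0 ≤ a) {x : V → K} (hx : ∀ v, x v ∈ 𝓜.cell v) (e : E) {f : K → ℝ} {L : NNReal}
    (hf : LipschitzWith L f) (n : ℕ) (y : K) :
    |∑ g : Fin (n + 1) → E, 𝓜.wordProb (List.ofFn g) y *
        (𝓜.p e (𝓜.wordMap (List.ofFn g) y) * f (𝓜.wordPoint x g)) -
      𝓜.markovOp^[n + 1] (fun z => 𝓜.p e z * f z) y| ≤ L * (a ^ (n + 1) * 𝓜.height x y) := by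
  rw [iterate_markovOp_apply, ← Finset.sum_sub_distrib]
  refine (Finset.abs_sum_le_sum_abs _ _).trans (le_trans (Finset.sum_le_sum fun g _ => ?_)
    ((Finset.mul_sum _ _ _).ge.trans (mul_le_mul_of_nonneg_left
      (ha.sum_wordProb_mul_dist_wordPoint_le ha0 hx n y) L.coe_nonneg)))
  rw [← mul_sub, ← mul_sub, abs_mul, abs_mul, abs_of_nonneg (𝓜.wordProb_nonneg _ _),
    abs_of_nonneg (𝓜.p_nonneg _ _), mul_left_comm (L : ℝ)]
  refine mul_le_mul_of_nonneg_left ?_ (𝓜.wordProb_nonneg _ _)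
  refine (mul_le_of_le_one_left (abs_nonneg _) (𝓜.p_le_one _ _)).trans ?_
  rw [dist_comm]
  exact hf.dist_le_mul _ _

variable [BorelSpace K] [MeasurableSpace E] [DiscreteMeasurableSpace E]
  {μ : Measure K} {M : Measure (ℤ → E)}

theorem IsGeneralizedMarkovMeasure.lintegral_edist_codingSeq_le {a : ℝ} (ha : 𝓜.ContractsBy a)
    (ha0 : 0 ≤ a) (hopen : ∀ v, IsOpen (𝓜.cell v)) {x : V → K} (hx : ∀ v, x v ∈ 𝓜.cell v)
    (hμ : 𝓜.kernel.Invariant μ) (hM : 𝓜.IsGeneralizedMarkovMeasure μ M) (n : ℕ) :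
    ∫⁻ σ, edist (𝓜.codingSeq x σ n) (𝓜.codingSeq x σ (n + 1)) ∂M ≤
      (ENNReal.ofReal (a ^ (n + 1)) + ENNReal.ofReal (a ^ (n + 2))) *
        ∫⁻ z, ENNReal.ofReal (𝓜.height x z) ∂μ := by
  have hhm := (continuous_height hopen x).measurable
  have hcoding : ∀ σ : ℤ → E, edist (𝓜.codingSeq x σ n) (𝓜.codingSeq x σ (n + 1)) =
      (fun g : Fin (n + 2) → E => edist (𝓜.wordPoint x (Fin.tail g)) (𝓜.wordPoint x g))
        (window (-(n + 1 : ℕ)) (n + 2) σ) := fun σ => by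
    simp only [codingSeq_eq_wordPoint, tail_window]
    congr 3
    push_cast
    ring
  calc ∫⁻ σ, edist (𝓜.codingSeq x σ n) (𝓜.codingSeq x σ (n + 1)) ∂M
      = ∫⁻ y, ∑ g : Fin (n + 2) → E, ENNReal.ofReal (𝓜.wordProb (List.ofFn g) y) *
          edist (𝓜.wordPoint x (Fin.tail g)) (𝓜.wordPoint x g) ∂μ :=
        (lintegral_congr hcoding).trans <| hM.lintegral_window _ _ fun g : Fin (n + 2) → E =>
          edist (𝓜.wordPoint x (Fin.tail g)) (𝓜.wordPoint x g)
    _ ≤ ∫⁻ y, (ENNReal.ofReal (a ^ (n + 1)) * ENNReal.ofReal (𝓜.markovOp (𝓜.height x) y) +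
          ENNReal.ofReal (a ^ (n + 2)) * ENNReal.ofReal (𝓜.height x y)) ∂μ :=
        lintegral_mono (ha.sum_wordProb_mul_edist_wordPoint_succ_le ha0 hx n)
    _ = _ := by
        rw [lintegral_add_right _ (hhm.ennreal_ofReal.const_mul _),
          lintegral_const_mul' _ _ ENNReal.ofReal_ne_top,
          lintegral_const_mul' _ _ ENNReal.ofReal_ne_top,
          lintegral_markovOp_of_invariant hμ hhm (height_nonneg x), add_mul]

theorem IsGeneralizedMarkovMeasure.abs_setIntegral_codingSeq_sub_le [IsProbabilityMeasure μ]
    {a : ℝ} (ha : 𝓜.ContractsBy a) (ha0 : 0 ≤ a) {x : V → K} (hx : ∀ v, x v ∈ 𝓜.cell v)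
    (hμ : 𝓜.kernel.Invariant μ) (hH : Integrable (𝓜.height x) μ)
    (hM : 𝓜.IsGeneralizedMarkovMeasure μ M) (e : E) {f : K → ℝ} {L : NNReal}
    (hf : LipschitzWith L f) (hf01 : ∀ y, f y ∈ Set.Icc 0 1) (n : ℕ) :
    |∫ σ in {σ | σ 1 = e}, f (𝓜.codingSeq x σ n) ∂M - ∫ y, 𝓜.p e y * f y ∂μ| ≤
      L * (a ^ (n + 1) * ∫ y, 𝓜.height x y ∂μ) := by
  have hpf : Measurable fun y => 𝓜.p e y * f y :=
    (𝓜.p_measurable e).mul hf.continuous.measurable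
  have hbound : ∀ y z, ‖𝓜.p e y * f z‖ ≤ 1 := fun y z => by
    rw [Real.norm_of_nonneg (mul_nonneg (𝓜.p_nonneg e y) (hf01 z).1)]
    exact mul_le_one₀ (𝓜.p_le_one e y) (hf01 z).1 (hf01 z).2
  rw [hM.setIntegral_codingSeq, ← integral_iterate_markovOp_of_invariant hμ hpf
    (fun y => mul_nonneg (𝓜.p_nonneg e y) (hf01 y).1) (n + 1), ← integral_sub]
  · rw [← integral_const_mul, ← integral_const_mul, ← Real.norm_eq_abs]
    exact norm_integral_le_of_norm_le ((hH.const_mul _).const_mul _)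
      (ae_of_all _ fun y => ha.abs_sum_wordProb_mul_sub_iterate_markovOp_le ha0 hx e hf n y)
  · exact integrable_finsetSum _ fun g _ => (integrable_wordProb μ _).mul_bdd
      (((𝓜.p_measurable e).comp (𝓜.measurable_wordMap _)).mul_const _).aestronglyMeasurable
      (ae_of_all _ fun y => hbound _ _)
  · refine Integrable.congr ?_ (ae_of_all _ fun y => (𝓜.iterate_markovOp_apply (n + 1) _ y).symm)
    exact integrable_finsetSum _ fun g _ => (integrable_wordProb μ _).mul_bdd
      (hpf.comp (𝓜.measurable_wordMap _)).aestronglyMeasurable (ae_of_all _ fun y => hbound _ _)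

variable [ProperSpace K]

theorem IsGeneralizedMarkovMeasure.ae_mem_codingDomain [IsProbabilityMeasure μ]
    (hcontr : 𝓜.IsContractive) (hopen : ∀ v, IsOpen (𝓜.cell v)) {x : V → K}
    (hx : ∀ v, x v ∈ 𝓜.cell v) (hμ : 𝓜.kernel.Invariant μ) (hH : Integrable (𝓜.height x) μ)
    (hM : 𝓜.IsGeneralizedMarkovMeasure μ M) : ∀ᵐ σ ∂M, σ ∈ 𝓜.codingDomain x := by
  obtain ⟨a, ha0, ha1, ha : 𝓜.ContractsBy a⟩ := hcontr
  simp only [mem_codingDomain]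
  refine hM.ae_shiftBy ?_
  have hm : ∀ n, Measurable fun σ => edist (𝓜.codingSeq x σ n) (𝓜.codingSeq x σ (n + 1)) :=
    fun n => (measurable_codingSeq x n).edist (measurable_codingSeq x (n + 1))
  have hsum : ∫⁻ σ, ∑' n, edist (𝓜.codingSeq x σ n) (𝓜.codingSeq x σ (n + 1)) ∂M ≠ ⊤ := by
    rw [lintegral_tsum fun n => (hm n).aemeasurable]
    refine ne_top_of_le_ne_top ?_ (ENNReal.tsum_le_tsum fun n =>
      hM.lintegral_edist_codingSeq_le ha ha0.le hopen hx hμ n)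
    rw [ENNReal.tsum_mul_right, ENNReal.tsum_add]
    have hgeom : ∀ k : ℕ, ∑' n : ℕ, ENNReal.ofReal (a ^ (n + k)) ≠ ⊤ := fun k => by
      rw [← ENNReal.ofReal_tsum_of_nonneg (fun n => by positivity)
        ((summable_nat_add_iff k).2 (summable_geometric_of_lt_one ha0.le ha1))]
      exact ENNReal.ofReal_ne_top
    exact ENNReal.mul_ne_top (ENNReal.add_ne_top.2 ⟨hgeom 1, hgeom 2⟩) hH.lintegral_lt_top.ne
  filter_upwards [hM.ae_mem_pathSpace, ae_lt_top' (AEMeasurable.tsum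
    fun n => (hm n).aemeasurable) hsum] with σ hσ hlt
  exact ⟨hσ, cauchySeq_tendsto_of_complete
    (cauchySeq_of_edist_le_of_tsum_ne_top _ (fun n => le_rfl) hlt.ne)⟩

variable [Nonempty K]

theorem IsGeneralizedMarkovMeasure.map_restrict_codingMap [IsProbabilityMeasure μ]
    (hcontr : 𝓜.IsContractive) (hopen : ∀ v, IsOpen (𝓜.cell v)) {x : V → K}
    (hx : ∀ v, x v ∈ 𝓜.cell v) (hμ : 𝓜.kernel.Invariant μ) (hH : Integrable (𝓜.height x) μ)
    (hM : 𝓜.IsGeneralizedMarkovMeasure μ M) (e : E) :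
    (M.restrict {σ | σ 1 = e}).map (𝓜.codingMap x) =
      μ.withDensity fun y => ENNReal.ofReal (𝓜.p e y) := by
  have hprob := hM.isProbabilityMeasure
  have hY := hM.ae_mem_codingDomain hcontr hopen hx hμ hH
  obtain ⟨a, ha0, ha1, ha : 𝓜.ContractsBy a⟩ := hcontr
  have hfin : IsFiniteMeasure (μ.withDensity fun y => ENNReal.ofReal (𝓜.p e y)) :=
    isFiniteMeasure_withDensity_ofReal
      ((integrable_wordProb (𝓜 := 𝓜) μ [e]).congr (ae_of_all _ fun y => by simp)).hasFiniteIntegral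
  refine measure_ext_of_lipschitz fun L f hf hf01 => ?_
  have hfm : Measurable f := hf.continuous.measurable
  rw [integral_map (measurable_codingMap x).aemeasurable hfm.aestronglyMeasurable,
    integral_withDensity_eq_integral_toReal_smul (𝓜.measurable_ofReal_p e)
      (ae_of_all _ fun _ => ENNReal.ofReal_lt_top)]
  simp only [ENNReal.toReal_ofReal (𝓜.p_nonneg e _), smul_eq_mul]
  have hlim : Tendsto (fun n => ∫ σ in {σ | σ 1 = e}, f (𝓜.codingSeq x σ n) ∂M) atTop
      (𝓝 (∫ σ in {σ | σ 1 = e}, f (𝓜.codingMap x σ) ∂M)) := by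
    refine tendsto_integral_of_dominated_convergence (fun _ => 1)
      (fun n => (hfm.comp (measurable_codingSeq x n)).aestronglyMeasurable)
      (integrable_const _) (fun n => ae_of_all _ fun σ => ?_) ?_
    · rw [Real.norm_of_nonneg (hf01 _).1]
      exact (hf01 _).2
    · filter_upwards [ae_restrict_of_ae hY] with σ hσ
      exact (hf.continuous.tendsto _).comp
        (tendsto_codingSeq (mem_convergenceSet_of_mem_codingDomain hσ))
  have hzero : Tendsto (fun n : ℕ => L * (a ^ (n + 1) * ∫ y, 𝓜.height x y ∂μ)) atTop (𝓝 0) := by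
    simpa using (((tendsto_pow_atTop_nhds_zero_of_lt_one ha0.le ha1).comp
      (tendsto_add_atTop_nat 1)).mul_const (∫ y, 𝓜.height x y ∂μ)).const_mul (L : ℝ)
  exact tendsto_nhds_unique hlim (tendsto_iff_norm_sub_tendsto_zero.2 (squeeze_zero
    (fun _ => norm_nonneg _)
    (hM.abs_setIntegral_codingSeq_sub_le ha ha0.le hx hμ hH e hf hf01) hzero))

theorem IsGeneralizedMarkovMeasure.lintegral_letter_codingMap [IsProbabilityMeasure μ]
    (hcontr : 𝓜.IsContractive) (hopen : ∀ v, IsOpen (𝓜.cell v)) {x : V → K}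
    (hx : ∀ v, x v ∈ 𝓜.cell v) (hμ : 𝓜.kernel.Invariant μ) (hH : Integrable (𝓜.height x) μ)
    (hM : 𝓜.IsGeneralizedMarkovMeasure μ M) {f : E → K → ℝ≥0∞} (hf : ∀ e, Measurable (f e)) :
    ∫⁻ σ, f (σ 1) (𝓜.codingMap x σ) ∂M =
      ∑ e, ∫⁻ y, ENNReal.ofReal (𝓜.p e y) * f e y ∂μ := by
  rw [← sum_setLIntegral_eval M 1]
  refine Finset.sum_congr rfl fun e _ => ?_
  calc _ = ∫⁻ σ in {σ | σ 1 = e}, f e (𝓜.codingMap x σ) ∂M := by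
        refine setLIntegral_congr_fun (measurableSet_eval 1 e) fun σ hσ => ?_
        have hσ : σ 1 = e := hσ
        simp only [hσ]
    _ = ∫⁻ y, f e y ∂(M.restrict {σ | σ 1 = e}).map (𝓜.codingMap x) :=
        (lintegral_map (hf e) (measurable_codingMap x)).symm
    _ = _ := by
        rw [hM.map_restrict_codingMap hcontr hopen hx hμ hH e,
          lintegral_withDensity_eq_lintegral_mul _ (𝓜.measurable_ofReal_p e) (hf e)]
        rfl

theorem IsGeneralizedMarkovMeasure.map_codingMap [IsProbabilityMeasure μ]
    (hcontr : 𝓜.IsContractive) (hopen : ∀ v, IsOpen (𝓜.cell v)) {x : V → K}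
    (hx : ∀ v, x v ∈ 𝓜.cell v) (hμ : 𝓜.kernel.Invariant μ) (hH : Integrable (𝓜.height x) μ)
    (hM : 𝓜.IsGeneralizedMarkovMeasure μ M) : M.map (𝓜.codingMap x) = μ := by
  refine Measure.ext_of_lintegral _ fun f hf => ?_
  have hpf : ∀ e, Measurable fun y => ENNReal.ofReal (𝓜.p e y) * f y := fun e =>
    (𝓜.measurable_ofReal_p e).mul hf
  rw [lintegral_map hf (measurable_codingMap x),
    hM.lintegral_letter_codingMap hcontr hopen hx hμ hH (f := fun _ => f) fun _ => hf,
    ← lintegral_finsetSum _ fun e _ => hpf e]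
  refine lintegral_congr fun y => ?_
  rw [← Finset.sum_mul, 𝓜.sum_ofReal_p, one_mul]

end Coding

end MarkovSystem

/-! ### Entropy of finite partitions -/

section Gibbs

theorem negMulLog_add_mul_log_le {a b : ℝ} (ha : 0 ≤ a) (hb : 0 ≤ b) (hab : b = 0 → a = 0) :
    Real.negMulLog a + a * Real.log b ≤ b - a - (√a - √b) ^ 2 := by
  rcases ha.eq_or_lt with rfl | ha
  · simp [Real.sq_sqrt hb]
  have hb : 0 < b := lt_of_le_of_ne hb fun h => ha.ne' (hab h.symm)
  have hlog := Real.log_le_sub_one_of_pos (div_pos (Real.sqrt_pos.2 hb) (Real.sqrt_pos.2 ha))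
  rw [Real.log_div (Real.sqrt_pos.2 hb).ne' (Real.sqrt_pos.2 ha).ne', Real.log_sqrt ha.le,
    Real.log_sqrt hb.le] at hlog
  have hmul : a * (√b / √a - 1) = √a * √b - a := by
    rw [mul_sub, mul_one, mul_div_left_comm, Real.div_sqrt, mul_comm]
  have hsq : (√a - √b) ^ 2 = a + b - 2 * (√a * √b) := by
    rw [sub_sq, Real.sq_sqrt ha.le, Real.sq_sqrt hb.le]
    ring
  have := mul_le_mul_of_nonneg_left hlog ha.le
  rw [hmul] at this
  rw [Real.negMulLog, hsq]
  linarith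

variable {ι : Type*} [Fintype ι] {P Q : ι → ℝ}

theorem sum_sq_sqrt_sub_sqrt_le (hP : ∀ i, 0 ≤ P i) (hQ : ∀ i, 0 ≤ Q i)
    (hPQ : ∀ i, Q i = 0 → P i = 0) (hsum : ∑ i, Q i ≤ ∑ i, P i) :
    ∑ i, (√(P i) - √(Q i)) ^ 2 ≤
      ∑ i, P i * -Real.log (Q i) - ∑ i, Real.negMulLog (P i) := by
  have := Finset.sum_le_sum fun i (_ : i ∈ Finset.univ) =>
    negMulLog_add_mul_log_le (hP i) (hQ i) (hPQ i)
  rw [Finset.sum_add_distrib, Finset.sum_sub_distrib, Finset.sum_sub_distrib] at this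
  simp only [mul_neg, Finset.sum_neg_distrib]
  linarith

theorem sum_negMulLog_le_sum_mul_neg_log (hP : ∀ i, 0 ≤ P i) (hQ : ∀ i, 0 ≤ Q i)
    (hPQ : ∀ i, Q i = 0 → P i = 0) (hsum : ∑ i, Q i ≤ ∑ i, P i) :
    ∑ i, Real.negMulLog (P i) ≤ ∑ i, P i * -Real.log (Q i) :=
  sub_nonneg.1 ((Finset.sum_nonneg fun _ _ => sq_nonneg _).trans
    (sum_sq_sqrt_sub_sqrt_le hP hQ hPQ hsum))

theorem sq_sum_abs_sub_le (hP : ∀ i, 0 ≤ P i) (hQ : ∀ i, 0 ≤ Q i) (hP1 : ∑ i, P i = 1)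
    (hQ1 : ∑ i, Q i = 1) : (∑ i, |P i - Q i|) ^ 2 ≤ 4 * ∑ i, (√(P i) - √(Q i)) ^ 2 := by
  have hfactor : ∀ i, |P i - Q i| = |√(P i) - √(Q i)| * (√(P i) + √(Q i)) := fun i => by
    rw [← abs_of_nonneg (add_nonneg (Real.sqrt_nonneg (P i)) (Real.sqrt_nonneg (Q i))), ← abs_mul]
    congr 1
    linear_combination -Real.mul_self_sqrt (hP i) + Real.mul_self_sqrt (hQ i)
  have hsum : ∑ i, (√(P i) + √(Q i)) ^ 2 ≤ 4 := by
    calc ∑ i, (√(P i) + √(Q i)) ^ 2 ≤ ∑ i, (2 * P i + 2 * Q i) := by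
          refine Finset.sum_le_sum fun i _ => ?_
          nlinarith [Real.mul_self_sqrt (hP i), Real.mul_self_sqrt (hQ i),
            sq_nonneg (√(P i) - √(Q i))]
      _ = 4 := by
          rw [Finset.sum_add_distrib, ← Finset.mul_sum, ← Finset.mul_sum, hP1, hQ1]
          norm_num
  calc (∑ i, |P i - Q i|) ^ 2
      ≤ (∑ i, |√(P i) - √(Q i)| ^ 2) * ∑ i, (√(P i) + √(Q i)) ^ 2 := by
        simp only [hfactor]
        exact Finset.sum_mul_sq_le_sq_mul_sq _ _ _
    _ ≤ (∑ i, (√(P i) - √(Q i)) ^ 2) * 4 := by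
        simp only [sq_abs]
        exact mul_le_mul_of_nonneg_left hsum (Finset.sum_nonneg fun _ _ => sq_nonneg _)
    _ = _ := mul_comm _ _

theorem negMulLog_sum_le (hP : ∀ i, 0 ≤ P i) :
    Real.negMulLog (∑ i, P i) ≤ ∑ i, Real.negMulLog (P i) := by
  simp only [Real.negMulLog, neg_mul, Finset.sum_mul, Finset.sum_neg_distrib]
  refine neg_le_neg (Finset.sum_le_sum fun i _ => ?_)
  rcases (hP i).eq_or_lt with h | h
  · simp [← h]
  · exact mul_le_mul_of_nonneg_left (Real.log_le_log h
      (Finset.single_le_sum (fun i _ => hP i) (Finset.mem_univ i))) (hP i)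

end Gibbs

section Entropy

variable {X : Type*} [MeasurableSpace X] {μ : Measure X} {ι κ : Type*} [Fintype ι] [Fintype κ]

theorem partitionEntropy_equiv_comp (c : ι ≃ κ) (ξ : X → ι) :
    partitionEntropy μ (fun x => c (ξ x)) = partitionEntropy μ ξ := by
  rw [partitionEntropy, ← c.sum_comp]
  refine Finset.sum_congr rfl fun j _ => ?_
  congr 2
  ext x
  simp

section Finite

variable [IsFiniteMeasure μ] [MeasurableSpace κ] [MeasurableSingletonClass κ]

theorem partitionEntropy_le_prodMk (ξ : X → ι) {η : X → κ} (hη : Measurable η) :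
    partitionEntropy μ ξ ≤ partitionEntropy μ fun x => (ξ x, η x) := by
  rw [partitionEntropy, partitionEntropy, Fintype.sum_prod_type]
  refine Finset.sum_le_sum fun j _ => ?_
  have hsplit : μ.real (ξ ⁻¹' {j}) = ∑ i, μ.real ((fun x => (ξ x, η x)) ⁻¹' {(j, i)}) := by
    have h := sum_measureReal_preimage_singleton (μ := μ.restrict (ξ ⁻¹' {j}))
      (Finset.univ : Finset κ) (f := η) fun i _ => hη (measurableSet_singleton i)
    simp only [Finset.coe_univ, Set.preimage_univ, measureReal_restrict_apply_univ] at h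
    rw [← h]
    refine Finset.sum_congr rfl fun i _ => ?_
    rw [measureReal_restrict_apply (hη (measurableSet_singleton i))]
    congr 1
    ext x
    simp [and_comm]
  rw [hsplit]
  exact negMulLog_sum_le fun i => measureReal_nonneg

omit [Fintype κ] in
theorem integrable_comp_of_finite [Finite κ] {η : X → κ} (hη : Measurable η) (f : κ → ℝ) :
    Integrable (fun x => f (η x)) μ :=
  (Integrable.of_finite (μ := μ.map η)).comp_measurable hη

theorem integral_comp_of_fintype {η : X → κ} (hη : Measurable η) (f : κ → ℝ) :
    ∫ x, f (η x) ∂μ = ∑ i, μ.real (η ⁻¹' {i}) * f i := by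
  rw [← integral_map hη.aemeasurable (measurable_of_finite f).aestronglyMeasurable,
    integral_fintype .of_finite]
  exact Finset.sum_congr rfl fun i _ => by
    rw [map_measureReal_apply hη (measurableSet_singleton _), smul_eq_mul]

end Finite

variable [IsProbabilityMeasure μ] [MeasurableSpace ι] [MeasurableSingletonClass ι]
  [MeasurableSpace κ] [MeasurableSingletonClass κ]

theorem sum_measureReal_preimage {η : X → κ} (hη : Measurable η) :
    ∑ i, μ.real (η ⁻¹' {i}) = 1 := by
  simpa using (integral_comp_of_fintype (μ := μ) hη fun _ => 1).symm

theorem partitionEntropy_le_add_integral_neg_log {ξ : X → ι} (hξ : Measurable ξ) {η : X → κ}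
    (hη : Measurable η) {Q : κ → ι → ℝ} (hQ : ∀ i j, 0 < Q i j) (hQ1 : ∀ i, ∑ j, Q i j = 1) :
    partitionEntropy μ ξ ≤ partitionEntropy μ η + ∫ x, -Real.log (Q (η x) (ξ x)) ∂μ := by
  have hξη : Measurable fun x => (ξ x, η x) := hξ.prodMk hη
  set P : ι × κ → ℝ := fun r => μ.real ((fun x => (ξ x, η x)) ⁻¹' {r})
  have hP : ∀ r, P r ≤ μ.real (η ⁻¹' {r.2}) := fun r =>
    measureReal_mono fun x (hx : (ξ x, η x) = r) => by simp [← hx]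
  have hsum : ∑ r : ι × κ, μ.real (η ⁻¹' {r.2}) * Q r.2 r.1 = 1 := by
    simp only [Fintype.sum_prod_type_right, ← Finset.mul_sum, hQ1, mul_one,
      sum_measureReal_preimage hη]
  have hlog : ∀ r, P r * -Real.log (μ.real (η ⁻¹' {r.2}) * Q r.2 r.1) =
      P r * (-Real.log (μ.real (η ⁻¹' {r.2})) + -Real.log (Q r.2 r.1)) := fun r => by
    obtain hr | hr := eq_or_ne (μ.real (η ⁻¹' {r.2})) 0
    · have : P r = 0 := le_antisymm (hr ▸ hP r) measureReal_nonneg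
      simp [this]
    · rw [Real.log_mul hr (hQ _ _).ne', neg_add]
  calc partitionEntropy μ ξ
      ≤ ∑ r, Real.negMulLog (P r) := partitionEntropy_le_prodMk ξ hη
    _ ≤ ∑ r, P r * -Real.log (μ.real (η ⁻¹' {r.2}) * Q r.2 r.1) :=
        sum_negMulLog_le_sum_mul_neg_log (fun r => measureReal_nonneg)
          (fun r => mul_nonneg measureReal_nonneg (hQ _ _).le)
          (fun r hr => le_antisymm ((hP r).trans
            ((mul_eq_zero.1 hr).resolve_right (hQ _ _).ne').le) measureReal_nonneg)
          (by rw [hsum, sum_measureReal_preimage hξη])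
    _ = ∫ x, (-Real.log (μ.real (η ⁻¹' {η x})) + -Real.log (Q (η x) (ξ x))) ∂μ := by
        rw [Finset.sum_congr rfl fun r _ => hlog r, ← integral_comp_of_fintype hξη]
    _ = ∑ i, μ.real (η ⁻¹' {i}) * -Real.log (μ.real (η ⁻¹' {i})) +
          ∫ x, -Real.log (Q (η x) (ξ x)) ∂μ := by
        rw [integral_add
          (integrable_comp_of_finite hη fun i => -Real.log (μ.real (η ⁻¹' {i})))
          (integrable_comp_of_finite hξη fun r => -Real.log (Q r.2 r.1)),
          integral_comp_of_fintype hη fun i => -Real.log (μ.real (η ⁻¹' {i}))]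
    _ = _ := by simp only [partitionEntropy, Real.negMulLog, mul_neg, neg_mul]

end Entropy

section Prediction

variable {α : Type*} [Fintype α] {ε : ℝ}

theorem neg_log_div_card_nonneg [Nonempty α] (hε0 : 0 < ε) (hε1 : ε < 1) :
    0 ≤ -Real.log (ε / Fintype.card α) :=
  neg_nonneg.2 (Real.log_nonpos (by positivity)
    ((div_le_one (by positivity)).2 (hε1.le.trans (mod_cast Fintype.card_pos))))

variable [DecidableEq α]

/-- The weights on `α` of the law that equals `i` with probability `1 - ε` and is uniformly
distributed otherwise: a prediction of `i` which excludes no value. -/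
noncomputable def smearedDirac (ε : ℝ) (i j : α) : ℝ :=
  (if j = i then 1 - ε else 0) + ε / Fintype.card α

theorem smearedDirac_pos (hε0 : 0 < ε) (hε1 : ε < 1) (i j : α) : 0 < smearedDirac ε i j := by
  have : Nonempty α := ⟨i⟩
  have : 0 < ε / Fintype.card α := by positivity
  rw [smearedDirac]
  split_ifs <;> linarith

theorem sum_smearedDirac (ε : ℝ) (i : α) : ∑ j, smearedDirac ε i j = 1 := by
  have : Nonempty α := ⟨i⟩
  simp only [smearedDirac, Finset.sum_add_distrib, Finset.sum_ite_eq', Finset.mem_univ, if_true,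
    Finset.sum_const, Finset.card_univ, nsmul_eq_mul]
  field_simp
  ring

theorem neg_log_smearedDirac_le (hε0 : 0 < ε) (hε1 : ε < 1) (i j : α) :
    -Real.log (smearedDirac ε i j) ≤
      -Real.log (1 - ε) + {j' | j' ≠ i}.indicator (fun _ => -Real.log (ε / Fintype.card α)) j := by
  have : Nonempty α := ⟨i⟩
  have hcard : 0 < ε / Fintype.card α := by positivity
  have hlog : Real.log (1 - ε) ≤ 0 := Real.log_nonpos (by linarith) (by linarith)
  obtain rfl | hj := eq_or_ne j i
  · have := Real.log_le_log (show 0 < 1 - ε by linarith)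
      (show 1 - ε ≤ 1 - ε + ε / Fintype.card α by linarith)
    simpa [smearedDirac] using this
  · simpa [smearedDirac, hj] using hlog

variable [Nonempty α] [MeasurableSpace α] [MeasurableSingletonClass α]
  {X : Type*} [MeasurableSpace X] {μ : Measure X} [IsProbabilityMeasure μ]
  {J κ : Type*} [Fintype J] [DecidableEq J] [MeasurableSpace κ] [MeasurableSingletonClass κ]

theorem integral_neg_log_smearedDirac_le [Finite κ] (hε0 : 0 < ε) (hε1 : ε < 1) {ξ : X → α}
    (hξ : Measurable ξ) {η : X → κ} (hη : Measurable η) {φ : κ → α} {θ : ℝ}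
    (hθ : μ.real {x | ξ x ≠ φ (η x)} ≤ θ) :
    ∫ x, -Real.log (smearedDirac ε (φ (η x)) (ξ x)) ∂μ ≤
      -Real.log (1 - ε) + θ * -Real.log (ε / Fintype.card α) := by
  have hm : MeasurableSet {x | ξ x ≠ φ (η x)} :=
    (measurableSet_eq_fun hξ ((measurable_of_finite φ).comp hη)).compl
  calc ∫ x, -Real.log (smearedDirac ε (φ (η x)) (ξ x)) ∂μ
      ≤ ∫ x, (-Real.log (1 - ε) +
          {x | ξ x ≠ φ (η x)}.indicator (fun _ => -Real.log (ε / Fintype.card α)) x) ∂μ :=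
        integral_mono (integrable_comp_of_finite (hξ.prodMk hη) fun r : α × κ =>
            -Real.log (smearedDirac ε (φ r.2) r.1))
          ((integrable_const _).add ((integrable_const _).indicator hm))
          fun x => neg_log_smearedDirac_le hε0 hε1 _ _
    _ = -Real.log (1 - ε) +
          μ.real {x | ξ x ≠ φ (η x)} * -Real.log (ε / Fintype.card α) := by
        rw [integral_add (integrable_const _) ((integrable_const _).indicator hm),
          integral_indicator_const _ hm]
        simp
    _ ≤ _ := by
        gcongr
        exact neg_log_div_card_nonneg hε0 hε1

omit [DecidableEq α] in
theorem partitionEntropy_le_of_predicts [Fintype κ] {ζ : X → J → α} (hζ : Measurable ζ) {η : X → κ}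
    (hη : Measurable η) (φ : J → κ → α) (hε0 : 0 < ε) (hε1 : ε < 1) {θ : ℝ}
    (hθ : ∀ j, μ.real {x | ζ x j ≠ φ j (η x)} ≤ θ) :
    partitionEntropy μ ζ ≤ partitionEntropy μ η +
      Fintype.card J * (-Real.log (1 - ε) + θ * -Real.log (ε / Fintype.card α)) := by
  classical
  have hQ1 : ∀ i, ∑ s : J → α, ∏ j, smearedDirac ε (φ j i) (s j) = 1 := fun i => by
    rw [← Fintype.piFinset_univ, ← Finset.prod_univ_sum]
    exact Finset.prod_eq_one fun j _ => sum_smearedDirac ε _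
  refine (partitionEntropy_le_add_integral_neg_log hζ hη
    (Q := fun i s => ∏ j, smearedDirac ε (φ j i) (s j))
    (fun i s => Finset.prod_pos fun j _ => smearedDirac_pos hε0 hε1 _ _) hQ1).trans ?_
  gcongr
  simp only [Real.log_prod fun _ _ => (smearedDirac_pos hε0 hε1 _ _).ne',
    ← Finset.sum_neg_distrib]
  rw [integral_finsetSum _ fun j _ => integrable_comp_of_finite (hζ.prodMk hη)
    fun r : (J → α) × κ => -Real.log (smearedDirac ε (φ j r.2) (r.1 j))]
  refine (Finset.sum_le_card_nsmul _ _ _ fun j _ => integral_neg_log_smearedDirac_le hε0 hε1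
    ((measurable_pi_apply j).comp hζ) hη (hθ j)).trans_eq ?_
  rw [Finset.card_univ, nsmul_eq_mul]

end Prediction

/-! ### Entropy of the shift -/

section WindowApproximation

theorem exists_window_measureReal_symmDiff_lt {E : Type*} [MeasurableSpace E]
    {Λ : Measure (ℤ → E)} [IsFiniteMeasure Λ] {s : Set (ℤ → E)} (hs : MeasurableSet s) {θ : ℝ}
    (hθ : 0 < θ) :
    ∃ (n : ℕ) (S : Set (Fin (2 * n + 1) → E)),
      Λ.real (symmDiff s (window (-n) (2 * n + 1) ⁻¹' S)) < θ := by
  have hdense := Measure.MeasureDense.of_generateFrom_isSetAlgebra_finite Λ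
    (isSetAlgebra_measurableCylinders (α := fun _ : ℤ => E)) generateFrom_measurableCylinders.symm
  obtain ⟨t, ht, hst⟩ := hdense.approx s hs (measure_ne_top _ _) θ hθ
  obtain ⟨n, S, rfl⟩ := exists_window_of_mem_measurableCylinders ht
  exact ⟨n, S, ENNReal.toReal_lt_of_lt_ofReal hst⟩

theorem exists_setOf_ne_comp_subset_iUnion_symmDiff {X α β : Type*} [Nonempty α] (ξ : X → α)
    (η : X → β) (S : α → Set β) :
    ∃ φ : β → α, {x | ξ x ≠ φ (η x)} ⊆ ⋃ i, symmDiff (ξ ⁻¹' {i}) (η ⁻¹' S i) := by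
  have hchoice : ∀ b, ∃ i, (∃ j, b ∈ S j) → b ∈ S i := fun b => by
    by_cases hb : ∃ j, b ∈ S j
    · exact hb.imp fun _ hi _ => hi
    · exact ⟨Classical.arbitrary α, fun h => absurd h hb⟩
  choose φ hφ using hchoice
  refine ⟨φ, fun x hx => ?_⟩
  by_contra hcon
  have hiff : ∀ i, ξ x = i ↔ η x ∈ S i := fun i => by
    simp only [Set.mem_iUnion, not_exists, Set.mem_symmDiff, Set.mem_preimage,
      Set.mem_singleton_iff] at hcon
    have := hcon i
    tauto
  exact hx ((hiff _).2 (hφ _ ⟨ξ x, (hiff _).1 rfl⟩))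

theorem exists_window_measureReal_ne_le {E α : Type*} [MeasurableSpace E] {Λ : Measure (ℤ → E)}
    [IsFiniteMeasure Λ] [Finite α] [Nonempty α] [MeasurableSpace α] [DiscreteMeasurableSpace α]
    {ξ : (ℤ → E) → α} (hξ : Measurable ξ) {θ : ℝ} (hθ : 0 < θ) :
    ∃ (m : ℕ) (φ : (Fin (2 * m + 1) → E) → α),
      Λ.real {σ | ξ σ ≠ φ (window (-m) (2 * m + 1) σ)} ≤ θ := by
  have := Fintype.ofFinite α
  choose n S hS using fun i : α => exists_window_measureReal_symmDiff_lt (Λ := Λ)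
    (hξ (measurableSet_singleton i)) (show 0 < θ / Fintype.card α by positivity)
  set m := ∑ i, n i
  have hm : ∀ i, n i ≤ m := fun i =>
    Finset.single_le_sum (f := n) (fun _ _ => Nat.zero_le _) (Finset.mem_univ i)
  choose ρ hρ using fun i => exists_comp_window_eq (E := E) (m := -n i) (m' := -m)
    (n := 2 * n i + 1) (n' := 2 * m + 1) (by have := hm i; omega) (by have := hm i; omega)
  obtain ⟨φ, hφ⟩ := exists_setOf_ne_comp_subset_iUnion_symmDiff ξ
    (window (-m) (2 * m + 1)) fun i => ρ i ⁻¹' S i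
  refine ⟨m, φ, ?_⟩
  calc Λ.real {σ | ξ σ ≠ φ (window (-m) (2 * m + 1) σ)}
      ≤ Λ.real (⋃ i, symmDiff (ξ ⁻¹' {i}) (window (-m) (2 * m + 1) ⁻¹' (ρ i ⁻¹' S i))) :=
        measureReal_mono hφ
    _ ≤ ∑ i, Λ.real (symmDiff (ξ ⁻¹' {i}) (window (-m) (2 * m + 1) ⁻¹' (ρ i ⁻¹' S i))) :=
        measureReal_iUnion_fintype_le _
    _ ≤ ∑ _i : α, θ / Fintype.card α := Finset.sum_le_sum fun i _ => by
        simp only [← Set.preimage_comp, Function.comp_def, hρ]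
        exact (hS i).le
    _ = θ := by
        rw [Finset.sum_const, Finset.card_univ, nsmul_eq_mul]
        field_simp

end WindowApproximation

theorem exists_neg_log_one_sub_add_mul_le {f : ℝ → ℝ} (hf : ∀ ε, 0 < ε → ε < 1 → 0 ≤ f ε) {d : ℝ}
    (hd : 0 < d) :
    ∃ ε θ : ℝ, 0 < ε ∧ ε < 1 ∧ 0 < θ ∧ -Real.log (1 - ε) + θ * f ε ≤ d := by
  set ε := 1 - Real.exp (-(d / 2)) with hε
  have hε0 : 0 < ε := sub_pos.2 (Real.exp_lt_one_iff.2 (by linarith))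
  have hε1 : ε < 1 := sub_lt_self _ (Real.exp_pos _)
  have hfε := hf ε hε0 hε1
  have hlog : -Real.log (1 - ε) = d / 2 := by simp [hε]
  have hmul : d / 2 / (f ε + 1) * f ε ≤ d / 2 := by
    rw [div_mul_eq_mul_div, div_le_iff₀ (by positivity)]
    nlinarith
  exact ⟨ε, d / 2 / (f ε + 1), hε0, hε1, by positivity, by linarith⟩

section ShiftEntropy

variable {E : Type*} [MeasurableSpace E] {Λ : Measure (ℤ → E)}

theorem IsInvariantProb.measure_cylinderAt [Finite E] [DiscreteMeasurableSpace E]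
    (h : IsInvariantProb leftShift Λ) (m m' : ℤ) (l : List E) :
    Λ (cylinderAt m l) = Λ (cylinderAt m' l) := by
  have hsucc : ∀ m : ℤ, Λ (cylinderAt (m + 1) l) = Λ (cylinderAt m l) := fun m => by
    rw [← preimage_shiftBy_cylinderAt]
    exact h.2.measure_preimage (measurableSet_cylinderAt m l).nullMeasurableSet
  suffices h0 : ∀ m : ℤ, Λ (cylinderAt m l) = Λ (cylinderAt 0 l) by rw [h0 m, h0 m']
  intro m
  induction m using Int.induction_on with
  | zero => rfl
  | succ i ih => rw [hsucc, ih]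
  | pred i ih => rw [← ih, ← hsucc, sub_add_cancel]

variable [Fintype E]

/-- The Shannon entropy of the law of the words of length `n` under `Λ`, for a shift-invariant `Λ`;
the place at which the words are read is then immaterial. -/
noncomputable def blockEntropy (Λ : Measure (ℤ → E)) (n : ℕ) : ℝ :=
  ∑ g : Fin n → E, Real.negMulLog (Λ.real (cylinderAt 1 (List.ofFn g)))

variable [DiscreteMeasurableSpace E]

theorem IsInvariantProb.partitionEntropy_window (h : IsInvariantProb leftShift Λ) (m : ℤ) (n : ℕ) :
    partitionEntropy Λ (window m n) = blockEntropy Λ n := by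
  refine Finset.sum_congr rfl fun g _ => ?_
  rw [← cylinderAt_ofFn, Measure.real, Measure.real, h.measure_cylinderAt m 1]

theorem IsInvariantProb.partitionEntropy_itinerary_le {α : Type*} [Fintype α] [Nonempty α]
    [MeasurableSpace α] [DiscreteMeasurableSpace α] (h : IsInvariantProb leftShift Λ)
    {ξ : (ℤ → E) → α} (hξ : Measurable ξ) {ε θ : ℝ} (hε0 : 0 < ε) (hε1 : ε < 1)
    {m : ℕ} {φ : (Fin (2 * m + 1) → E) → α}
    (hφ : Λ.real {σ | ξ σ ≠ φ (window (-m) (2 * m + 1) σ)} ≤ θ) (n : ℕ) :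
    partitionEntropy Λ (itinerary leftShift ξ n) ≤ blockEntropy Λ (n + 2 * m) +
      n * (-Real.log (1 - ε) + θ * -Real.log (ε / Fintype.card α)) := by
  have := h.1
  have hit : Measurable (itinerary leftShift ξ n) :=
    measurable_pi_lambda _ fun j => hξ.comp (h.2.iterate j).measurable
  choose ρ hρ using fun j : Fin n => exists_comp_window_eq (E := E) (m := -m + j) (m' := -m)
    (n := 2 * m + 1) (n' := n + 2 * m) (by omega) (by omega)
  have hshift : ∀ (j : Fin n) (σ : ℤ → E),
      window (-m) (2 * m + 1) (leftShift^[j] σ) = window (-m + j) (2 * m + 1) σ := fun j σ => by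
    rw [iterate_leftShift]
    funext i
    simp only [window, shiftBy, add_right_comm]
  have hbad : MeasurableSet {σ | ξ σ ≠ φ (window (-m) (2 * m + 1) σ)} :=
    (measurableSet_eq_fun hξ (measurable_of_window _ _ φ)).compl
  rw [← h.partitionEntropy_window (-m)]
  refine (partitionEntropy_le_of_predicts hit (measurable_window _ _) (fun j g => φ (ρ j g))
    hε0 hε1 fun j => ?_).trans_eq (by rw [Fintype.card_fin])
  rw [← (h.2.iterate j).measureReal_preimage hbad.nullMeasurableSet] at hφ
  simpa only [hρ, itinerary, Set.preimage_ofPred_eq, hshift] using hφ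

theorem IsInvariantProb.exists_partitionEntropy_itinerary_le {α : Type*} [Fintype α] [Nonempty α]
    [MeasurableSpace α] [DiscreteMeasurableSpace α] (h : IsInvariantProb leftShift Λ)
    {ξ : (ℤ → E) → α} (hξ : Measurable ξ) {d : ℝ} (hd : 0 < d) :
    ∃ m : ℕ, ∀ n : ℕ,
      partitionEntropy Λ (itinerary leftShift ξ n) ≤ blockEntropy Λ (n + 2 * m) + n * d := by
  have := h.1
  obtain ⟨ε, θ, hε0, hε1, hθ, hd⟩ := exists_neg_log_one_sub_add_mul_le
    (f := fun ε => -Real.log (ε / Fintype.card α)) (fun _ => neg_log_div_card_nonneg) hd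
  obtain ⟨m, φ, hφ⟩ := exists_window_measureReal_ne_le (Λ := Λ) hξ hθ
  refine ⟨m, fun n => (h.partitionEntropy_itinerary_le hξ hε0 hε1 hφ n).trans ?_⟩
  gcongr

theorem IsInvariantProb.ksEntropy_le (h : IsInvariantProb leftShift Λ) {r : ℝ}
    (hr : ∀ᶠ n : ℕ in atTop, blockEntropy Λ n ≤ n * r) : ksEntropy leftShift Λ ≤ r := by
  have := h.1
  refine iSup_le fun k => iSup_le fun ξ => iSup_le fun hξ => ?_
  rw [← EReal.le_of_forall_lt_iff_le]
  intro s hs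
  have hrs : r < s := by exact_mod_cast hs
  have hd : 0 < (s - r) / 2 := by linarith
  have : Nonempty (Fin k) := (nonempty_of_isProbabilityMeasure Λ).map ξ
  obtain ⟨m, hm⟩ := h.exists_partitionEntropy_itinerary_le hξ hd
  refine limsup_le_of_le (by isBoundedDefault) ?_
  have hlarge : ∀ᶠ n : ℕ in atTop, 2 * m * r ≤ n * ((s - r) / 2) :=
    ((tendsto_natCast_atTop_atTop (R := ℝ)).atTop_mul_const hd).eventually_ge_atTop _
  filter_upwards [hlarge, (tendsto_add_atTop_nat (2 * m)).eventually hr, eventually_gt_atTop 0]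
    with n hn hblock hn0
  rw [EReal.coe_le_coe_iff, div_le_iff₀ (by exact_mod_cast hn0)]
  push_cast at hblock
  linarith [hm n]

theorem IsInvariantProb.le_ksEntropy (h : IsInvariantProb leftShift Λ) {r : ℝ}
    (hr : ∀ n : ℕ, n * r ≤ blockEntropy Λ n) : (r : EReal) ≤ ksEntropy leftShift Λ := by
  set c : E ≃ Fin (Fintype.card E) := Fintype.equivFin E
  set ξ : (ℤ → E) → Fin (Fintype.card E) := fun σ => c (σ 0)
  have hξ : Measurable ξ := (measurable_of_finite c).comp (measurable_pi_apply 0)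
  have hitinerary : ∀ n,
      itinerary leftShift ξ n = fun σ => (Equiv.refl (Fin n)).arrowCongr c (window 0 n σ) :=
    fun n => by
      funext σ j
      simp [ξ, itinerary, iterate_leftShift, window, shiftBy, Equiv.arrowCongr]
  refine le_trans ?_ (le_iSup_of_le (Fintype.card E) (le_iSup_of_le ξ (le_iSup_of_le hξ le_rfl)))
  refine le_limsup_of_frequently_le (Eventually.frequently ?_) (by isBoundedDefault)
  filter_upwards [eventually_gt_atTop 0] with n hn
  rw [EReal.coe_le_coe_iff, le_div_iff₀ (by exact_mod_cast hn), mul_comm, hitinerary,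
    partitionEntropy_equiv_comp, h.partitionEntropy_window]
  exact hr n

end ShiftEntropy

/-! ### The variational principle -/

theorem eventually_le_mul_of_sub_le {u : ℕ → ℝ} {r s : ℝ} (hrs : s < r)
    (h : ∀ᶠ n in atTop, u (n + 1) - u n ≤ s) : ∀ᶠ n : ℕ in atTop, u n ≤ n * r := by
  obtain ⟨N, hN⟩ := eventually_atTop.1 h
  have hle : ∀ d : ℕ, u (N + d) ≤ u N + d * s := by
    intro d
    induction d with
    | zero => simp
    | succ d ih =>
      have := hN (N + d) (Nat.le_add_right _ _)
      push_cast
      rw [← add_assoc]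
      linarith
  have hlarge : ∀ᶠ n : ℕ in atTop, u N - N * s ≤ n * (r - s) :=
    ((tendsto_natCast_atTop_atTop (R := ℝ)).atTop_mul_const (sub_pos.2 hrs)).eventually_ge_atTop _
  filter_upwards [hlarge, eventually_ge_atTop N] with n hn hNn
  obtain ⟨d, rfl⟩ := Nat.exists_eq_add_of_le hNn
  have := hle d
  push_cast at hn ⊢
  linarith

section NextLetter

variable {E : Type*} [MeasurableSpace E] {Λ : Measure (ℤ → E)}

/-- The probability of the word `g` at the places `-k, …, 0` followed by the letter `e` at the
place `1`, for `r = (g, e)`. -/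
noncomputable def nextProb (Λ : Measure (ℤ → E)) {k : ℕ} (r : (Fin (k + 1) → E) × E) : ℝ :=
  Λ.real (cylinderAt (-k) (List.ofFn r.1) ∩ {σ | σ 1 = r.2})

theorem nextProb_eq_cylinderAt {k : ℕ} (g : Fin (k + 1) → E) (e : E) :
    nextProb Λ (g, e) = Λ.real (cylinderAt (-k) (List.ofFn g ++ [e])) := by
  rw [nextProb, cylinderAt_append_singleton, List.length_ofFn]
  simp

theorem measureReal_cylinderAt_pos_of_nextProb_ne_zero [IsFiniteMeasure Λ] {k : ℕ}
    {r : (Fin (k + 1) → E) × E} (hr : nextProb Λ r ≠ 0) :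
    0 < Λ.real (cylinderAt (-k) (List.ofFn r.1)) :=
  (measureReal_nonneg.lt_of_ne' hr).trans_le (measureReal_mono Set.inter_subset_left)

variable [Fintype E] [DiscreteMeasurableSpace E]

theorem sum_measureReal_cylinderAt [IsProbabilityMeasure Λ] (m : ℤ) (n : ℕ) :
    ∑ g : Fin n → E, Λ.real (cylinderAt m (List.ofFn g)) = 1 := by
  simpa using (integral_window Λ m n fun _ => 1).symm

theorem sum_nextProb_right [IsFiniteMeasure Λ] {k : ℕ} (g : Fin (k + 1) → E) :
    ∑ e, nextProb Λ (g, e) = Λ.real (cylinderAt (-k) (List.ofFn g)) := by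
  simp only [nextProb, Measure.real]
  rw [← ENNReal.toReal_sum fun e _ => measure_ne_top _ _, sum_measure_inter_eval]

theorem sum_nextProb [IsProbabilityMeasure Λ] (k : ℕ) :
    ∑ r : (Fin (k + 1) → E) × E, nextProb Λ r = 1 := by
  rw [Fintype.sum_prod_type]
  simp only [sum_nextProb_right, sum_measureReal_cylinderAt]

theorem IsInvariantProb.blockEntropy_add_two (h : IsInvariantProb leftShift Λ) (k : ℕ) :
    blockEntropy Λ (k + 2) =
      ∑ r : (Fin (k + 1) → E) × E, Real.negMulLog (nextProb Λ r) := by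
  rw [Fintype.sum_prod_type, blockEntropy,
    sum_ofFn_succ_last (k + 1) fun l => Real.negMulLog (Λ.real (cylinderAt 1 l))]
  refine Finset.sum_congr rfl fun g _ => Finset.sum_congr rfl fun e _ => ?_
  rw [nextProb_eq_cylinderAt, Measure.real, Measure.real, h.measure_cylinderAt 1 (-k)]

theorem IsInvariantProb.blockEntropy_add_one (h : IsInvariantProb leftShift Λ) (k : ℕ) :
    blockEntropy Λ (k + 1) = -∑ r : (Fin (k + 1) → E) × E,
      nextProb Λ r * Real.log (Λ.real (cylinderAt (-k) (List.ofFn r.1))) := by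
  have := h.1
  simp only [Fintype.sum_prod_type, ← Finset.sum_mul, sum_nextProb_right, blockEntropy,
    ← Finset.sum_neg_distrib, Real.negMulLog, neg_mul, Measure.real,
    h.measure_cylinderAt 1 (-k)]

end NextLetter

namespace MarkovSystem

variable {K V E : Type*} [MeasurableSpace K] [Fintype E] {𝓜 : MarkovSystem K V E}

theorem IsBoundedBelow.exists_neg_log_p_le (hpos : 𝓜.IsBoundedBelow) :
    ∃ B : ℝ, ∀ e, ∀ y ∈ 𝓜.cell (𝓜.init e), -Real.log (𝓜.p e y) ≤ B := by
  choose δ hδ0 hδ using hpos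
  refine ⟨∑ e, |Real.log (δ e)|, fun e y hy => ?_⟩
  refine (neg_le_neg (Real.log_le_log (hδ0 e) (hδ e y hy))).trans ((neg_le_abs _).trans ?_)
  exact Finset.single_le_sum (f := fun e => |Real.log (δ e)|) (fun e _ => abs_nonneg _)
    (Finset.mem_univ e)

theorem IsBoundedBelow.p_pos (hpos : 𝓜.IsBoundedBelow) {e : E} {y : K}
    (hy : y ∈ 𝓜.cell (𝓜.init e)) : 0 < 𝓜.p e y := by
  obtain ⟨δ, hδ0, hδ⟩ := hpos e
  exact hδ0.trans_le (hδ y hy)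

variable [MeasurableSpace E] {Λ : Measure (ℤ → E)}

variable (𝓜 Λ) in
/-- The mean of minus the logarithm of the probability of the next letter, computed from `k + 1`
letters of the past. -/
noncomputable def meanRate (x : V → K) (k : ℕ) : ℝ :=
  ∫ σ, -Real.log (𝓜.p (σ 1) (𝓜.codingSeq x σ k)) ∂Λ

variable (𝓜 Λ) in
/-- The excess of `meanRate` over the entropy of the next letter given `k + 1` letters of the past.
It is the relative entropy of `nextProb` with respect to `predictedProb`. -/
noncomputable def entropyDefect (x : V → K) (k : ℕ) : ℝ :=
  𝓜.meanRate Λ x k - (blockEntropy Λ (k + 2) - blockEntropy Λ (k + 1))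

variable (𝓜 Λ) in
/-- The probability of the word `g` at the places `-k, …, 0` followed by the letter `e`, for
`r = (g, e)`, if that letter were chosen by the probabilities at the point coded by `g`. -/
noncomputable def predictedProb (x : V → K) {k : ℕ} (r : (Fin (k + 1) → E) × E) : ℝ :=
  Λ.real (cylinderAt (-k) (List.ofFn r.1)) * 𝓜.p r.2 (𝓜.wordPoint x r.1)

theorem predictedProb_nonneg (x : V → K) {k : ℕ} (r : (Fin (k + 1) → E) × E) :
    0 ≤ 𝓜.predictedProb Λ x r :=
  mul_nonneg measureReal_nonneg (𝓜.p_nonneg _ _)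

theorem p_wordPoint_pos [TopologicalSpace K] {x : V → K} (hpos : 𝓜.IsBoundedBelow)
    (hx : ∀ v, x v ∈ 𝓜.cell v) (hY : ∀ᵐ σ ∂Λ, σ ∈ 𝓜.codingDomain x)
    {k : ℕ} {r : (Fin (k + 1) → E) × E} (hr : nextProb Λ r ≠ 0) :
    0 < 𝓜.p r.2 (𝓜.wordPoint x r.1) := by
  have hne : Λ (cylinderAt (-k) (List.ofFn r.1) ∩ {σ | σ 1 = r.2}) ≠ 0 := fun h0 =>
    hr (by rw [nextProb, Measure.real, h0, ENNReal.toReal_zero])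
  obtain ⟨σ, ⟨hword, hletter : σ 1 = r.2⟩, hσ⟩ :=
    (frequently_ae_mem_iff.2 hne).and_eventually hY |>.exists
  rw [cylinderAt_ofFn] at hword
  rw [← hletter, ← show window (-k) (k + 1) σ = r.1 from hword, ← codingSeq_eq_wordPoint]
  exact hpos.p_pos (codingSeq_mem_cell hx (mem_convergenceSet_of_mem_codingDomain hσ).1 k)

variable [DiscreteMeasurableSpace E] {x : V → K}

theorem sum_predictedProb [IsProbabilityMeasure Λ] (x : V → K) (k : ℕ) :
    ∑ r : (Fin (k + 1) → E) × E, 𝓜.predictedProb Λ x r = 1 := by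
  rw [Fintype.sum_prod_type]
  simp only [predictedProb, ← Finset.mul_sum, 𝓜.p_sum, mul_one, sum_measureReal_cylinderAt]

theorem meanRate_eq_sum [IsFiniteMeasure Λ] (x : V → K) (k : ℕ) :
    𝓜.meanRate Λ x k = -∑ r : (Fin (k + 1) → E) × E,
      nextProb Λ r * Real.log (𝓜.p r.2 (𝓜.wordPoint x r.1)) := by
  have hwindow : ∀ σ : ℤ → E, window (-k) (k + 1) σ = Fin.init (window (-k) (k + 2) σ) :=
    fun _ => rfl
  have hnext : ∀ σ : ℤ → E, σ 1 = window (-k) (k + 2) σ (Fin.last (k + 1)) := fun σ => by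
    simp [window]
  simp only [meanRate, codingSeq_eq_wordPoint, hwindow, hnext]
  rw [integral_window Λ (-k) (k + 2) fun g =>
    -Real.log (𝓜.p (g (Fin.last (k + 1))) (𝓜.wordPoint x (Fin.init g))),
    sum_fin_succ_fun_last, Fintype.sum_prod_type]
  simp only [Fin.snoc_last, Fin.init_snoc, ofFn_snoc, nextProb_eq_cylinderAt, mul_neg,
    Finset.sum_neg_distrib]

section Defect

variable [TopologicalSpace K]

variable (h : IsInvariantProb leftShift Λ) (hpos : 𝓜.IsBoundedBelow) (hx : ∀ v, x v ∈ 𝓜.cell v)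
  (hY : ∀ᵐ σ ∂Λ, σ ∈ 𝓜.codingDomain x) (k : ℕ)
include h hpos hx hY

theorem entropyDefect_eq_sum :
    𝓜.entropyDefect Λ x k =
      ∑ r : (Fin (k + 1) → E) × E, nextProb Λ r * -Real.log (𝓜.predictedProb Λ x r) -
        ∑ r : (Fin (k + 1) → E) × E, Real.negMulLog (nextProb Λ r) := by
  have := h.1
  have hlog : ∀ r : (Fin (k + 1) → E) × E, nextProb Λ r * -Real.log (𝓜.predictedProb Λ x r) =
      -(nextProb Λ r * Real.log (Λ.real (cylinderAt (-k) (List.ofFn r.1)))) -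
      nextProb Λ r * Real.log (𝓜.p r.2 (𝓜.wordPoint x r.1)) := fun r => by
    by_cases hr : nextProb Λ r = 0
    · simp [hr]
    · rw [predictedProb, Real.log_mul (measureReal_cylinderAt_pos_of_nextProb_ne_zero hr).ne'
        (p_wordPoint_pos hpos hx hY hr).ne']
      ring
  simp only [hlog, Finset.sum_sub_distrib, Finset.sum_neg_distrib]
  rw [entropyDefect, meanRate_eq_sum, h.blockEntropy_add_two, h.blockEntropy_add_one]
  ring

theorem sum_sq_sqrt_sub_sqrt_le_entropyDefect :
    ∑ r : (Fin (k + 1) → E) × E, (√(nextProb Λ r) - √(𝓜.predictedProb Λ x r)) ^ 2 ≤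
      𝓜.entropyDefect Λ x k := by
  have := h.1
  rw [entropyDefect_eq_sum h hpos hx hY k]
  refine sum_sq_sqrt_sub_sqrt_le (fun _ => measureReal_nonneg) (predictedProb_nonneg x)
    (fun r hr => ?_) (by rw [sum_nextProb, sum_predictedProb])
  by_contra hne
  exact (mul_pos (measureReal_cylinderAt_pos_of_nextProb_ne_zero hne)
    (p_wordPoint_pos hpos hx hY hne)).ne' hr

theorem entropyDefect_nonneg : 0 ≤ 𝓜.entropyDefect Λ x k :=
  (Finset.sum_nonneg fun _ _ => sq_nonneg _).trans
    (sum_sq_sqrt_sub_sqrt_le_entropyDefect h hpos hx hY k)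

theorem sq_sum_abs_sub_le_entropyDefect :
    (∑ r : (Fin (k + 1) → E) × E, |nextProb Λ r - 𝓜.predictedProb Λ x r|) ^ 2 ≤
      4 * 𝓜.entropyDefect Λ x k := by
  have := h.1
  refine (sq_sum_abs_sub_le (fun _ => measureReal_nonneg) (predictedProb_nonneg x)
    (sum_nextProb k) (sum_predictedProb x k)).trans ?_
  gcongr
  exact sum_sq_sqrt_sub_sqrt_le_entropyDefect h hpos hx hY k

end Defect

theorem abs_measureReal_sub_setIntegral_le [IsFiniteMeasure Λ] (x : V → K) {k : ℕ}
    (S : Set (Fin (k + 1) → E)) (e : E) :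
    |Λ.real (window (-k) (k + 1) ⁻¹' S ∩ {σ | σ 1 = e}) -
        ∫ σ in window (-k) (k + 1) ⁻¹' S, 𝓜.p e (𝓜.codingSeq x σ k) ∂Λ| ≤
      ∑ r : (Fin (k + 1) → E) × E, |nextProb Λ r - 𝓜.predictedProb Λ x r| := by
  classical
  have hnext : Λ.real (window (-k) (k + 1) ⁻¹' S ∩ {σ | σ 1 = e}) =
      ∑ g, S.indicator (fun g => nextProb Λ (g, e)) g := by
    have hsum := setIntegral_window (Λ.restrict {σ | σ 1 = e}) (-k) (k + 1) S fun _ => 1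
    rw [setIntegral_const, smul_eq_mul, mul_one,
      measureReal_restrict_apply (measurable_window _ _ S.toFinite.measurableSet)] at hsum
    rw [hsum]
    refine Finset.sum_congr rfl fun g _ => ?_
    rw [measureReal_restrict_apply (measurableSet_cylinderAt _ _), ← nextProb.eq_1 Λ (g, e)]
    simp [Set.indicator_apply]
  have hpredicted : ∫ σ in window (-k) (k + 1) ⁻¹' S, 𝓜.p e (𝓜.codingSeq x σ k) ∂Λ =
      ∑ g, S.indicator (fun g => 𝓜.predictedProb Λ x (g, e)) g := by
    simp only [codingSeq_eq_wordPoint]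
    rw [setIntegral_window Λ (-k) (k + 1) S fun g => 𝓜.p e (𝓜.wordPoint x g)]
    simp only [Set.indicator_apply, mul_ite, mul_zero, predictedProb]
  rw [hnext, hpredicted, ← Finset.sum_sub_distrib, Fintype.sum_prod_type]
  refine (Finset.abs_sum_le_sum_abs _ _).trans (Finset.sum_le_sum fun g _ => ?_)
  refine le_trans ?_ (Finset.single_le_sum
    (f := fun e => |nextProb Λ (g, e) - 𝓜.predictedProb Λ x (g, e)|)
    (fun e _ => abs_nonneg _) (Finset.mem_univ e))
  simp only [Set.indicator_apply]
  split_ifs <;> simp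

section Variational

variable [MetricSpace K] [Nonempty K]

theorem integrable_rate [ProperSpace K] [BorelSpace K] [IsFiniteMeasure Λ]
    (hopen : ∀ v, IsOpen (𝓜.cell v)) (hpos : 𝓜.IsBoundedBelow) (hx : ∀ v, x v ∈ 𝓜.cell v)
    (hY : ∀ᵐ σ ∂Λ, σ ∈ 𝓜.codingDomain x) : Integrable (𝓜.rate x) Λ := by
  obtain ⟨B, hB⟩ := hpos.exists_neg_log_p_le
  refine Integrable.of_bound (measurable_rate x).aestronglyMeasurable B ?_
  filter_upwards [hY] with σ hσ
  rw [Real.norm_eq_abs, rate, abs_of_nonneg (𝓜.neg_log_p_nonneg _ _)]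
  exact hB _ _ (codingMap_mem_cell hopen hx (mem_convergenceSet_of_mem_codingDomain hσ))

theorem tendsto_setIntegral_p [IsFiniteMeasure Λ] (hcont : ∀ e, Continuous (𝓜.p e))
    (hY : ∀ᵐ σ ∂Λ, σ ∈ 𝓜.codingDomain x) (s : Set (ℤ → E)) (e : E) :
    Tendsto (fun k => ∫ σ in s, 𝓜.p e (𝓜.codingSeq x σ k) ∂Λ) atTop
      (𝓝 (∫ σ in s, 𝓜.p e (𝓜.codingMap x σ) ∂Λ)) := by
  refine tendsto_integral_of_dominated_convergence (fun _ => 1)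
    (fun n => ((𝓜.p_measurable e).comp (measurable_codingSeq x n)).aestronglyMeasurable)
    (integrable_const _) (fun n => ae_of_all _ fun σ => ?_) ?_
  · rw [Real.norm_eq_abs, abs_of_nonneg (𝓜.p_nonneg _ _)]
    exact 𝓜.p_le_one _ _
  · filter_upwards [ae_restrict_of_ae hY] with σ hσ
    exact ((hcont e).tendsto _).comp
      (tendsto_codingSeq (mem_convergenceSet_of_mem_codingDomain hσ))

variable (𝓜 Λ x) in
/-- Given the past, the letter at the place `1` is distributed according to the probabilities at
the value of the coding map. -/
def NextLetterLaw : Prop :=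
  ∀ (n : ℕ) (g : Fin (n + 1) → E) (e : E),
    Λ.real (cylinderAt (-n) (List.ofFn g) ∩ {σ | σ 1 = e}) =
      ∫ σ in cylinderAt (-n) (List.ofFn g), 𝓜.p e (𝓜.codingMap x σ) ∂Λ

variable (h : IsInvariantProb leftShift Λ) (hopen : ∀ v, IsOpen (𝓜.cell v))
  (hcont : ∀ e, Continuous (𝓜.p e)) (hpos : 𝓜.IsBoundedBelow) (hx : ∀ v, x v ∈ 𝓜.cell v)
  (hY : ∀ᵐ σ ∂Λ, σ ∈ 𝓜.codingDomain x)
include hopen hcont hpos hx hY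

theorem tendsto_meanRate [IsFiniteMeasure Λ] :
    Tendsto (𝓜.meanRate Λ x) atTop (𝓝 (∫ σ, 𝓜.rate x σ ∂Λ)) := by
  obtain ⟨B, hB⟩ := hpos.exists_neg_log_p_le
  refine tendsto_integral_of_dominated_convergence (fun _ => B)
    (fun n => (measurable_letter_comp 𝓜.measurable_log_p (measurable_pi_apply 1)
      (measurable_codingSeq x n)).neg.aestronglyMeasurable)
    (integrable_const _) (fun n => ?_) ?_
  · filter_upwards [hY] with σ hσ
    rw [Real.norm_eq_abs, abs_of_nonneg (𝓜.neg_log_p_nonneg _ _)]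
    exact hB _ _ (codingSeq_mem_cell hx (mem_convergenceSet_of_mem_codingDomain hσ).1 n)
  · filter_upwards [hY] with σ hσ
    have hσ := mem_convergenceSet_of_mem_codingDomain hσ
    have hp := hpos.p_pos (codingMap_mem_cell hopen hx hσ)
    exact ((Real.continuousAt_log hp.ne').tendsto.comp
      (((hcont (σ 1)).tendsto _).comp (tendsto_codingSeq hσ))).neg

include h

theorem ksEntropy_le_integral_rate_sub {ε : ℝ} (hε : ∀ᶠ k in atTop, ε ≤ 𝓜.entropyDefect Λ x k) :
    ksEntropy leftShift Λ ≤ ((∫ σ, 𝓜.rate x σ ∂Λ) - ε : ℝ) := by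
  have := h.1
  rw [← EReal.le_of_forall_lt_iff_le]
  intro r hr
  have hr : (∫ σ, 𝓜.rate x σ ∂Λ) - ε < r := by exact_mod_cast hr
  obtain ⟨s, hs, hsr⟩ := exists_between hr
  refine h.ksEntropy_le (eventually_le_mul_of_sub_le hsr ?_)
  rw [← map_add_atTop_eq_nat 1, eventually_map]
  filter_upwards [hε, (tendsto_meanRate hopen hcont hpos hx hY).eventually_lt_const
    (show ∫ σ, 𝓜.rate x σ ∂Λ < s + ε by linarith)] with k hdefect hrate
  rw [entropyDefect] at hdefect
  linarith

theorem ksEntropy_le_integral_rate :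
    ksEntropy leftShift Λ ≤ ((∫ σ, 𝓜.rate x σ ∂Λ : ℝ) : EReal) := by
  have hle := ksEntropy_le_integral_rate_sub h hopen hcont hpos hx hY (ε := 0)
    (Eventually.of_forall (entropyDefect_nonneg h hpos hx hY))
  rwa [sub_zero] at hle

theorem frequently_entropyDefect_lt
    (hks : ((∫ σ, 𝓜.rate x σ ∂Λ : ℝ) : EReal) ≤ ksEntropy leftShift Λ) {ε : ℝ} (hε : 0 < ε) :
    ∃ᶠ k in atTop, 𝓜.entropyDefect Λ x k < ε := by
  by_contra hcon
  simp only [not_frequently, not_lt] at hcon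
  have hle := hks.trans (ksEntropy_le_integral_rate_sub h hopen hcont hpos hx hY hcon)
  rw [EReal.coe_le_coe_iff] at hle
  linarith

/- The entropy defect dominates the squared distance between the law of the words of length `k + 2`
and its prediction. It vanishes along a subsequence, and the predictions converge. -/
theorem nextLetterLaw_of_le_ksEntropy
    (hks : ((∫ σ, 𝓜.rate x σ ∂Λ : ℝ) : EReal) ≤ ksEntropy leftShift Λ) :
    𝓜.NextLetterLaw Λ x := by
  intro j g e
  have := h.1
  set C := cylinderAt (-j) (List.ofFn g) with hC
  set P := Λ.real (C ∩ {σ | σ 1 = e})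
  have hbound : ∀ k, j ≤ k → (P - ∫ σ in C, 𝓜.p e (𝓜.codingSeq x σ k) ∂Λ) ^ 2 ≤
      4 * 𝓜.entropyDefect Λ x k := by
    intro k hjk
    obtain ⟨ρ, hρ⟩ := exists_comp_window_eq (E := E) (m := -j) (m' := -k) (n := j + 1)
      (n' := k + 1) (by omega) (by omega)
    have hCk : C = window (-k) (k + 1) ⁻¹' (ρ ⁻¹' {g}) := by
      rw [hC, cylinderAt_ofFn, ← Set.preimage_comp, ← funext hρ]
      rfl
    have hdist := abs_measureReal_sub_setIntegral_le (𝓜 := 𝓜) (Λ := Λ) x (ρ ⁻¹' {g}) e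
    rw [← hCk] at hdist
    refine le_trans ?_ (sq_sum_abs_sub_le_entropyDefect h hpos hx hY k)
    rw [← sq_abs]
    gcongr
  have hlim := (tendsto_const_nhds (x := P)).sub (tendsto_setIntegral_p hcont hY C e) |>.pow 2
  have hsq : (P - ∫ σ in C, 𝓜.p e (𝓜.codingMap x σ) ∂Λ) ^ 2 ≤ 0 := by
    refine le_of_forall_pos_le_add fun ε hε => le_of_tendsto_of_frequently hlim ?_
    refine ((frequently_entropyDefect_lt h hopen hcont hpos hx hY hks
      (show 0 < ε / 4 by positivity)).and_eventually (eventually_ge_atTop j)).mono ?_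
    rintro k ⟨hk, hjk⟩
    linarith [hbound k hjk]
  exact sub_eq_zero.1 (pow_eq_zero_iff two_ne_zero |>.1 (hsq.antisymm (sq_nonneg _)))

end Variational

end MarkovSystem

/-! ### Equilibrium states are generalized Markov measures -/

section Past

variable {E : Type*}

theorem cylinderAt_cons_eq_inter (m : ℤ) (e : E) (l : List E) :
    cylinderAt m (e :: l) = {σ | σ m = e} ∩ leftShift ⁻¹' cylinderAt m l := by
  rw [leftShift, preimage_shiftBy_cylinderAt]
  ext σ
  exact mem_cylinderAt_cons

/-- The sequence that agrees with `σ` up to the place `0` and is constant from there on. -/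
def pastProj (σ : ℤ → E) : ℤ → E := fun j => σ (min j 0)

@[fun_prop]
theorem measurable_pastProj [MeasurableSpace E] : Measurable (pastProj : (ℤ → E) → ℤ → E) :=
  measurable_pi_lambda _ fun _ => measurable_pi_apply _

theorem apply_pastProj_of_dependsOn {β : Type*} {G : (ℤ → E) → β} (hG : DependsOn G (Set.Iic 0))
    (σ : ℤ → E) : G (pastProj σ) = G σ :=
  hG fun _ hj => congrArg σ (min_eq_left hj)

theorem map_pastProj_eq [Finite E] [MeasurableSpace E] [DiscreteMeasurableSpace E]
    {Λ₁ Λ₂ : Measure (ℤ → E)} [IsFiniteMeasure Λ₁]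
    (h : ∀ (n : ℕ) (g : Fin (n + 1) → E),
      Λ₁ (cylinderAt (-n) (List.ofFn g)) = Λ₂ (cylinderAt (-n) (List.ofFn g))) :
    Λ₁.map pastProj = Λ₂.map pastProj := by
  refine measure_ext_of_cylinderAt fun n g => ?_
  set ρ : (Fin (n + 1) → E) → Fin (2 * n + 1) → E := fun f j => f ⟨min j n, by omega⟩
  have hρ : pastProj ⁻¹' cylinderAt (-n) (List.ofFn g) = window (-n) (n + 1) ⁻¹' (ρ ⁻¹' {g}) := by
    rw [cylinderAt_ofFn, ← Set.preimage_comp, ← Set.preimage_comp]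
    congr 1
    funext σ j
    simp only [Function.comp_apply, ρ, window, pastProj]
    congr 1
    push_cast
    omega
  have hS : MeasurableSet (ρ ⁻¹' {g}) := (Set.toFinite _).measurableSet
  rw [Measure.map_apply measurable_pastProj (measurableSet_cylinderAt _ _),
    Measure.map_apply measurable_pastProj (measurableSet_cylinderAt _ _), hρ,
    ← Measure.map_apply (measurable_window _ _) hS, ← Measure.map_apply (measurable_window _ _) hS,
    map_window_eq fun f => h n f]

/-- The function that takes the value `G σ` at `leftShift σ` if the letter of `σ` at the place `1`
is `e`, and `0` otherwise. -/
noncomputable def pushLetter (e : E) (G : (ℤ → E) → ℝ≥0∞) : (ℤ → E) → ℝ≥0∞ :=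
  {τ | τ 0 = e}.indicator (G ∘ shiftBy (-1))

theorem pushLetter_leftShift (e : E) (G : (ℤ → E) → ℝ≥0∞) (σ : ℤ → E) :
    pushLetter e G (leftShift σ) = {σ : ℤ → E | σ 1 = e}.indicator G σ := by
  classical
  simp only [pushLetter, Set.indicator_apply, Function.comp_apply, leftShift, shiftBy_shiftBy,
    neg_add_cancel, shiftBy_zero]
  rfl

theorem dependsOn_pushLetter {G : (ℤ → E) → ℝ≥0∞} (hG : DependsOn G (Set.Iic 0)) (e : E) :
    DependsOn (pushLetter e G) (Set.Iic 0) := by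
  classical
  intro τ τ' h
  have hshift : G (shiftBy (-1) τ) = G (shiftBy (-1) τ') :=
    hG fun j hj => h _ (show j + -1 ≤ 0 by linarith [Set.mem_Iic.1 hj])
  simp only [pushLetter, Set.indicator_apply, Set.mem_ofPred_eq, h 0 (Set.mem_Iic.2 le_rfl),
    Function.comp_apply, hshift]

variable [MeasurableSpace E] [DiscreteMeasurableSpace E]

theorem measurable_pushLetter {G : (ℤ → E) → ℝ≥0∞} (hG : Measurable G) (e : E) :
    Measurable (pushLetter e G) :=
  (hG.comp (measurable_shiftBy _)).indicator (measurableSet_eval 0 e)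

theorem IsInvariantProb.setLIntegral_cylinderAt_cons [Finite E] {Λ : Measure (ℤ → E)}
    (h : IsInvariantProb leftShift Λ) {G : (ℤ → E) → ℝ≥0∞} (hG : Measurable G) (e : E)
    (l : List E) :
    ∫⁻ σ in cylinderAt 1 (e :: l), G σ ∂Λ = ∫⁻ τ in cylinderAt 1 l, pushLetter e G τ ∂Λ := by
  rw [← h.2.setLIntegral_comp_preimage (measurableSet_cylinderAt 1 l) (measurable_pushLetter hG e)]
  simp only [pushLetter_leftShift]
  rw [lintegral_indicator (measurableSet_eval 1 e),
    Measure.restrict_restrict (measurableSet_eval 1 e), cylinderAt_cons_eq_inter]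

end Past

namespace MarkovSystem

variable {K V E : Type*} [MeasurableSpace K] [Fintype E] {𝓜 : MarkovSystem K V E}
  [MetricSpace K] [Nonempty K] {x : V → K}

variable (𝓜 x) in
theorem dependsOn_codingMap : DependsOn (𝓜.codingMap x) (Set.Iic 0) := by
  intro σ σ' h
  have hseq : 𝓜.codingSeq x σ = 𝓜.codingSeq x σ' := by
    funext n
    rw [codingSeq_eq_wordPoint, codingSeq_eq_wordPoint]
    congr 1
    funext j
    exact h _ (show -(n : ℤ) + j ≤ 0 by omega)
  rw [codingMap, codingMap, hseq]

variable [ProperSpace K] [BorelSpace K] [MeasurableSpace E] [DiscreteMeasurableSpace E]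
  {Λ : Measure (ℤ → E)}

namespace NextLetterLaw

theorem setLIntegral_eval [IsFiniteMeasure Λ] (hΛ : 𝓜.NextLetterLaw Λ x) (e : E)
    {G : (ℤ → E) → ℝ≥0∞} (hG : Measurable G) (hpast : DependsOn G (Set.Iic 0)) :
    ∫⁻ σ in {σ | σ 1 = e}, G σ ∂Λ =
      ∫⁻ σ, ENNReal.ofReal (𝓜.p e (𝓜.codingMap x σ)) * G σ ∂Λ := by
  have hp : Measurable fun σ => 𝓜.p e (𝓜.codingMap x σ) :=
    (𝓜.p_measurable e).comp (measurable_codingMap x)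
  have hmap : (Λ.restrict {σ | σ 1 = e}).map pastProj =
      (Λ.withDensity fun σ => ENNReal.ofReal (𝓜.p e (𝓜.codingMap x σ))).map pastProj := by
    refine map_pastProj_eq fun n g => ?_
    have hC := measurableSet_cylinderAt (-n) (List.ofFn g)
    rw [Measure.restrict_apply hC, withDensity_apply _ hC,
      ← ofReal_integral_eq_lintegral_ofReal, ← hΛ n g e, ofReal_measureReal]
    · refine Integrable.of_bound hp.aestronglyMeasurable 1 (ae_of_all _ fun σ => ?_)
      rw [Real.norm_of_nonneg (𝓜.p_nonneg _ _)]
      exact 𝓜.p_le_one _ _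
    · exact ae_of_all _ fun σ => 𝓜.p_nonneg _ _
  have hfint := congrArg (fun ν => ∫⁻ τ, G τ ∂ν) hmap
  simp only [lintegral_map hG measurable_pastProj, apply_pastProj_of_dependsOn hpast] at hfint
  rw [hfint, lintegral_withDensity_eq_lintegral_mul _ hp.ennreal_ofReal hG]
  rfl

variable (hΛ : 𝓜.NextLetterLaw Λ x) (h : IsInvariantProb leftShift Λ) (hcontr : 𝓜.IsContractive)
  (hopen : ∀ v, IsOpen (𝓜.cell v)) (hpos : 𝓜.IsBoundedBelow) (hx : ∀ v, x v ∈ 𝓜.cell v)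
  (hY : ∀ᵐ σ ∂Λ, σ ∈ 𝓜.codingDomain x)
include hΛ h hcontr hopen hpos hx hY

theorem lintegral_pushLetter_mul_codingMap {G : (ℤ → E) → ℝ≥0∞} (hG : Measurable G)
    (hpast : DependsOn G (Set.Iic 0)) {f : K → ℝ≥0∞} (hf : Measurable f) (e : E) :
    ∫⁻ τ, pushLetter e G τ * f (𝓜.codingMap x τ) ∂Λ =
      ∫⁻ σ, ENNReal.ofReal (𝓜.p e (𝓜.codingMap x σ)) * (G σ * f (𝓜.w e (𝓜.codingMap x σ))) ∂Λ := by
  have := h.1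
  have hF := measurable_codingMap (𝓜 := 𝓜) x
  have hstep := hΛ.setLIntegral_eval e
    (G := fun σ => G σ * f (𝓜.w e (𝓜.codingMap x σ)))
    (hG.mul (hf.comp ((𝓜.w_measurable e).comp hF)))
    fun σ σ' hσ => by simp only [hpast hσ, dependsOn_codingMap 𝓜 x hσ]
  have hshift := h.2.lintegral_comp ((measurable_pushLetter hG e).mul (hf.comp hF))
  simp only [Pi.mul_apply, Function.comp_apply] at hshift
  rw [← hstep, ← hshift, ← lintegral_indicator (measurableSet_eval 1 e)]
  refine lintegral_congr_ae ?_
  filter_upwards [hY] with σ hσ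
  rw [pushLetter_leftShift, codingMap_leftShift hcontr hopen hpos hx hσ]
  by_cases he : σ ∈ {σ : ℤ → E | σ 1 = e}
  · rw [Set.indicator_of_mem he, Set.indicator_of_mem he, show σ 1 = e from he]
  · rw [Set.indicator_of_notMem he, Set.indicator_of_notMem he, zero_mul]

theorem invariant_map_codingMap : 𝓜.kernel.Invariant (Λ.map (𝓜.codingMap x)) := by
  have hF := measurable_codingMap (𝓜 := 𝓜) x
  refine Measure.ext_of_lintegral _ fun f hf => ?_
  have hpf : ∀ e, Measurable fun y => ENNReal.ofReal (𝓜.p e y) * f (𝓜.w e y) := fun e =>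
    (𝓜.measurable_ofReal_p e).mul (hf.comp (𝓜.w_measurable e))
  have hpfF : ∀ e, Measurable fun σ => ENNReal.ofReal (𝓜.p e (𝓜.codingMap x σ)) *
      f (𝓜.w e (𝓜.codingMap x σ)) := fun e => (hpf e).comp hF
  rw [𝓜.lintegral_bind_kernel _ hf, lintegral_map (Finset.measurable_sum _ fun e _ => hpf e) hF,
    lintegral_finsetSum _ fun e _ => hpfF e, lintegral_map hf hF,
    ← sum_setLIntegral_eval Λ 0]
  refine Finset.sum_congr rfl fun e _ => ?_
  have hstep := hΛ.lintegral_pushLetter_mul_codingMap h hcontr hopen hpos hx hY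
    (G := fun _ => 1) measurable_const (fun _ _ _ => rfl) hf e
  simp only [one_mul] at hstep
  rw [← hstep, ← lintegral_indicator (measurableSet_eval 0 e)]
  refine lintegral_congr fun τ => ?_
  by_cases he : τ ∈ {τ : ℤ → E | τ 0 = e} <;> simp [pushLetter, he]

theorem setLIntegral_cylinderAt (l : List E) {G : (ℤ → E) → ℝ≥0∞} (hG : Measurable G)
    (hpast : DependsOn G (Set.Iic 0)) :
    ∫⁻ σ in cylinderAt 1 l, G σ ∂Λ =
      ∫⁻ σ, G σ * ENNReal.ofReal (𝓜.wordProb l (𝓜.codingMap x σ)) ∂Λ := by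
  induction l generalizing G with
  | nil => simp
  | cons e l ih =>
    rw [h.setLIntegral_cylinderAt_cons hG,
      ih (measurable_pushLetter hG e) (dependsOn_pushLetter hpast e),
      hΛ.lintegral_pushLetter_mul_codingMap h hcontr hopen hpos hx hY hG hpast
        (𝓜.measurable_wordProb l).ennreal_ofReal e]
    refine lintegral_congr fun σ => ?_
    rw [wordProb_cons, ENNReal.ofReal_mul (𝓜.p_nonneg _ _), mul_left_comm]

theorem isGeneralizedMarkovMeasure :
    𝓜.IsGeneralizedMarkovMeasure (Λ.map (𝓜.codingMap x)) Λ := by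
  intro m l
  have hword := hΛ.setLIntegral_cylinderAt h hcontr hopen hpos hx hY l (G := fun _ => 1)
    measurable_const fun _ _ _ => rfl
  simp only [lintegral_one, Measure.restrict_apply_univ, one_mul] at hword
  rw [h.measure_cylinderAt m 1, hword,
    lintegral_map (𝓜.measurable_wordProb l).ennreal_ofReal (measurable_codingMap x)]

end NextLetterLaw

end MarkovSystem

/-! ### The entropy of the generalized Markov measure -/

theorem integrable_negMulLog {X : Type*} [MeasurableSpace X] {ν : Measure X} [IsFiniteMeasure ν]
    {f : X → ℝ} (hf : Measurable f) (hf0 : ∀ y, 0 ≤ f y) (hf1 : ∀ y, f y ≤ 1) :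
    Integrable (fun y => Real.negMulLog (f y)) ν := by
  refine Integrable.of_bound (Real.continuous_negMulLog.measurable.comp hf).aestronglyMeasurable 1
    (ae_of_all _ fun y => ?_)
  rw [Real.norm_of_nonneg (Real.negMulLog_nonneg (hf0 y) (hf1 y))]
  linarith [Real.negMulLog_le_one_sub_self (hf0 y), hf0 y]

namespace MarkovSystem

variable {K V E : Type*} [MeasurableSpace K] [Fintype E] {𝓜 : MarkovSystem K V E}

variable (𝓜) in
/-- The entropy of the distribution of the next edge. -/
noncomputable def pointEntropy (y : K) : ℝ := ∑ e, Real.negMulLog (𝓜.p e y)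

theorem measurable_pointEntropy : Measurable 𝓜.pointEntropy :=
  Finset.measurable_sum _ fun e _ =>
    Real.continuous_negMulLog.measurable.comp (𝓜.p_measurable e)

theorem pointEntropy_nonneg (y : K) : 0 ≤ 𝓜.pointEntropy y :=
  Finset.sum_nonneg fun e _ => Real.negMulLog_nonneg (𝓜.p_nonneg e y) (𝓜.p_le_one e y)

theorem sum_negMulLog_wordProb_succ (n : ℕ) (y : K) :
    ∑ g : Fin (n + 1) → E, Real.negMulLog (𝓜.wordProb (List.ofFn g) y) =
      ∑ g : Fin n → E, Real.negMulLog (𝓜.wordProb (List.ofFn g) y) +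
        𝓜.markovOp^[n] 𝓜.pointEntropy y := by
  rw [sum_ofFn_succ_last n fun l => Real.negMulLog (𝓜.wordProb l y), iterate_markovOp_apply,
    ← Finset.sum_add_distrib]
  refine Finset.sum_congr rfl fun g _ => ?_
  simp only [wordProb_append, wordProb_cons, wordProb_nil, mul_one, Real.negMulLog_mul]
  rw [Finset.sum_add_distrib, ← Finset.sum_mul, 𝓜.p_sum, one_mul, ← Finset.mul_sum]
  rfl

theorem integral_sum_negMulLog_wordProb {μ : Measure K} [IsProbabilityMeasure μ]
    (hμ : 𝓜.kernel.Invariant μ) (n : ℕ) :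
    ∫ y, ∑ g : Fin n → E, Real.negMulLog (𝓜.wordProb (List.ofFn g) y) ∂μ =
      n * ∫ y, 𝓜.pointEntropy y ∂μ := by
  have hInt : ∀ n : ℕ, Integrable
      (fun y => ∑ g : Fin n → E, Real.negMulLog (𝓜.wordProb (List.ofFn g) y)) μ := fun n =>
    integrable_finsetSum _ fun g _ => integrable_negMulLog (𝓜.measurable_wordProb _)
      (𝓜.wordProb_nonneg _) (𝓜.wordProb_le_one _)
  induction n with
  | zero => simp
  | succ n ih =>
    have hop : Integrable (𝓜.markovOp^[n] 𝓜.pointEntropy) μ := by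
      refine ((hInt (n + 1)).sub (hInt n)).congr (ae_of_all _ fun y => ?_)
      simp only [Pi.sub_apply, sum_negMulLog_wordProb_succ, add_sub_cancel_left]
    simp only [sum_negMulLog_wordProb_succ]
    rw [integral_add (hInt n) hop, ih,
      integral_iterate_markovOp_of_invariant hμ measurable_pointEntropy pointEntropy_nonneg]
    push_cast
    ring

theorem IsGeneralizedMarkovMeasure.mul_le_blockEntropy [MeasurableSpace E]
    {μ : Measure K} [IsProbabilityMeasure μ] {M : Measure (ℤ → E)} (hμ : 𝓜.kernel.Invariant μ)
    (hM : 𝓜.IsGeneralizedMarkovMeasure μ M) (n : ℕ) :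
    n * ∫ y, 𝓜.pointEntropy y ∂μ ≤ blockEntropy M n := by
  have hInt : ∀ l, Integrable (fun y => Real.negMulLog (𝓜.wordProb l y)) μ := fun l =>
    integrable_negMulLog (𝓜.measurable_wordProb l) (𝓜.wordProb_nonneg l) (𝓜.wordProb_le_one l)
  rw [← integral_sum_negMulLog_wordProb hμ, integral_finsetSum _ fun g _ => hInt _, blockEntropy]
  refine Finset.sum_le_sum fun g _ => ?_
  rw [hM.measureReal_cylinderAt]
  exact Real.concaveOn_negMulLog.le_map_integral Real.continuous_negMulLog.continuousOn
    isClosed_Ici (ae_of_all _ fun y => 𝓜.wordProb_nonneg _ y) (integrable_wordProb μ _) (hInt _)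

theorem integral_pointEntropy (μ : Measure K) [IsProbabilityMeasure μ] :
    ∫ y, 𝓜.pointEntropy y ∂μ =
      -∑ e, ∫ y in 𝓜.cell (𝓜.init e), 𝓜.p e y * Real.log (𝓜.p e y) ∂μ := by
  simp only [pointEntropy]
  rw [integral_finsetSum _ fun e _ =>
    integrable_negMulLog (𝓜.p_measurable e) (𝓜.p_nonneg e) (𝓜.p_le_one e),
    ← Finset.sum_neg_distrib]
  refine Finset.sum_congr rfl fun e _ => ?_
  rw [setIntegral_eq_integral_of_forall_compl_eq_zero fun y hy => by
    rw [𝓜.p_eq_zero e y hy, zero_mul], ← integral_neg]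
  simp only [Real.negMulLog, neg_mul]

variable [MetricSpace K] [ProperSpace K] [BorelSpace K] [Nonempty K] [Fintype V]
  [MeasurableSpace E] [DiscreteMeasurableSpace E] {x : V → K} {μ : Measure K}
  {M : Measure (ℤ → E)}

theorem IsGeneralizedMarkovMeasure.integral_rate [IsProbabilityMeasure μ]
    (hcontr : 𝓜.IsContractive) (hopen : ∀ v, IsOpen (𝓜.cell v)) (hx : ∀ v, x v ∈ 𝓜.cell v)
    (hμ : 𝓜.kernel.Invariant μ) (hH : Integrable (𝓜.height x) μ)
    (hM : 𝓜.IsGeneralizedMarkovMeasure μ M) :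
    ∫ σ, 𝓜.rate x σ ∂M = ∫ y, 𝓜.pointEntropy y ∂μ := by
  rw [integral_eq_lintegral_of_nonneg_ae (f := 𝓜.rate x)
    (ae_of_all _ fun σ => 𝓜.neg_log_p_nonneg _ _) (measurable_rate x).aestronglyMeasurable,
    integral_eq_lintegral_of_nonneg_ae (ae_of_all _ pointEntropy_nonneg)
    measurable_pointEntropy.aestronglyMeasurable]
  congr 1
  have hm : ∀ e, Measurable fun y => ENNReal.ofReal (-Real.log (𝓜.p e y)) := fun e =>
    (𝓜.measurable_log_p e).neg.ennreal_ofReal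
  have hpm : ∀ e, Measurable fun y => ENNReal.ofReal (𝓜.p e y) *
      ENNReal.ofReal (-Real.log (𝓜.p e y)) := fun e => (𝓜.measurable_ofReal_p e).mul (hm e)
  have := hM.lintegral_letter_codingMap hcontr hopen hx hμ hH
    (f := fun e y => ENNReal.ofReal (-Real.log (𝓜.p e y))) hm
  simp only [rate]
  rw [this, ← lintegral_finsetSum _ fun e _ => hpm e]
  refine lintegral_congr fun y => ?_
  rw [pointEntropy, ENNReal.ofReal_sum_of_nonneg fun e _ =>
    Real.negMulLog_nonneg (𝓜.p_nonneg e y) (𝓜.p_le_one e y)]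
  refine Finset.sum_congr rfl fun e _ => ?_
  rw [← ENNReal.ofReal_mul (𝓜.p_nonneg e y), Real.negMulLog, mul_neg, neg_mul]

end MarkovSystem

/-! ### Pressure and equilibrium states -/

namespace MarkovSystem

variable {K V E : Type*} [MeasurableSpace K] [Fintype E] {𝓜 : MarkovSystem K V E}
  [MetricSpace K] [Nonempty K] [ProperSpace K] [BorelSpace K] [MeasurableSpace E]
  [DiscreteMeasurableSpace E] {x : V → K} {Λ : Measure (ℤ → E)}

section Invariant

variable (h : IsInvariantProb leftShift Λ) (hopen : ∀ v, IsOpen (𝓜.cell v))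
  (hcont : ∀ e, Continuous (𝓜.p e)) (hpos : 𝓜.IsBoundedBelow) (hx : ∀ v, x v ∈ 𝓜.cell v)
include h hopen hcont hpos hx

theorem ksEntropy_add_energyIntegral_nonpos :
    ksEntropy leftShift Λ + energyIntegral Λ (𝓜.energy x) ≤ 0 := by
  have := h.1
  by_cases hY : ∀ᵐ σ ∂Λ, σ ∈ 𝓜.codingDomain x
  · rw [energyIntegral_energy hY (integrable_rate hopen hpos hx hY)]
    refine (add_le_add_left (ksEntropy_le_integral_rate h hopen hcont hpos hx hY) _).trans ?_
    rw [← EReal.coe_add, add_neg_cancel, EReal.coe_zero]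
  · rw [energyIntegral_energy_eq_bot hY, EReal.add_bot]
    exact bot_le

theorem nextLetterLaw_of_ksEntropy_add_energyIntegral_eq_zero
    (h0 : ksEntropy leftShift Λ + energyIntegral Λ (𝓜.energy x) = 0) :
    (∀ᵐ σ ∂Λ, σ ∈ 𝓜.codingDomain x) ∧ 𝓜.NextLetterLaw Λ x := by
  have := h.1
  have hY : ∀ᵐ σ ∂Λ, σ ∈ 𝓜.codingDomain x := by
    by_contra hY
    rw [energyIntegral_energy_eq_bot hY, EReal.add_bot] at h0
    exact EReal.bot_ne_zero h0
  refine ⟨hY, nextLetterLaw_of_le_ksEntropy h hopen hcont hpos hx hY ?_⟩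
  rw [energyIntegral_energy hY (integrable_rate hopen hpos hx hY), EReal.coe_neg,
    ← sub_eq_add_neg] at h0
  by_contra hlt
  refine (ne_of_lt ?_) h0
  rw [EReal.sub_lt_iff (Or.inl (EReal.coe_ne_bot _)) (Or.inl (EReal.coe_ne_top _)), zero_add]
  exact not_le.1 hlt

end Invariant

namespace IsGeneralizedMarkovMeasure

variable [Fintype V] {μ : Measure K} {M : Measure (ℤ → E)} [IsProbabilityMeasure μ]

section Continuous

variable (hM : 𝓜.IsGeneralizedMarkovMeasure μ M) (hcontr : 𝓜.IsContractive)
  (hopen : ∀ v, IsOpen (𝓜.cell v)) (hcont : ∀ e, Continuous (𝓜.p e)) (hpos : 𝓜.IsBoundedBelow)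
  (hx : ∀ v, x v ∈ 𝓜.cell v) (hμ : 𝓜.kernel.Invariant μ) (hH : Integrable (𝓜.height x) μ)
include hM hcontr hopen hcont hpos hx hμ hH

theorem ksEntropy_eq :
    ksEntropy leftShift M = ((∫ y, 𝓜.pointEntropy y ∂μ : ℝ) : EReal) := by
  refine le_antisymm ?_ (hM.isInvariantProb.le_ksEntropy (hM.mul_le_blockEntropy hμ))
  rw [← hM.integral_rate hcontr hopen hx hμ hH]
  exact ksEntropy_le_integral_rate hM.isInvariantProb hopen hcont hpos hx
    (hM.ae_mem_codingDomain hcontr hopen hx hμ hH)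

theorem ksEntropy_add_energyIntegral_eq_zero :
    ksEntropy leftShift M + energyIntegral M (𝓜.energy x) = 0 := by
  have := hM.isProbabilityMeasure
  have hY := hM.ae_mem_codingDomain hcontr hopen hx hμ hH
  rw [energyIntegral_energy hY (integrable_rate hopen hpos hx hY),
    hM.ksEntropy_eq hcontr hopen hcont hpos hx hμ hH, hM.integral_rate hcontr hopen hx hμ hH,
    ← EReal.coe_add, add_neg_cancel, EReal.coe_zero]

theorem pressure_energy_eq_zero :
    pressure (leftShift : (ℤ → E) → ℤ → E) (𝓜.energy x) = 0 := by
  refine le_antisymm (iSup₂_le fun Θ hΘ =>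
    ksEntropy_add_energyIntegral_nonpos hΘ hopen hcont hpos hx) ?_
  rw [← hM.ksEntropy_add_energyIntegral_eq_zero hcontr hopen hcont hpos hx hμ hH]
  exact le_iSup₂_of_le M hM.isInvariantProb le_rfl

theorem isEquilibriumState : IsEquilibriumState leftShift (𝓜.energy x) M :=
  ⟨hM.isInvariantProb,
    (hM.ksEntropy_add_energyIntegral_eq_zero hcontr hopen hcont hpos hx hμ hH).trans
      (hM.pressure_energy_eq_zero hcontr hopen hcont hpos hx hμ hH).symm⟩

end Continuous

theorem eq_of_isEquilibriumState (hM : 𝓜.IsGeneralizedMarkovMeasure μ M)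
    (hcontr : 𝓜.IsContractive) (hirr : 𝓜.IsIrreducible) (hopen : ∀ v, IsOpen (𝓜.cell v))
    (hdini : 𝓜.IsDini) (hpos : 𝓜.IsBoundedBelow) (hx : ∀ v, x v ∈ 𝓜.cell v)
    (hμ : 𝓜.kernel.Invariant μ) (hH : Integrable (𝓜.height x) μ)
    (hΛ : IsEquilibriumState leftShift (𝓜.energy x) Λ) : Λ = M := by
  obtain ⟨h, hmax⟩ := hΛ
  have := h.1
  have hcont := continuous_p hopen hdini
  obtain ⟨hY, hlaw⟩ := nextLetterLaw_of_ksEntropy_add_energyIntegral_eq_zero h hopen hcont hpos hx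
    (hmax.trans (hM.pressure_energy_eq_zero hcontr hopen hcont hpos hx hμ hH))
  have := Measure.isProbabilityMeasure_map (μ := Λ) (measurable_codingMap (𝓜 := 𝓜) x).aemeasurable
  have hmap : Λ.map (𝓜.codingMap x) = μ := eq_of_invariant hcontr hirr hdini hpos
    (hlaw.invariant_map_codingMap h hcontr hopen hpos hx hY) hμ
  have hΛ := hlaw.isGeneralizedMarkovMeasure h hcontr hopen hpos hx hY
  rw [hmap] at hΛ
  exact hΛ.eq hM

end IsGeneralizedMarkovMeasure

end MarkovSystem

theorem corollary1 {K V E : Type*} [MetricSpace K] [ProperSpace K] [Nonempty K]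
    [MeasurableSpace K] [BorelSpace K] [Fintype V] [Fintype E]
    [MeasurableSpace E] [DiscreteMeasurableSpace E]
    (𝓜 : MarkovSystem K V E)
    (hopen : ∀ v, IsOpen (𝓜.cell v))
    (hcontr : 𝓜.IsContractive)
    (hirr : 𝓜.IsIrreducible)
    (hdini : ∀ e, DiniContinuousOn (𝓜.p e) (𝓜.cell (𝓜.init e)))
    (hpos : ∀ e, ∃ δ : ℝ, 0 < δ ∧ ∀ y ∈ 𝓜.cell (𝓜.init e), δ ≤ 𝓜.p e y)
    (x : V → K) (hx : ∀ v, x v ∈ 𝓜.cell v) :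
    IsEnergyFunction (𝓜.energy x) ∧
    (∃! μ : Measure K, 𝓜.IsInvariantMeasure μ) ∧
    ∀ μ : Measure K, 𝓜.IsInvariantMeasure μ →
      (∃! M : Measure (ℤ → E), 𝓜.IsGeneralizedMarkovMeasure μ M) ∧
      ∀ M : Measure (ℤ → E), 𝓜.IsGeneralizedMarkovMeasure μ M →
        (IsEquilibriumState leftShift (𝓜.energy x) M ∧
          ∀ Λ : Measure (ℤ → E), IsEquilibriumState leftShift (𝓜.energy x) Λ → Λ = M) ∧
        pressure (leftShift : (ℤ → E) → (ℤ → E)) (𝓜.energy x) = 0 ∧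
        ((∀ᵐ σ ∂M, σ ∈ 𝓜.codingDomain x) ∧ M.map (𝓜.codingMap x) = μ) ∧
        ksEntropy leftShift M =
          ((-∑ e, ∫ y in 𝓜.cell (𝓜.init e), 𝓜.p e y * Real.log (𝓜.p e y) ∂μ : ℝ) : EReal) := by
  have hcont := MarkovSystem.continuous_p hopen hdini
  obtain ⟨μ₀, hprob, hinv, hH⟩ := MarkovSystem.exists_invariant hcontr hopen hdini hpos hx
  have huniq : ∀ μ, 𝓜.IsInvariantMeasure μ → μ = μ₀ := fun μ hμ => by
    obtain ⟨_, hμ⟩ := (𝓜.isInvariantMeasure_iff μ).1 hμ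
    exact MarkovSystem.eq_of_invariant hcontr hirr hdini hpos hμ hinv
  refine ⟨MarkovSystem.isEnergyFunction_energy x,
    ⟨μ₀, (𝓜.isInvariantMeasure_iff μ₀).2 ⟨hprob, hinv⟩, huniq⟩, fun μ hμ => ?_⟩
  obtain rfl := huniq μ hμ
  obtain ⟨M₀, hM₀⟩ := MarkovSystem.exists_isGeneralizedMarkovMeasure (E := E) hinv
  refine ⟨⟨M₀, hM₀, fun M hM => hM.eq hM₀⟩, fun M hM => ⟨⟨?_, fun Λ hΛ => ?_⟩, ?_, ⟨?_, ?_⟩, ?_⟩⟩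
  · exact hM.isEquilibriumState hcontr hopen hcont hpos hx hinv hH
  · exact hM.eq_of_isEquilibriumState hcontr hirr hopen hdini hpos hx hinv hH hΛ
  · exact hM.pressure_energy_eq_zero hcontr hopen hcont hpos hx hinv hH
  · exact hM.ae_mem_codingDomain hcontr hopen hx hinv hH
  · exact hM.map_codingMap hcontr hopen hx hinv hH
  · rw [hM.ksEntropy_eq hcontr hopen hcont hpos hx hinv hH, MarkovSystem.integral_pointEntropy]
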